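/- **Model.** Let $G$ be a graph on the criteria $[k]=\{1,\dots,k\}$, $k\ge 1$. The states are the independent sets $s$ of $G$ (the sets of fixed criteria); the initial state is $\emptyset$. The actions are: do nothing; fix a criterion $i$, which adds $i$ to $s$, removes all neighbours of $i$ from $s$ and costs $c_i\in[0,c]$; unfix a criterion $i$, which removes $i$ from $s$ at no cost. Let $\mathcal C=\{C_1,\dots,C_n\}$ be distinct subsets of $[k]$ (correlation sets). If $s$ is the state at the end of time step $t$, each criterion $i$ incurs a loss $\ell_{t,i}^{s}\in[0,B]$, which is observed. The loss vectors of different time steps are independent, and $$\mathbb E\,\ell_{t,i}^{s}=\mu_i^s=\sum_{j:\,i\in C_j}\theta_j(s\cap C_j)$$ with unknown parameters $\theta_j$. The loss of a time step is the cost of its action plus $\sum_i\ell_{t,i}^{s}$ for the state $s$ reached. Let $g(s)=\sum_i\mu_i^s$. An optimal policy $\pi^*$ is a stationary policy that moves from $\emptyset$ to a state minimizing $g$ and stays there forever. The pseudo-regret over $T$ time steps is the expected total loss of the algorithm minus the expected total loss of $\pi^*$. **Algorithm.** Let $S_i$ consist of $i$ and all criteria that share a correlation set with $i$; the local configuration of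 $s$ at $i$ is $s\cap S_i$. Let $\tau_i^{b}$ be the number of time steps so far that ended in a state with local configuration $b$ at $i$, let $\hat\gamma_i^{b}$ be the average loss of $i$ observed in them, and let $$\tilde\gamma_i^{b}=\hat\gamma_i^{b}-10B\sqrt{\frac{m\log(kT/\delta)}{\tau_i^{b}}}$$ (and $0$ if $\tau_i^b=0$). A cover is a finite list of states in which every local configuration (at every $i$) of every state occurs. The optimization oracle returns, for given $(\gamma_i^{b})$, a state minimizing $\sum_i\gamma_i^{s\cap S_i}$. The algorithm first moves to each state of a cover and waits there for one time step. Then it works in episodes: it calls the oracle with the current $\tilde\gamma$ to get a state $s$, puts $t(h)=\min_i\tau_i^{s\cap S_i}$, moves to $s$ (first unfixing the criteria not in $s$, then fixing the missing ones, which takes at most $k$ time steps), and stays in $s$ for $t(h)$ time steps. **Theorem.** Let $D\ge1$ be an integer. Suppose that $m\ge1$, that all correlation sets have size at most $m$, and that each criterion lies in at most $D\log_2k$ of them. 1. For every $E$ there is a constant $A$, depending only on $D$ and $E$, such that for all $T\ge2$ and all $B\ge 0$, $c$ with $c+B\ge1$, the algorithm with any cover of at most $E\,k^{Dm+1}$ states,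 $\delta=T^{-4}$ and any (measurable) oracle has losses of finite expectation and pseudo-regret at most $$A\,m\,k^{2Dm+2}(c+B)^2\sqrt T\,\log T .$$ 2. There are a program for a real random access machine with the optimization oracle, and constants $E,q$ depending only on $D$, such that for every problem instance there is a cover of at most $E\,k^{Dm+1}$ states for which the program, given the graph, the correlation sets, the fixing costs and $m,T,B,\delta$, computes the actions of the algorithm with this cover (including the computation of the cover) on every sequence of losses, making at most $E\,(k^{m+1})^q$ elementary steps before each action. (Elementary steps: array access; addition and truncated subtraction of natural numbers; addition, subtraction, multiplication, division, square root and logarithm of real numbers; comparisons; loop passes; an oracle call counts as one step.) For $D=1$ the bounds read: covers of size $O(k^{m+1})$ and pseudo-regret $O(m\,k^{2m+2}(c+B)^2\sqrt T\log T)$. -/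

import Mathlib

open MeasureTheory ProbabilityTheory

noncomputable section

namespace FairnessMDP

/-! ### The Markov decision process -/

/-- Actions: wait, fix a criterion, or withdraw the fix of a criterion. -/
inductive Action (k : ℕ) : Type
  | null : Action k
  | fix (i : Fin k) : Action k
  | unfix (i : Fin k) : Action k

/-- The data known to the learner: the incompatibility graph on the criteria `0, …, k - 1`, the
correlation sets `corr 0, …, corr (n - 1)` and the fixing costs. A configuration of the criteria is
written as the set of those that are fixed. -/
structure Problem (k n : ℕ) where
  graph : SimpleGraph (Fin k)
  corr : Fin n → Finset (Fin k)
  fixCost : Fin k → ℝ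

namespace Problem

variable {k n : ℕ}

/-- `s` is a state of the process iff the fixed criteria are pairwise compatible. -/
def IsState (P : Problem k n) (s : Finset (Fin k)) : Prop :=
  P.graph.IsIndepSet (s : Set (Fin k))

open Classical in
/-- Deterministic transitions: fixing `i` unfixes all neighbours of `i`. -/
def next (P : Problem k n) (s : Finset (Fin k)) : Action k → Finset (Fin k)
  | .null => s
  | .fix i => insert i (s.filter fun j => ¬ P.graph.Adj i j)
  | .unfix i => s.erase i

/-- Cost of an action; only fixing a criterion costs something. -/
def cost (P : Problem k n) : Action k → ℝ
  | .null => 0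
  | .fix i => P.fixCost i
  | .unfix _ => 0

/-- Expected loss of criterion `i` in state `s`: every correlation set `j` containing `i`
contributes `θ j u`, where `u` is the configuration of `s` on that set. -/
def meanLoss (P : Problem k n) (θ : Fin n → Finset (Fin k) → ℝ) (s : Finset (Fin k))
    (i : Fin k) : ℝ :=
  ∑ j, if i ∈ P.corr j then θ j (s ∩ P.corr j) else 0

/-- `s` is a state of least expected loss per time step. -/
def IsBestState (P : Problem k n) (θ : Fin n → Finset (Fin k) → ℝ) (s : Finset (Fin k)) : Prop :=
  P.IsState s ∧ ∀ s', P.IsState s' → ∑ i, P.meanLoss θ s i ≤ ∑ i, P.meanLoss θ s' i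

/-- The correlation sets are distinct, have at most `m` elements, and every criterion lies in at
most `D * log₂ k` of them. -/
structure IsSparse (P : Problem k n) (m D : ℕ) : Prop where
  injective : Function.Injective P.corr
  card_le : ∀ j, (P.corr j).card ≤ m
  degree_le : ∀ i, ((Finset.univ.filter fun j => i ∈ P.corr j).card : ℝ) ≤ D * Real.logb 2 k

/-- The losses: `ℓ t s i` is the loss of criterion `i` if the process is in state `s` at the end
of time step `t`. The loss vectors of different time steps are independent; within a time step
the losses may depend on each other in any way. -/
structure IsLossModel {Ω : Type*} [MeasurableSpace Ω] (P : Problem k n)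
    (θ : Fin n → Finset (Fin k) → ℝ) (B : ℝ) (Pr : Measure Ω)
    (ℓ : ℕ → Finset (Fin k) → Fin k → Ω → ℝ) : Prop where
  measurable : ∀ t s i, Measurable (ℓ t s i)
  mem_Icc : ∀ t s i, P.IsState s → ∀ᵐ ω ∂Pr, ℓ t s i ω ∈ Set.Icc 0 B
  mean : ∀ t s i, P.IsState s → ∫ ω, ℓ t s i ω ∂Pr = P.meanLoss θ s i
  indep : iIndepFun (fun t ω (p : Finset (Fin k) × Fin k) => ℓ t p.1 p.2 ω) Pr

/-! ### Policies -/

/-- The state in which a stationary policy is after `t` time steps. -/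
def policyState (P : Problem k n) (π : Finset (Fin k) → Action k) : ℕ → Finset (Fin k)
  | 0 => ∅
  | t + 1 => P.next (P.policyState π t) (π (P.policyState π t))

/-- The policy moves from the initial state to a best state and remains there forever. -/
def IsOptimalPolicy (P : Problem k n) (θ : Fin n → Finset (Fin k) → ℝ)
    (π : Finset (Fin k) → Action k) : Prop :=
  ∃ s, P.IsBestState θ s ∧ π s = .null ∧ ∃ t, P.policyState π t = s

/-- Loss of a policy in time step `t`, for the realized losses `x`. -/
def policyLoss (P : Problem k n) (π : Finset (Fin k) → Action k)
    (x : ℕ → Finset (Fin k) → Fin k → ℝ) (t : ℕ) : ℝ :=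
  P.cost (π (P.policyState π t)) + ∑ i, x t (P.policyState π (t + 1)) i

/-! ### The episodic optimistic algorithm -/

open Classical in
/-- The criterion `i` together with the criteria it shares a correlation set with. The local
configuration of a state `s` at `i` is `s ∩ P.scope i`. -/
def scope (P : Problem k n) (i : Fin k) : Finset (Fin k) :=
  insert i (Finset.univ.filter fun j => ∃ l, i ∈ P.corr l ∧ j ∈ P.corr l)

/-- A list of states in which every local configuration of every state occurs. -/
def IsCover (P : Problem k n) (K : List (Finset (Fin k))) : Prop :=
  (∀ s ∈ K, P.IsState s) ∧
    ∀ s, P.IsState s → ∀ i, ∃ s' ∈ K, s' ∩ P.scope i = s ∩ P.scope i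

/-- `O` is an exact optimization oracle: for all parameters `γ i b` (one for every criterion `i`
and every local configuration `b` at `i`) it returns a state minimizing the total loss. -/
def IsOracle (P : Problem k n) (O : (Fin k → Finset (Fin k) → ℝ) → Finset (Fin k)) : Prop :=
  ∀ γ, P.IsState (O γ) ∧ ∀ s, P.IsState s →
    ∑ i, γ i (O γ ∩ P.scope i) ≤ ∑ i, γ i (s ∩ P.scope i)

/-- Number of observed time steps in which the local configuration at `i` was `b`. -/
def visits (P : Problem k n) (seen : List (Finset (Fin k) × (Fin k → ℝ))) (i : Fin k)
    (b : Finset (Fin k)) : ℕ :=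
  (seen.filter fun p => p.1 ∩ P.scope i = b).length

/-- Total loss of criterion `i` observed in these time steps. -/
def lossSum (P : Problem k n) (seen : List (Finset (Fin k) × (Fin k → ℝ))) (i : Fin k)
    (b : Finset (Fin k)) : ℝ :=
  ((seen.filter fun p => p.1 ∩ P.scope i = b).map fun p => p.2 i).sum

end Problem

/-- Numerical parameters of the algorithm: the bound `m` on the size of the correlation sets, the
horizon `T`, the bound `B` on the losses and the confidence parameter `δ`. -/
structure Params where
  m : ℕ
  T : ℕ
  B : ℝ
  δ : ℝ

/-- What the algorithm keeps between two time steps: the current state, the states and loss vectors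
observed so far (latest first), the states of the cover that are still to be visited, the state it
is heading for, and the number of time steps it still has to stay there after its arrival. -/
structure Memory (k : ℕ) where
  state : Finset (Fin k)
  seen : List (Finset (Fin k) × (Fin k → ℝ))
  todo : List (Finset (Fin k))
  target : Finset (Fin k)
  stay : ℕ

/-- One time step of the way from `s` to `s'`: first unfix what is not fixed in `s'`, then fix
what is missing. The whole way takes at most `k` time steps. -/
def moveAction {k : ℕ} (s s' : Finset (Fin k)) : Action k :=
  if h : (s \ s').Nonempty then .unfix ((s \ s').min' h)
  else if h : (s' \ s).Nonempty then .fix ((s' \ s).min' h)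
  else .null

namespace Problem

variable {k n : ℕ}

/-- Optimistic estimate (lower confidence bound) of the parameter of the local configuration `b`
at `i`. It is `0` as long as `b` has not been observed. -/
def optimistic (P : Problem k n) (p : Params) (seen : List (Finset (Fin k) × (Fin k → ℝ)))
    (i : Fin k) (b : Finset (Fin k)) : ℝ :=
  P.lossSum seen i b / P.visits seen i b
    - 10 * p.B * √(p.m * Real.log (k * p.T / p.δ) / P.visits seen i b)

/-- If the last visit is completed, choose the next one: the next state of the cover, for one time
step, or, once the cover is exhausted, the answer `s` of the oracle to the optimistic estimates,
for as many time steps as the least visited local configuration of `s` has been visited. -/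
def plan (P : Problem k n) (p : Params) (O : (Fin k → Finset (Fin k) → ℝ) → Finset (Fin k))
    (M : Memory k) : Memory k :=
  if M.state = M.target ∧ M.stay = 0 then
    match M.todo with
    | s :: rest => { M with todo := rest, target := s, stay := 1 }
    | [] =>
      { M with
        target := O (P.optimistic p M.seen)
        stay := ⨅ i, P.visits M.seen i (O (P.optimistic p M.seen) ∩ P.scope i) }
  else M

/-- Carry out one time step towards, or in, the target; `x` gives the losses. -/
def perform (P : Problem k n) (M : Memory k) (x : Finset (Fin k) → Fin k → ℝ) : Memory k :=
  let s := P.next M.state (moveAction M.state M.target)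
  { state := s
    seen := (s, x s) :: M.seen
    todo := M.todo
    target := M.target
    stay := if M.state = M.target then M.stay - 1 else M.stay }

/-- Memory after `t` time steps, if the losses are `x` and the cover is `K`. The losses of states
other than the ones visited have no influence. -/
def run (P : Problem k n) (p : Params) (K : List (Finset (Fin k)))
    (O : (Fin k → Finset (Fin k) → ℝ) → Finset (Fin k))
    (x : ℕ → Finset (Fin k) → Fin k → ℝ) : ℕ → Memory k
  | 0 => { state := ∅, seen := [], todo := K, target := ∅, stay := 0 }
  | t + 1 => P.perform (P.plan p O (P.run p K O x t)) (x t)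

/-- Action of the algorithm in time step `t`. -/
def action (P : Problem k n) (p : Params) (K : List (Finset (Fin k)))
    (O : (Fin k → Finset (Fin k) → ℝ) → Finset (Fin k))
    (x : ℕ → Finset (Fin k) → Fin k → ℝ) (t : ℕ) : Action k :=
  let M := P.plan p O (P.run p K O x t)
  moveAction M.state M.target

/-- Loss of the algorithm in time step `t`. -/
def algLoss (P : Problem k n) (p : Params) (K : List (Finset (Fin k)))
    (O : (Fin k → Finset (Fin k) → ℝ) → Finset (Fin k))
    (x : ℕ → Finset (Fin k) → Fin k → ℝ) (t : ℕ) : ℝ :=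
  P.cost (P.action p K O x t) + ∑ i, x t (P.run p K O x (t + 1)).state i

/-- Pseudo-regret over `p.T` time steps with respect to the policy `π`. -/
def pseudoRegret {Ω : Type*} [MeasurableSpace Ω] (P : Problem k n) (p : Params)
    (K : List (Finset (Fin k))) (O : (Fin k → Finset (Fin k) → ℝ) → Finset (Fin k))
    (π : Finset (Fin k) → Action k) (Pr : Measure Ω)
    (ℓ : ℕ → Finset (Fin k) → Fin k → Ω → ℝ) : ℝ :=
  ∑ t ∈ Finset.range p.T, ∫ ω, P.algLoss p K O (fun t s i => ℓ t s i ω) t ∂Pr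
    - ∑ t ∈ Finset.range p.T, ∫ ω, P.policyLoss π (fun t s i => ℓ t s i ω) t ∂Pr

end Problem

/-! ### Running time: a random access machine over the reals with an oracle

A store consists of numbered two-dimensional arrays of natural numbers and of real numbers. A
program is an imperative program with bounded loops; every operation on numbers, every access to
an array, every test, every pass through a loop and every oracle call is one step. There is no
multiplication of natural numbers and no rounding of real numbers. -/

/-- The memory: `nat a i j` and `real a i j` are the entries `(i, j)` of the arrays number `a`. -/
structure Store where
  nat : ℕ → ℕ → ℕ → ℕ
  real : ℕ → ℕ → ℕ → ℝ

inductive NatExpr : Type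
  | const (c : ℕ) : NatExpr
  | read (a : ℕ) (i j : NatExpr) : NatExpr
  | plus (e f : NatExpr) : NatExpr
  | minus (e f : NatExpr) : NatExpr

inductive RealExpr : Type
  | cast (e : NatExpr) : RealExpr
  | read (a : ℕ) (i j : NatExpr) : RealExpr
  | plus (e f : RealExpr) : RealExpr
  | minus (e f : RealExpr) : RealExpr
  | times (e f : RealExpr) : RealExpr
  | over (e f : RealExpr) : RealExpr
  | sqrt (e : RealExpr) : RealExpr
  | log (e : RealExpr) : RealExpr

inductive Test : Type
  | natLE (e f : NatExpr) : Test
  | realLE (e f : RealExpr) : Test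

inductive Cmd : Type
  | skip : Cmd
  | setNat (a : ℕ) (i j e : NatExpr) : Cmd
  | setReal (a : ℕ) (i j : NatExpr) (e : RealExpr) : Cmd
  | seq (c d : Cmd) : Cmd
  | ite (b : Test) (c d : Cmd) : Cmd
  | loop (e : NatExpr) (c : Cmd) : Cmd
  | oracle : Cmd

def NatExpr.eval (σ : Store) : NatExpr → ℕ
  | .const c => c
  | .read a i j => σ.nat a (i.eval σ) (j.eval σ)
  | .plus e f => e.eval σ + f.eval σ
  | .minus e f => e.eval σ - f.eval σ

def NatExpr.steps : NatExpr → ℕ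
  | .const _ => 1
  | .read _ i j => i.steps + j.steps + 1
  | .plus e f => e.steps + f.steps + 1
  | .minus e f => e.steps + f.steps + 1

def RealExpr.eval (σ : Store) : RealExpr → ℝ
  | .cast e => (e.eval σ : ℝ)
  | .read a i j => σ.real a (i.eval σ) (j.eval σ)
  | .plus e f => e.eval σ + f.eval σ
  | .minus e f => e.eval σ - f.eval σ
  | .times e f => e.eval σ * f.eval σ
  | .over e f => e.eval σ / f.eval σ
  | .sqrt e => √(e.eval σ)
  | .log e => Real.log (e.eval σ)

def RealExpr.steps : RealExpr → ℕ
  | .cast e => e.steps + 1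
  | .read _ i j => i.steps + j.steps + 1
  | .plus e f => e.steps + f.steps + 1
  | .minus e f => e.steps + f.steps + 1
  | .times e f => e.steps + f.steps + 1
  | .over e f => e.steps + f.steps + 1
  | .sqrt e => e.steps + 1
  | .log e => e.steps + 1

def Test.Holds (σ : Store) : Test → Prop
  | .natLE e f => e.eval σ ≤ f.eval σ
  | .realLE e f => e.eval σ ≤ f.eval σ

def Test.steps : Test → ℕ
  | .natLE e f => e.steps + f.steps + 1
  | .realLE e f => e.steps + f.steps + 1

def Store.writeNat (σ : Store) (a i j v : ℕ) : Store :=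
  { σ with nat := fun a' i' j' => if a' = a ∧ i' = i ∧ j' = j then v else σ.nat a' i' j' }

def Store.writeReal (σ : Store) (a i j : ℕ) (v : ℝ) : Store :=
  { σ with real := fun a' i' j' => if a' = a ∧ i' = i ∧ j' = j then v else σ.real a' i' j' }

/-- A set of criteria as a natural number in binary. -/
def mask {k : ℕ} (b : Finset (Fin k)) : ℕ := ∑ i ∈ b, 2 ^ (i : ℕ)

/-- An oracle call reads the parameter `γ i b` in entry `(i, mask b)` of real array `3` and puts
the answer, as a vector of bits, into the entries `(i, 0)`, `i < k`, of natural array `4`. -/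
def Store.callOracle {k : ℕ} (O : (Fin k → Finset (Fin k) → ℝ) → Finset (Fin k))
    (σ : Store) : Store :=
  { σ with
    nat := fun a i j =>
      if h : a = 4 ∧ i < k ∧ j = 0 then
        if (⟨i, h.2.1⟩ : Fin k) ∈ O (fun i b => σ.real 3 i (mask b)) then 1 else 0
      else σ.nat a i j }

open Classical in
/-- Final store and number of steps of a program. -/
def Cmd.eval {k : ℕ} (O : (Fin k → Finset (Fin k) → ℝ) → Finset (Fin k)) :
    Cmd → Store → Store × ℕ
  | .skip, σ => (σ, 1)
  | .setNat a i j e, σ =>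
      (σ.writeNat a (i.eval σ) (j.eval σ) (e.eval σ), i.steps + j.steps + e.steps + 1)
  | .setReal a i j e, σ =>
      (σ.writeReal a (i.eval σ) (j.eval σ) (e.eval σ), i.steps + j.steps + e.steps + 1)
  | .seq c d, σ =>
      let r := c.eval O σ
      let r' := d.eval O r.1
      (r'.1, r.2 + r'.2)
  | .ite b c d, σ =>
      let r := if b.Holds σ then c.eval O σ else d.eval O σ
      (r.1, b.steps + r.2)
  | .loop e c, σ =>
      (fun q : Store × ℕ =>
        let r := c.eval O q.1
        (r.1, q.2 + r.2 + 1))^[e.eval σ] (σ, e.steps + 1)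
  | .oracle, σ => (σ.callOracle O, 1)

/-- A program that interacts with the environment: `setup` is run at the beginning and determines
the first action; after each time step the observed losses are supplied, and `round` is run and
determines the next action. -/
structure OnlineProgram where
  setup : Cmd
  round : Cmd

open Classical in
/-- The input. Natural arrays: `0` holds `k, n, m, T`, array `1` the adjacency matrix of the graph,
array `2` the incidence matrix of the correlation sets. Real arrays: `0` holds `B, δ`, array `1`
the fixing costs. All other entries are zero. -/
def inputStore {k n : ℕ} (P : Problem k n) (p : Params) : Store where
  nat := fun a i j =>
    if a = 0 ∧ i = 0 then
      (if j = 0 then k else if j = 1 then n else if j = 2 then p.m else if j = 3 then p.T else 0)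
    else if a = 1 then
      (if ∃ (u v : Fin k), (u : ℕ) = i ∧ (v : ℕ) = j ∧ P.graph.Adj u v then 1 else 0)
    else if a = 2 then
      (if ∃ (l : Fin n) (u : Fin k), (l : ℕ) = i ∧ (u : ℕ) = j ∧ u ∈ P.corr l then 1 else 0)
    else 0
  real := fun a i j =>
    if a = 0 ∧ i = 0 then (if j = 0 then p.B else if j = 1 then p.δ else 0)
    else if a = 1 ∧ j = 0 then (if h : i < k then P.fixCost ⟨i, h⟩ else 0)
    else 0

/-- The observed losses are supplied in the entries `(i, 0)`, `i < k`, of real array `2`. -/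
def Store.supply {k : ℕ} (σ : Store) (y : Fin k → ℝ) : Store :=
  { σ with
    real := fun a i j => if h : a = 2 ∧ i < k ∧ j = 0 then y ⟨i, h.2.1⟩ else σ.real a i j }

/-- Store when the action of time step `t` is announced, and number of steps made since the losses
of the previous time step were supplied (since the start, if `t = 0`), for observed losses `y`. -/
def OnlineProgram.exec {k : ℕ} (prog : OnlineProgram)
    (O : (Fin k → Finset (Fin k) → ℝ) → Finset (Fin k)) (σ : Store) (y : ℕ → Fin k → ℝ) :
    ℕ → Store × ℕ
  | 0 => prog.setup.eval O σ
  | t + 1 => prog.round.eval O ((prog.exec O σ y t).1.supply (y t))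

/-- The action announced in a store: entry `(0, 0)` of natural array `3` holds its kind, entry
`(0, 1)` the criterion it applies to. -/
def Store.Announces {k : ℕ} (σ : Store) : Action k → Prop
  | .null => σ.nat 3 0 0 = 0
  | .fix i => σ.nat 3 0 0 = 1 ∧ σ.nat 3 0 1 = i
  | .unfix i => σ.nat 3 0 0 = 2 ∧ σ.nat 3 0 1 = i

/-- On every sequence of losses and in every time step the program takes the action of the
algorithm with cover `K`, after at most `N` steps since the previous time step. -/
def OnlineProgram.Implements {k n : ℕ} (prog : OnlineProgram) (P : Problem k n) (p : Params)
    (K : List (Finset (Fin k))) (O : (Fin k → Finset (Fin k) → ℝ) → Finset (Fin k))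
    (N : ℝ) : Prop :=
  ∀ (x : ℕ → Finset (Fin k) → Fin k → ℝ) (t : ℕ),
    let y : ℕ → Fin k → ℝ := fun t => x t (P.run p K O x (t + 1)).state
    let r := prog.exec O (inputStore P p) y t
    r.1.Announces (P.action p K O x t) ∧ (r.2 : ℝ) ≤ N

end FairnessMDP

end

noncomputable section
namespace FairnessMDP

variable {k n : ℕ}

/-! ### Moves -/

/-! Regret. No policy can lose less in a time step, in expectation, than the minimum of `g`: costs
are nonnegative and only independent sets are visited. So the pseudo-regret is at most the
expectation of the sum over time of action cost plus Δ(s), where Δ(s) = g(s) - min g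
(`pseudoRegret_le_integral`). Here it is essential that the state reached in a time step is
determined before the losses of that step, which are independent of the past (`integral_mul`).

Along a single run, a step contributes at most W = c + kB, and the cover is finished within (k +
1)|K| steps. From then on every local configuration has been observed. An episode with target s has
at most k moves and a stay of h steps, where h is the least count among the local configurations of
s; so this count at least doubles. Let N be the sum of 2^|S_i|, which is at most 2k^(Dm)
(`sum_two_pow_card_scope_le`). The sum of the logarithms of all N counts rises by log 2 per finished
episode, which pays for the moves: Wk N log T / log 2 in total. If the empirical means are accurate,
optimism gives Δ(s)√h ≤ G with G = 20Bk√L and L = m log(kT/δ) (`Accurate.gap_le`). The stay then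
contributes at most G√h, and the sum of the square roots of the counts rises by at least √h/3, so
all stays together contribute at most 3GN√T. Both sums enter `potential`; the invariants
`CoverPhase` and `EpisodePhase` turn this into `sum_regret_le`.

Accuracy is not a plain Hoeffding bound, since the algorithm decides what is sampled. For each local
configuration the exponential of r · deviation - r²B²/8 · count has expectation at most 1
(`integral_exp_deviation`). Markov's inequality and a union bound over time, criterion,
configuration and count follow. For δ = T^(-4) the failure probability is negligible even against
the trivial regret TW, and `regret_bound` collects the terms.

Running time. For every criterion, all independent subsets of its scope are produced by fixing the
members of the scope in order; these at most N states form a cover (`isCover_coverStates`). The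
program maintains tables of counts, loss sums and estimates indexed by binary masks, and a round
changes one entry per criterion. Correctness is shown in a Hoare logic whose triples `Spec` also
carry the step bound `Cmd.bound L`, where L limits the passes of every loop. This bound is
polynomial in L (`exists_bound_le`), and all loops have k, n or at most 2^|S_i| passes, which is
polynomial in k^(m+1) for fixed D. -/

theorem moveAction_cases (s s' : Finset (Fin k)) :
    (∃ i ∈ s \ s', (∀ j ∈ s \ s', i ≤ j) ∧ moveAction s s' = .unfix i) ∨
    (s ⊆ s' ∧ ∃ i ∈ s' \ s, (∀ j ∈ s' \ s, i ≤ j) ∧ moveAction s s' = .fix i) ∨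
    (s = s' ∧ moveAction s s' = .null) := by
  unfold moveAction
  by_cases h : (s \ s').Nonempty
  · left
    exact ⟨_, Finset.min'_mem _ h, fun j hj => Finset.min'_le _ _ hj, by simp [h]⟩
  · right
    have hs : s ⊆ s' := by
      rwa [Finset.not_nonempty_iff_eq_empty, Finset.sdiff_eq_empty_iff_subset] at h
    by_cases h' : (s' \ s).Nonempty
    · left
      exact ⟨hs, _, Finset.min'_mem _ h', fun j hj => Finset.min'_le _ _ hj, by simp [h, h']⟩
    · right
      have hs' : s' ⊆ s := by
        rwa [Finset.not_nonempty_iff_eq_empty, Finset.sdiff_eq_empty_iff_subset] at h'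
      exact ⟨hs.antisymm hs', by simp [h, h']⟩

/-- The number of criteria in which two configurations differ. -/
def distance (s s' : Finset (Fin k)) : ℕ := (s \ s').card + (s' \ s).card

theorem distance_self (s : Finset (Fin k)) : distance s s = 0 := by simp [distance]

theorem distance_le (s s' : Finset (Fin k)) : distance s s' ≤ k := by
  unfold distance
  rw [← Finset.card_union_of_disjoint disjoint_sdiff_sdiff]
  simpa using Finset.card_le_univ ((s \ s') ∪ (s' \ s))

namespace Problem

theorem isState_empty (P : Problem k n) : P.IsState ∅ := by simp [IsState]

theorem IsState.mono {P : Problem k n} {s s' : Finset (Fin k)} (h : P.IsState s) (hs : s' ⊆ s) :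
    P.IsState s' :=
  Set.Pairwise.mono (by exact_mod_cast hs) h

theorem IsState.next {P : Problem k n} {s : Finset (Fin k)} (h : P.IsState s) (a : Action k) :
    P.IsState (P.next s a) := by
  cases a with
  | null => exact h
  | unfix i => exact h.mono (Finset.erase_subset _ _)
  | fix i =>
    intro u hu v hv huv
    simp only [Problem.next, Finset.coe_insert, Finset.coe_filter, Set.mem_insert_iff,
      Set.mem_ofPred_eq] at hu hv
    rcases hu with rfl | hu <;> rcases hv with rfl | hv
    · exact absurd rfl huv
    · exact hv.2
    · exact fun h' => hu.2 h'.symm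
    · exact h hu.1 hv.1 huv

theorem next_fix_eq_insert {P : Problem k n} {s s' : Finset (Fin k)} {i : Fin k}
    (h : P.IsState s') (hs : s ⊆ s') (hi : i ∈ s') : P.next s (.fix i) = insert i s := by
  simp only [Problem.next]
  ext j
  have : j ∈ s → ¬ P.graph.Adj i j := fun hj hij =>
    h (by exact_mod_cast hi) (by exact_mod_cast hs hj) hij.ne hij
  simp only [Finset.mem_insert, Finset.mem_filter]
  tauto

/-- Withdrawals come first, so whenever a criterion is fixed the current state is a subset of the
independent target. No neighbour is then lost, and each step repairs exactly one difference. -/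
theorem distance_next {P : Problem k n} {s s' : Finset (Fin k)} (h : P.IsState s') (hne : s ≠ s') :
    distance (P.next s (moveAction s s')) s' + 1 = distance s s' := by
  rcases moveAction_cases s s' with ⟨i, hi, -, hm⟩ | ⟨hs, i, hi, -, hm⟩ | ⟨he, -⟩
  · rw [hm]
    rw [Finset.mem_sdiff] at hi
    have h1 : s.erase i \ s' = (s \ s').erase i := Finset.erase_sdiff_comm _ _ _
    have h2 : s' \ s.erase i = s' \ s := by
      ext j
      simp only [Finset.mem_sdiff, Finset.mem_erase]
      grind
    have h3 := Finset.card_erase_add_one (s := s \ s') (a := i) (by simp [hi])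
    simp only [Problem.next, distance, h1, h2]
    omega
  · rw [hm, Finset.mem_sdiff] at *
    rw [next_fix_eq_insert h hs hi.1]
    have h1 : insert i s \ s' = s \ s' := Finset.insert_sdiff_of_mem _ hi.1
    have h2 : s' \ insert i s = (s' \ s).erase i := by
      ext j
      simp only [Finset.mem_sdiff, Finset.mem_erase, Finset.mem_insert]
      grind
    have h3 := Finset.card_erase_add_one (s := s' \ s) (a := i) (by simp [hi])
    simp only [distance, h1, h2]
    omega
  · exact absurd he hne

theorem next_moveAction_self (P : Problem k n) (s : Finset (Fin k)) :
    P.next s (moveAction s s) = s := by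
  simp [moveAction, Problem.next]

theorem cost_nonneg {P : Problem k n} (h : ∀ i, 0 ≤ P.fixCost i) (a : Action k) :
    0 ≤ P.cost a := by
  cases a <;> simp [cost, h]

theorem cost_le {P : Problem k n} {c : ℝ} (hc : 0 ≤ c) (h : ∀ i, P.fixCost i ≤ c) (a : Action k) :
    P.cost a ≤ c := by
  cases a <;> simp [cost, h, hc]

theorem cost_moveAction_self (P : Problem k n) (s : Finset (Fin k)) :
    P.cost (moveAction s s) = 0 := by
  simp [moveAction, cost]

/-! ### Local configurations -/

/-- Every correlation set containing `i` lies inside the scope of `i`. Hence observations made in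
different states with the same local configuration may be averaged. -/
theorem meanLoss_inter_scope (P : Problem k n) (θ : Fin n → Finset (Fin k) → ℝ)
    (s : Finset (Fin k)) (i : Fin k) :
    P.meanLoss θ (s ∩ P.scope i) i = P.meanLoss θ s i := by
  refine Finset.sum_congr rfl fun j _ => ?_
  split_ifs with h
  · congr 1
    ext u
    simp only [scope, Finset.mem_inter, Finset.mem_insert, Finset.mem_filter, Finset.mem_univ,
      true_and]
    exact ⟨fun hu => ⟨hu.1.1, hu.2⟩, fun hu => ⟨⟨hu.1, .inr ⟨j, h, hu.2⟩⟩, hu.2⟩⟩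
  · rfl

/-- Each of the `d` correlation sets through `i` adds at most `m - 1` further criteria to the scope,
and the logarithmic bound on `d` turns `2 ^ d` into at most `k ^ D`. -/
theorem two_pow_card_scope_le {P : Problem k n} {m D : ℕ} (hk : 1 ≤ k) (h : P.IsSparse m D)
    (i : Fin k) : (2 : ℝ) ^ (P.scope i).card ≤ 2 * (k : ℝ) ^ (D * (m - 1)) := by
  set d := (Finset.univ.filter fun j => i ∈ P.corr j).card with hd
  have hcard : (P.scope i).card ≤ d * (m - 1) + 1 := by
    have hsub : P.scope i ⊆ insert i ((Finset.univ.filter fun j => i ∈ P.corr j).biUnion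
        fun j => (P.corr j).erase i) := by
      intro u
      simp only [scope, Finset.mem_insert, Finset.mem_filter, Finset.mem_univ, true_and,
        Finset.mem_biUnion, Finset.mem_erase]
      grind
    refine (Finset.card_le_card hsub).trans ((Finset.card_insert_le _ _).trans ?_)
    refine Nat.add_le_add_right (Finset.card_biUnion_le_card_mul _ _ _ fun j hj => ?_) 1
    rw [Finset.mem_filter] at hj
    rw [Finset.card_erase_of_mem hj.2]
    exact Nat.sub_le_sub_right (h.card_le j) 1
  have hk' : (0 : ℝ) < k := by exact_mod_cast hk
  have hpow : (2 : ℝ) ^ d ≤ (k : ℝ) ^ D := by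
    rw [← Real.rpow_natCast, ← Real.rpow_natCast]
    calc (2 : ℝ) ^ (d : ℝ) ≤ 2 ^ (D * Real.logb 2 k) :=
          Real.rpow_le_rpow_of_exponent_le (by norm_num) (h.degree_le i)
      _ = (k : ℝ) ^ (D : ℝ) := by
          rw [mul_comm, Real.rpow_mul (by norm_num), Real.rpow_logb (by norm_num) (by norm_num) hk']
  calc (2 : ℝ) ^ (P.scope i).card ≤ 2 ^ (d * (m - 1) + 1) :=
        pow_le_pow_right₀ (by norm_num) hcard
    _ = 2 * (2 ^ d) ^ (m - 1) := by rw [pow_succ, pow_mul]; ring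
    _ ≤ 2 * ((k : ℝ) ^ D) ^ (m - 1) := by gcongr
    _ = 2 * (k : ℝ) ^ (D * (m - 1)) := by rw [pow_mul]

/-- Summation over `i` costs one more factor `k`, which fits into the exponent because `D ≥ 1`. -/
theorem sum_two_pow_card_scope_le {P : Problem k n} {m D : ℕ} (hk : 1 ≤ k) (hm : 1 ≤ m)
    (hD : 1 ≤ D) (h : P.IsSparse m D) :
    ∑ i, (2 : ℝ) ^ (P.scope i).card ≤ 2 * (k : ℝ) ^ (D * m) := by
  have hk' : (1 : ℝ) ≤ k := by exact_mod_cast hk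
  calc ∑ i, (2 : ℝ) ^ (P.scope i).card ≤ ∑ _i : Fin k, 2 * (k : ℝ) ^ (D * (m - 1)) :=
        Finset.sum_le_sum fun i _ => two_pow_card_scope_le hk h i
    _ = 2 * (k : ℝ) ^ (D * (m - 1) + 1) := by simp; ring
    _ ≤ 2 * (k : ℝ) ^ (D * m) := by
        have : D * (m - 1) + 1 ≤ D * m := by
          obtain ⟨m, rfl⟩ : ∃ m', m = m' + 1 := ⟨m - 1, by omega⟩
          simp only [Nat.add_sub_cancel]; nlinarith
        gcongr

/-! ### Observations -/

theorem visits_cons (P : Problem k n) (s : Finset (Fin k)) (y : Fin k → ℝ)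
    (seen : List (Finset (Fin k) × (Fin k → ℝ))) (i : Fin k) (b : Finset (Fin k)) :
    P.visits ((s, y) :: seen) i b = P.visits seen i b + if s ∩ P.scope i = b then 1 else 0 := by
  unfold visits
  rw [List.filter_cons]
  split_ifs with h1 h2 h2 <;> simp_all

theorem lossSum_cons (P : Problem k n) (s : Finset (Fin k)) (y : Fin k → ℝ)
    (seen : List (Finset (Fin k) × (Fin k → ℝ))) (i : Fin k) (b : Finset (Fin k)) :
    P.lossSum ((s, y) :: seen) i b = P.lossSum seen i b + if s ∩ P.scope i = b then y i else 0 := by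
  unfold lossSum
  rw [List.filter_cons]
  split_ifs with h1 h2 h2 <;> simp_all [add_comm]

theorem visits_le_length (P : Problem k n) (seen : List (Finset (Fin k) × (Fin k → ℝ)))
    (i : Fin k) (b : Finset (Fin k)) : P.visits seen i b ≤ seen.length :=
  List.length_filter_le _ _

theorem visits_pos_of_mem (P : Problem k n) {seen : List (Finset (Fin k) × (Fin k → ℝ))}
    {s : Finset (Fin k)} (h : s ∈ seen.map Prod.fst) (i : Fin k) :
    1 ≤ P.visits seen i (s ∩ P.scope i) := by
  obtain ⟨q, hq, rfl⟩ := List.mem_map.1 h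
  exact List.length_pos_of_mem (List.mem_filter.2 ⟨hq, by simp⟩)

/-- Every local configuration of every state has been observed. -/
def AllSeen (P : Problem k n) (seen : List (Finset (Fin k) × (Fin k → ℝ))) : Prop :=
  ∀ s, P.IsState s → ∀ i, 1 ≤ P.visits seen i (s ∩ P.scope i)

/-! ### The run of the algorithm -/

section Run

variable (P : Problem k n) (p : Params) (K : List (Finset (Fin k)))
  (O : (Fin k → Finset (Fin k) → ℝ) → Finset (Fin k)) (x : ℕ → Finset (Fin k) → Fin k → ℝ)

theorem plan_seen (M : Memory k) : (P.plan p O M).seen = M.seen := by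
  unfold plan; split_ifs
  · split <;> rfl
  · rfl

theorem run_seen_length (t : ℕ) : (P.run p K O x t).seen.length = t := by
  induction t with
  | zero => rfl
  | succ t ih => simp [run, perform, plan_seen, ih]

variable {P p K O x}

/-- The states the algorithm is in, is heading for, or will visit are states of the process. -/
def ValidMemory (P : Problem k n) (M : Memory k) : Prop :=
  P.IsState M.state ∧ P.IsState M.target ∧ ∀ s ∈ M.todo, P.IsState s

theorem ValidMemory.plan (hO : P.IsOracle O) {M : Memory k} (h : P.ValidMemory M) :
    P.ValidMemory (P.plan p O M) := by
  obtain ⟨h1, h2, h3⟩ := h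
  unfold Problem.plan
  split_ifs
  · split
    · next s rest hs =>
      rw [hs] at h3
      exact ⟨h1, h3 _ (by simp), fun s hs => h3 _ (by simp [hs])⟩
    · next hs => exact ⟨h1, (hO _).1, fun s hs' => h3 s hs'⟩
  · exact ⟨h1, h2, h3⟩

theorem ValidMemory.perform {M : Memory k} (h : P.ValidMemory M)
    (y : Finset (Fin k) → Fin k → ℝ) : P.ValidMemory (P.perform M y) :=
  ⟨h.1.next _, h.2.1, h.2.2⟩

theorem validMemory_run (hO : P.IsOracle O) (hK : ∀ s ∈ K, P.IsState s) (t : ℕ) :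
    P.ValidMemory (P.run p K O x t) := by
  induction t with
  | zero => exact ⟨P.isState_empty, P.isState_empty, hK⟩
  | succ t ih => exact (ih.plan hO).perform _

theorem isState_run (hO : P.IsOracle O) (hK : ∀ s ∈ K, P.IsState s) (t : ℕ) :
    P.IsState (P.run p K O x t).state :=
  (validMemory_run hO hK t).1

end Run

end Problem
end FairnessMDP
end

noncomputable section
namespace FairnessMDP
namespace Problem

variable {k n : ℕ}

/-! ### Regret along a single run -/

section Potential

/-- Sum over all local configurations of a function of the number of their observations. -/
def visitSum (P : Problem k n) (f : ℕ → ℝ) (seen : List (Finset (Fin k) × (Fin k → ℝ))) : ℝ :=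
  ∑ i, ∑ b ∈ (P.scope i).powerset, f (P.visits seen i b)

variable {P : Problem k n} {seen seen' : List (Finset (Fin k) × (Fin k → ℝ))} {f : ℕ → ℝ}

theorem visitSum_nonneg (hf : ∀ a, 0 ≤ f a) : 0 ≤ P.visitSum f seen :=
  Finset.sum_nonneg fun _ _ => Finset.sum_nonneg fun _ _ => hf _

theorem visitSum_le {v : ℝ} {T : ℕ} (hf : Monotone f) (hv : f T ≤ v) 
    (hT : ∀ i b, P.visits seen i b ≤ T) :
    P.visitSum f seen ≤ (∑ i, (2 : ℝ) ^ (P.scope i).card) * v := by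
  unfold visitSum
  rw [Finset.sum_mul]
  refine Finset.sum_le_sum fun i _ => ?_
  calc ∑ b ∈ (P.scope i).powerset, f (P.visits seen i b)
      ≤ ∑ b ∈ (P.scope i).powerset, v :=
        Finset.sum_le_sum fun b _ => (hf (hT i b)).trans hv
    _ = _ := by simp

/-- One entry gains `d` and no other entry can fall. This is how a finished episode is charged to a
single local configuration. -/
theorem visitSum_add_le {d : ℝ} (hf : Monotone f)
    (h : ∀ i b, P.visits seen i b ≤ P.visits seen' i b) {i₀ : Fin k} {b₀ : Finset (Fin k)}
    (hb : b₀ ⊆ P.scope i₀) (hd : f (P.visits seen i₀ b₀) + d ≤ f (P.visits seen' i₀ b₀)) :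
    P.visitSum f seen + d ≤ P.visitSum f seen' := by
  unfold visitSum
  have hle : ∀ i ∈ (Finset.univ : Finset (Fin k)).erase i₀,
      ∑ b ∈ (P.scope i).powerset, f (P.visits seen i b)
        ≤ ∑ b ∈ (P.scope i).powerset, f (P.visits seen' i b) :=
    fun i _ => Finset.sum_le_sum fun b _ => hf (h i b)
  have hle' : ∀ b ∈ (P.scope i₀).powerset.erase b₀,
      f (P.visits seen i₀ b) ≤ f (P.visits seen' i₀ b) := fun b _ => hf (h i₀ b)
  rw [← Finset.add_sum_erase _ _ (Finset.mem_univ i₀),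
    ← Finset.add_sum_erase _ _ (Finset.mem_univ i₀),
    ← Finset.add_sum_erase _ _ (Finset.mem_powerset.2 hb),
    ← Finset.add_sum_erase _ _ (Finset.mem_powerset.2 hb)]
  have h1 := Finset.sum_le_sum hle
  have h2 := Finset.sum_le_sum hle'
  linarith

end Potential

/-- The convention `Real.log 0 = 0` makes this true at zero; unobserved configurations contribute
nothing to the sum. -/
theorem monotone_log_natCast : Monotone fun a : ℕ => Real.log a := by
  intro a b hab
  rcases Nat.eq_zero_or_pos a with rfl | ha
  · simpa using Real.log_natCast_nonneg b
  · exact Real.log_le_log (by exact_mod_cast ha) (by exact_mod_cast hab)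

theorem monotone_sqrt_natCast : Monotone fun a : ℕ => √(a : ℝ) :=
  fun a b hab => Real.sqrt_le_sqrt (by exact_mod_cast hab)

theorem log_add_log_two_le {a b : ℕ} (ha : 1 ≤ a) (hb : 2 * a ≤ b) :
    Real.log a + Real.log 2 ≤ Real.log b := by
  have ha' : (0 : ℝ) < a := by exact_mod_cast ha
  rw [← Real.log_mul ha'.ne' two_ne_zero]
  exact Real.log_le_log (by positivity) (by exact_mod_cast (mul_comm a 2 ▸ hb))

/-- The square of 4/3 is 16/9 ≤ 2. The resulting gain of one third is the source of the factor 3 in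
`potential`. -/
theorem sqrt_add_third_sqrt_le {a b : ℕ} (hb : 2 * a ≤ b) : √(a : ℝ) + √a / 3 ≤ √(b : ℝ) := by
  have h : (2 : ℝ) * a ≤ b := by exact_mod_cast hb
  apply Real.le_sqrt_of_sq_le
  have := Real.sq_sqrt (Nat.cast_nonneg (α := ℝ) a)
  have h0 : (0 : ℝ) ≤ a := Nat.cast_nonneg a
  nlinarith

/-- Regret bound at the beginning of an episode. -/
def potential (P : Problem k n) (W G : ℝ) (l : ℕ) (seen : List (Finset (Fin k) × (Fin k → ℝ))) : ℝ :=
  W * ((k + 1) * l) + W * k / Real.log 2 * P.visitSum (fun a => Real.log a) seen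
    + 3 * G * P.visitSum (fun a => √(a : ℝ)) seen

/-- Invariant of the initial phase, after `t` time steps. -/
structure CoverPhase (P : Problem k n) (K : List (Finset (Fin k))) (t : ℕ) (M : Memory k) :
    Prop where
  time : t + distance M.state M.target + M.stay + (k + 1) * M.todo.length ≤ (k + 1) * K.length
  seen : ∀ s ∈ K, s ∈ M.todo ∨ (s = M.target ∧ 1 ≤ M.stay) ∨ s ∈ M.seen.map Prod.fst

/-- Invariant of the episodes: `R` is the regret so far, `Δ s` the regret of one time step in state
`s`, `seen₀` contains the observations before the episode, `h` is the number of time steps for which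
the target is to be occupied, `v` the number of moves in the episode so far. -/
structure EpisodePhase (P : Problem k n) (W G : ℝ) (l : ℕ) (Δ : Finset (Fin k) → ℝ) (R : ℝ)
    (M : Memory k) (seen₀ : List (Finset (Fin k) × (Fin k → ℝ))) (h v : ℕ) (i : Fin k) :
    Prop where
  todo : M.todo = []
  allSeen : P.AllSeen seen₀
  visits_le : ∀ i b, P.visits seen₀ i b ≤ P.visits M.seen i b
  stay_le : M.stay ≤ h
  visits_eq : P.visits seen₀ i (M.target ∩ P.scope i) = h
  le_visits : h + (h - M.stay) ≤ P.visits M.seen i (M.target ∩ P.scope i)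
  moves : v + distance M.state M.target ≤ k
  gap : Δ M.target * √h ≤ G
  regret : R ≤ P.potential W G l seen₀ + v * W + (h - M.stay : ℕ) * Δ M.target

section Pathwise

variable {P : Problem k n} {K : List (Finset (Fin k))} {W G : ℝ} {l t : ℕ}
  {Δ : Finset (Fin k) → ℝ} {R : ℝ} {M : Memory k}
  {seen₀ : List (Finset (Fin k) × (Fin k → ℝ))} {h v : ℕ} {i : Fin k}

theorem EpisodePhase.pos (he : P.EpisodePhase W G l Δ R M seen₀ h v i)
    (hM : P.IsState M.target) : 1 ≤ h :=
  he.visits_eq ▸ he.allSeen _ hM i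

/-- Split `h = √h * √h`: one root is absorbed by the confidence bound `gap`, the other remains. -/
theorem EpisodePhase.stay_regret_le (he : P.EpisodePhase W G l Δ R M seen₀ h v i)
    (hΔ : 0 ≤ Δ M.target) : (h - M.stay : ℕ) * Δ M.target ≤ G * √h := by
  have h1 : ((h - M.stay : ℕ) : ℝ) ≤ h := by exact_mod_cast Nat.sub_le _ _
  calc ((h - M.stay : ℕ) : ℝ) * Δ M.target ≤ h * Δ M.target := by gcongr
    _ = Δ M.target * √h * √h := by rw [mul_assoc, Real.mul_self_sqrt (by positivity)]; ring
    _ ≤ G * √h := by gcongr; exact he.gap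

/-- With the stay completed, the count of the least visited local configuration has grown from `h`
to at least `2 * h`. The logarithmic part of the potential gains enough for `k` moves, the square
root part enough for the stay. -/
theorem EpisodePhase.regret_le_potential (hW : 0 ≤ W) (hG : 0 ≤ G)
    (he : P.EpisodePhase W G l Δ R M seen₀ h v i) (hM : P.IsState M.target)
    (hΔ : 0 ≤ Δ M.target) (hs : M.stay = 0) :
    R ≤ P.potential W G l M.seen := by
  have h1 := he.stay_regret_le hΔ
  have hv : (v : ℝ) ≤ k := by exact_mod_cast (Nat.le_add_right _ _).trans he.moves
  have hle : 2 * h ≤ P.visits M.seen i (M.target ∩ P.scope i) := by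
    have := he.le_visits; omega
  have h2 := visitSum_add_le (P := P) monotone_log_natCast he.visits_le
    (Finset.inter_subset_right (s₁ := M.target))
    (he.visits_eq ▸ log_add_log_two_le (he.pos hM) hle)
  have h3 := visitSum_add_le (P := P) monotone_sqrt_natCast he.visits_le
    (Finset.inter_subset_right (s₁ := M.target))
    (sqrt_add_third_sqrt_le (he.visits_eq.symm ▸ hle))
  rw [he.visits_eq] at h3
  have hlog : 0 < Real.log 2 := Real.log_pos (by norm_num)
  have h4 : W * k / Real.log 2 * (P.visitSum (fun a => Real.log a) seen₀ + Real.log 2)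
      ≤ W * k / Real.log 2 * P.visitSum (fun a => Real.log a) M.seen := by gcongr
  have h5 : 3 * G * (P.visitSum (fun a => √(a : ℝ)) seen₀ + √h / 3)
      ≤ 3 * G * P.visitSum (fun a => √(a : ℝ)) M.seen := by gcongr
  have h6 : W * k / Real.log 2 * Real.log 2 = W * k := by field_simp
  have h7 : v * W ≤ k * W := by gcongr
  have := he.regret
  unfold potential at *
  nlinarith

variable {p : Params} {O : (Fin k → Finset (Fin k) → ℝ) → Finset (Fin k)}

/-- Removing one state from the list frees `k + 1` time steps of the budget: at most `k` for the way
and one for the stay. -/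
theorem CoverPhase.plan_of_cons (hc : P.CoverPhase K t M) (hM : M.state = M.target)
    (hs : M.stay = 0) {s : Finset (Fin k)} {rest : List (Finset (Fin k))}
    (ht : M.todo = s :: rest) : P.CoverPhase K t (P.plan p O M) := by
  have hp : P.plan p O M = { M with todo := rest, target := s, stay := 1 } := by
    unfold plan; rw [if_pos ⟨hM, hs⟩, ht]
  rw [hp]
  obtain ⟨h1, h2⟩ := hc
  constructor
  · have := distance_le M.state s
    rw [ht, List.length_cons] at h1
    simp only
    ring_nf at h1 ⊢
    omega
  · intro s' hs'
    rcases h2 s' hs' with h | ⟨_, h⟩ | h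
    · rw [ht, List.mem_cons] at h
      rcases h with rfl | h
      · exact .inr (.inl ⟨rfl, le_rfl⟩)
      · exact .inl h
    · omega
    · exact .inr (.inr h)

theorem CoverPhase.allSeen (hc : P.CoverPhase K t M) (hK : P.IsCover K) (hs : M.stay = 0)
    (ht : M.todo = []) : P.AllSeen M.seen := by
  intro s hP i
  obtain ⟨s', hs', he⟩ := hK.2 s hP i
  rw [← he]
  rcases hc.seen s' hs' with h | ⟨_, h⟩ | h
  · simp [ht] at h
  · omega
  · exact P.visits_pos_of_mem h i

/-- The criterion attaining the infimum is the one whose local configuration will be doubled. At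
this moment its count, `h` and the remaining stay coincide. -/
theorem episodePhase_plan (hk : 1 ≤ k) (ha : P.AllSeen M.seen) (hM : M.state = M.target)
    (hs : M.stay = 0) (ht : M.todo = [])
    (hgap : Δ (O (P.optimistic p M.seen))
      * √(⨅ i, P.visits M.seen i (O (P.optimistic p M.seen) ∩ P.scope i) : ℕ) ≤ G)
    (hR : R ≤ P.potential W G l M.seen) :
    ∃ h i, P.EpisodePhase W G l Δ R (P.plan p O M) M.seen h 0 i := by
  have hp : P.plan p O M = { M with
      target := O (P.optimistic p M.seen)
      stay := ⨅ i, P.visits M.seen i (O (P.optimistic p M.seen) ∩ P.scope i) } := by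
    unfold plan; rw [if_pos ⟨hM, hs⟩, ht]
  have : Nonempty (Fin k) := ⟨⟨0, hk⟩⟩
  obtain ⟨i, hi⟩ := exists_eq_ciInf_of_finite
    (f := fun i => P.visits M.seen i (O (P.optimistic p M.seen) ∩ P.scope i))
  refine ⟨⨅ i, P.visits M.seen i (O (P.optimistic p M.seen) ∩ P.scope i), i, ?_⟩
  rw [hp]
  exact ⟨ht, ha, fun _ _ => le_rfl, le_rfl, hi, by simp [hi],
    by simpa using distance_le M.state _, hgap, by simpa using hR⟩

theorem CoverPhase.perform (hc : P.CoverPhase K t M) (hv : P.ValidMemory M)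
    (hM : ¬ (M.state = M.target ∧ M.stay = 0)) (y : Finset (Fin k) → Fin k → ℝ) :
    P.CoverPhase K (t + 1) (P.perform M y) := by
  obtain ⟨h1, h2⟩ := hc
  by_cases he : M.state = M.target
  · have hs : 1 ≤ M.stay := Nat.one_le_iff_ne_zero.2 fun h => hM ⟨he, h⟩
    constructor
    · simp only [Problem.perform, he, if_true, next_moveAction_self] at h1 ⊢
      omega
    · intro s hs'
      simp only [Problem.perform, he, if_true, next_moveAction_self, List.map_cons, List.mem_cons]
      rcases h2 s hs' with h | h | h
      · exact .inl h
      · exact .inr (.inr (.inl h.1))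
      · exact .inr (.inr (.inr h))
  · constructor
    · have := distance_next hv.2.1 he
      simp only [Problem.perform, he, if_false] at h1 ⊢
      omega
    · intro s hs'
      simp only [Problem.perform, he, if_false, List.map_cons, List.mem_cons]
      rcases h2 s hs' with h | h | h
      · exact .inl h
      · exact .inr (.inl h)
      · exact .inr (.inr (.inr h))

/-- A move is charged `W` and shortens the way; a step of the stay has no action cost and adds one
observation of every local configuration of the target. Moves may happen to add some as well, which
is why `le_visits` is only an inequality. -/
theorem EpisodePhase.perform (he : P.EpisodePhase W G l Δ R M seen₀ h v i)
    (hv : P.ValidMemory M) (hM : ¬ (M.state = M.target ∧ M.stay = 0))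
    (y : Finset (Fin k) → Fin k → ℝ)
    (hW : ∀ s a, P.IsState s → P.cost a + Δ s ≤ W) :
    ∃ v, P.EpisodePhase W G l Δ (R + (P.cost (moveAction M.state M.target)
      + Δ (P.perform M y).state)) (P.perform M y) seen₀ h v i := by
  have hmono : ∀ i b, P.visits seen₀ i b ≤ P.visits (P.perform M y).seen i b := fun i b => by
    have := he.visits_le i b
    simp only [Problem.perform, visits_cons]
    omega
  by_cases hst : M.state = M.target
  · have hs : 1 ≤ M.stay := Nat.one_le_iff_ne_zero.2 fun h => hM ⟨hst, h⟩
    have hsub : h - (M.stay - 1) = h - M.stay + 1 := by have := he.stay_le; omega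
    refine ⟨v, he.todo, he.allSeen, hmono, ?_, he.visits_eq, ?_, ?_, he.gap, ?_⟩
    · simp only [Problem.perform, hst, if_true]
      exact (Nat.sub_le _ _).trans he.stay_le
    · have := he.le_visits
      simp only [Problem.perform, hst, if_true, next_moveAction_self, visits_cons, hsub]
      omega
    · have := he.moves
      simpa only [Problem.perform, hst, next_moveAction_self] using this
    · have := he.regret
      simp only [Problem.perform, hst, if_true, next_moveAction_self, hsub,
        cost_moveAction_self] at this ⊢
      push_cast
      linarith
  · have hd := distance_next hv.2.1 hst
    refine ⟨v + 1, he.todo, he.allSeen, hmono, ?_, he.visits_eq, ?_, ?_, he.gap, ?_⟩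
    · simpa only [Problem.perform, hst, if_false] using he.stay_le
    · have := he.le_visits
      simp only [Problem.perform, hst, if_false, visits_cons]
      omega
    · have := he.moves
      simp only [Problem.perform]
      omega
    · have := he.regret
      have := hW _ (moveAction M.state M.target) (hv.perform y).1
      simp only [Problem.perform, hst, if_false] at this ⊢
      push_cast
      linarith

end Pathwise

/-- Regret of a run, if in every episode the target is good enough: `Δ s` stands for the regret of
one time step in state `s`. -/
theorem sum_regret_le {P : Problem k n} {p : Params} {K : List (Finset (Fin k))}
    {O : (Fin k → Finset (Fin k) → ℝ) → Finset (Fin k)} {x : ℕ → Finset (Fin k) → Fin k → ℝ}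
    {Δ : Finset (Fin k) → ℝ} {W G : ℝ} {T : ℕ} (hk : 1 ≤ k) (hO : P.IsOracle O) (hK : P.IsCover K)
    (hG : 0 ≤ G) (hW : 0 ≤ W) (hΔ : ∀ s, P.IsState s → 0 ≤ Δ s)
    (hΔW : ∀ s a, P.IsState s → P.cost a + Δ s ≤ W)
    (hgap : ∀ t < T, P.AllSeen (P.run p K O x t).seen →
      Δ (O (P.optimistic p (P.run p K O x t).seen))
        * √(⨅ i, P.visits (P.run p K O x t).seen i
          (O (P.optimistic p (P.run p K O x t).seen) ∩ P.scope i) : ℕ) ≤ G) :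
    ∑ t ∈ Finset.range T, (P.cost (P.action p K O x t) + Δ (P.run p K O x (t + 1)).state)
      ≤ W * ((k + 1) * K.length)
        + W * k / Real.log 2 * ((∑ i, (2 : ℝ) ^ (P.scope i).card) * Real.log T)
        + 3 * G * ((∑ i, (2 : ℝ) ^ (P.scope i).card) * √(T : ℝ)) + k * W + G * √(T : ℝ) := by
  set R : ℕ → ℝ := fun t => ∑ u ∈ Finset.range t,
    (P.cost (P.action p K O x u) + Δ (P.run p K O x (u + 1)).state) with hRdef
  have hRsucc : ∀ t, R (t + 1) = R t + (P.cost (P.action p K O x t)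
      + Δ (P.run p K O x (t + 1)).state) := fun t => Finset.sum_range_succ _ _
  have hvalid := validMemory_run (p := p) (x := x) hO hK.1
  -- This crude bound serves as long as the cover is being visited.
  have hRle : ∀ t, R t ≤ t * W := fun t => by
    calc R t ≤ ∑ u ∈ Finset.range t, W :=
          Finset.sum_le_sum fun u _ => hΔW _ _ (hvalid (u + 1)).1
      _ = t * W := by simp
  have hpot_cover : ∀ {t M}, P.CoverPhase K t M → t * W ≤ W * ((k + 1) * K.length) := by
    intro t M hc
    have h1 : t ≤ (k + 1) * K.length := by have := hc.time; omega
    have h2 : (t : ℝ) ≤ (k + 1) * K.length := by exact_mod_cast h1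
    rw [mul_comm]
    gcongr
  have hpot : ∀ seen, W * ((k + 1) * K.length) ≤ P.potential W G K.length seen := by
    intro seen
    unfold potential
    have h1 : 0 ≤ P.visitSum (fun a => Real.log a) seen :=
      visitSum_nonneg fun a => Real.log_natCast_nonneg a
    have h2 : 0 ≤ P.visitSum (fun a => √(a : ℝ)) seen :=
      visitSum_nonneg fun a => Real.sqrt_nonneg _
    have h3 : 0 < Real.log 2 := Real.log_pos (by norm_num)
    have : 0 ≤ W * k / Real.log 2 * P.visitSum (fun a => Real.log a) seen := by positivity
    have : 0 ≤ 3 * G * P.visitSum (fun a => √(a : ℝ)) seen := by positivity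
    linarith
  have hinv : ∀ t ≤ T, P.CoverPhase K t (P.run p K O x t) ∨
      ∃ seen₀ h v i, P.EpisodePhase W G K.length Δ (R t) (P.run p K O x t) seen₀ h v i := by
    intro t
    induction t with
    | zero =>
      intro _
      left
      exact ⟨by simp [run, distance_self], fun s hs => .inl hs⟩
    | succ t ih =>
      intro ht
      have hv := hvalid t
      -- After planning there is always something to do, so each step makes progress. For an oracle
      -- answer this holds because all its local configurations have been seen, whence `h ≥ 1`.
      have key : ¬ ((P.plan p O (P.run p K O x t)).state = (P.plan p O (P.run p K O x t)).target ∧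
            (P.plan p O (P.run p K O x t)).stay = 0) ∧
          (P.CoverPhase K t (P.plan p O (P.run p K O x t)) ∨ ∃ seen₀ h v i,
            P.EpisodePhase W G K.length Δ (R t) (P.plan p O (P.run p K O x t)) seen₀ h v i) := by
        specialize ih (by omega)
        have hg := hgap t (by omega)
        have hRt := hRle t
        generalize P.run p K O x t = M at *
        by_cases hd : M.state = M.target ∧ M.stay = 0
        · rcases htodo : M.todo with _ | ⟨s, rest⟩
          · have hall : P.AllSeen M.seen ∧ R t ≤ P.potential W G K.length M.seen := by
              rcases ih with hc | ⟨seen₀, h, v, i, he⟩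
              · exact ⟨hc.allSeen hK hd.2 htodo, (hRt.trans (hpot_cover hc)).trans (hpot _)⟩
              · exact ⟨fun s hs i => (he.allSeen s hs i).trans (he.visits_le _ _),
                  he.regret_le_potential hW hG hv.2.1 (hΔ _ hv.2.1) hd.2⟩
            obtain ⟨h, i, he⟩ := episodePhase_plan hk hall.1 hd.1 hd.2 htodo (hg hall.1) hall.2
            refine ⟨fun h0 => ?_, .inr ⟨_, h, 0, i, he⟩⟩
            have h1 := he.pos (hv.plan hO).2.1
            have h2 := he.le_visits
            rw [plan_seen, he.visits_eq, h0.2] at h2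
            omega
          · rcases ih with hc | ⟨seen₀, h, v, i, he⟩
            · refine ⟨fun h0 => ?_, .inl (hc.plan_of_cons hd.1 hd.2 htodo)⟩
              have h1 := h0.2
              unfold plan at h1
              rw [if_pos hd, htodo] at h1
              simp at h1
            · simp [he.todo] at htodo
        · have hp : P.plan p O M = M := by unfold plan; rw [if_neg hd]
          rw [hp]
          exact ⟨hd, ih⟩
      obtain ⟨hd, hc | ⟨seen₀, h, v, i, he⟩⟩ := key
      · exact .inl (hc.perform (hv.plan hO) hd _)
      · right
        obtain ⟨v', he'⟩ := he.perform (hv.plan hO) hd (x t) hΔW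
        exact ⟨seen₀, h, v', i, (hRsucc t) ▸ he'⟩
  have hlog : 0 < Real.log 2 := Real.log_pos (by norm_num)
  have hN : 0 ≤ ∑ i, (2 : ℝ) ^ (P.scope i).card := Finset.sum_nonneg fun _ _ => by positivity
  have hlogT : 0 ≤ Real.log T := Real.log_natCast_nonneg T
  rcases hinv T le_rfl with hc | ⟨seen₀, h, v, i, he⟩
  · have h1 := (hRle T).trans (hpot_cover hc)
    have : 0 ≤ W * k / Real.log 2 * ((∑ i, (2 : ℝ) ^ (P.scope i).card) * Real.log T) := by
      positivity
    have : 0 ≤ 3 * G * ((∑ i, (2 : ℝ) ^ (P.scope i).card) * √(T : ℝ)) := by positivity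
    have : 0 ≤ k * W := by positivity
    have : 0 ≤ G * √(T : ℝ) := by positivity
    linarith
  -- The last episode may be unfinished at the horizon. Its moves and its stay account for the
  -- summands `k * W` and `G * √T`.
  · have hM := (hvalid T).2.1
    have hle : ∀ i b, P.visits seen₀ i b ≤ T := fun i b =>
      (he.visits_le i b).trans ((P.visits_le_length _ _ _).trans (P.run_seen_length p K O x T).le)
    have hh : (h : ℝ) ≤ T := by exact_mod_cast he.visits_eq ▸ hle _ _
    have h1 := he.stay_regret_le (hΔ _ hM)
    have h2 : G * √h ≤ G * √(T : ℝ) := by gcongr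
    have hv : (v : ℝ) ≤ k := by exact_mod_cast (Nat.le_add_right _ _).trans he.moves
    have h3 : v * W ≤ k * W := by gcongr
    have h4 := visitSum_le (P := P) monotone_log_natCast le_rfl hle
    have h5 := visitSum_le (P := P) monotone_sqrt_natCast le_rfl hle
    have h6 : W * k / Real.log 2 * P.visitSum (fun a => Real.log a) seen₀
      ≤ W * k / Real.log 2 * ((∑ i, (2 : ℝ) ^ (P.scope i).card) * Real.log T) := by gcongr
    have h7 : 3 * G * P.visitSum (fun a => √(a : ℝ)) seen₀
      ≤ 3 * G * ((∑ i, (2 : ℝ) ^ (P.scope i).card) * √(T : ℝ)) := by gcongr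
    have h8 := he.regret
    unfold potential at h8
    linarith

end Problem
end FairnessMDP
end

noncomputable section
namespace FairnessMDP

/-! ### Functions with countably many values -/

section Fibers

variable {Y α β γ : Type*} [MeasurableSpace Y]

/-- Working with fibres avoids choosing σ-algebras on states, lists and memories: for a map with
countably many values, measurable fibres give everything. -/
theorem measurableSet_fiber_comp [Countable α] {f : Y → α}
    (hf : ∀ a, MeasurableSet {y | f y = a}) (S : Set α) : MeasurableSet {y | f y ∈ S} := by
  have : {y | f y ∈ S} = ⋃ a ∈ S, {y | f y = a} := by ext y; simp
  rw [this]
  exact MeasurableSet.biUnion (Set.to_countable S) fun a _ => hf a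

theorem measurable_comp_of_fiber [Countable α] [MeasurableSpace β] {f : Y → α}
    (hf : ∀ a, MeasurableSet {y | f y = a}) (φ : α → β) : Measurable fun y => φ (f y) :=
  fun S _ => measurableSet_fiber_comp hf (φ ⁻¹' S)

theorem measurableSet_fiber_comp₂ [Countable α] [Countable β] {f : Y → α} {g : Y → β}
    (hf : ∀ a, MeasurableSet {y | f y = a}) (hg : ∀ b, MeasurableSet {y | g y = b})
    (F : α → β → γ) (c : γ) : MeasurableSet {y | F (f y) (g y) = c} := by
  refine measurableSet_fiber_comp (f := fun y => (f y, g y)) (fun q => ?_) {q | F q.1 q.2 = c}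
  have : {y | (f y, g y) = q} = {y | f y = q.1} ∩ {y | g y = q.2} := by
    ext y; simp [Prod.ext_iff]
  rw [this]
  exact (hf _).inter (hg _)

end Fibers

namespace Problem

variable {k n : ℕ}

/-! ### Optimism -/

/-- The observed losses of all local configurations are close to their expectations. -/
def Accurate (P : Problem k n) (θ : Fin n → Finset (Fin k) → ℝ) (p : Params)
    (seen : List (Finset (Fin k) × (Fin k → ℝ))) : Prop :=
  ∀ i s, P.IsState s →
    |P.lossSum seen i (s ∩ P.scope i) - P.visits seen i (s ∩ P.scope i) * P.meanLoss θ s i|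
      ≤ 10 * p.B * √(p.m * Real.log (k * p.T / p.δ) * P.visits seen i (s ∩ P.scope i))

theorem Accurate.abs_optimistic {P : Problem k n} {θ : Fin n → Finset (Fin k) → ℝ} {p : Params}
    {seen : List (Finset (Fin k) × (Fin k → ℝ))} (h : P.Accurate θ p seen)
    (hs : P.AllSeen seen) {s : Finset (Fin k)} (hP : P.IsState s) (i : Fin k) :
    |P.optimistic p seen i (s ∩ P.scope i)
      + 10 * p.B * √(p.m * Real.log (k * p.T / p.δ) / P.visits seen i (s ∩ P.scope i))
      - P.meanLoss θ s i|
      ≤ 10 * p.B * √(p.m * Real.log (k * p.T / p.δ) / P.visits seen i (s ∩ P.scope i)) := by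
  have h1 := h i s hP
  have h2 := hs s hP i
  unfold optimistic
  generalize P.visits seen i (s ∩ P.scope i) = v at *
  generalize (p.m : ℝ) * Real.log (k * p.T / p.δ) = L at *
  have hv : (0 : ℝ) < v := by exact_mod_cast h2
  rw [sub_add_cancel, ← mul_le_mul_iff_left₀ hv]
  -- Valid for either sign of `L`, since only the square of `v` is taken out of the root.
  have h3 : √(L / v) * v = √(L * v) := by
    rw [show L * v = L / v * v ^ 2 by field_simp, Real.sqrt_mul' _ (by positivity),
      Real.sqrt_sq hv.le]
  calc |P.lossSum seen i (s ∩ P.scope i) / v - P.meanLoss θ s i| * v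
      = |P.lossSum seen i (s ∩ P.scope i) / v - P.meanLoss θ s i| * |(v : ℝ)| := by
        rw [abs_of_pos hv]
    _ = |P.lossSum seen i (s ∩ P.scope i) - v * P.meanLoss θ s i| := by
        rw [← abs_mul]; congr 1; field_simp
    _ ≤ _ := by rw [mul_assoc _ (√_), h3]; exact h1

/-- Estimates are at most the true means, so the oracle's answer `s` has estimated loss at most the
true loss of `s'`. The true loss of `s` exceeds its estimate by at most two confidence radii per
criterion, each at most the radius for the least count. Multiplication by the root of that count
removes it. -/
theorem Accurate.gap_le {P : Problem k n} {θ : Fin n → Finset (Fin k) → ℝ} {p : Params}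
    {O : (Fin k → Finset (Fin k) → ℝ) → Finset (Fin k)} (hO : P.IsOracle O) (hB : 0 ≤ p.B)
    {seen : List (Finset (Fin k) × (Fin k → ℝ))} (h : P.Accurate θ p seen)
    (hs : P.AllSeen seen) (hk : 1 ≤ k) {s' : Finset (Fin k)} (hs' : P.IsState s') :
    (∑ i, P.meanLoss θ (O (P.optimistic p seen)) i - ∑ i, P.meanLoss θ s' i)
        * √(⨅ i, P.visits seen i (O (P.optimistic p seen) ∩ P.scope i) : ℕ)
      ≤ 20 * p.B * √(p.m * Real.log (k * p.T / p.δ)) * k := by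
  obtain ⟨hs, hmin⟩ : P.IsState (O (P.optimistic p seen)) ∧ _ :=
    ⟨(hO _).1, (hO (P.optimistic p seen)).2 s' hs'⟩
  rename P.AllSeen seen => hall
  generalize O (P.optimistic p seen) = s at *
  set L := (p.m : ℝ) * Real.log (k * p.T / p.δ)
  set v := ⨅ i, P.visits seen i (s ∩ P.scope i)
  have : Nonempty (Fin k) := ⟨⟨0, hk⟩⟩
  have hv : 1 ≤ v := le_ciInf fun i => hall s hs i
  have hv0 : (0 : ℝ) < v := by exact_mod_cast hv
  have hle : ∀ i, P.meanLoss θ s i ≤ P.optimistic p seen i (s ∩ P.scope i)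
      + 20 * p.B * √(L / v) := fun i => by
    have h1 := (abs_le.1 (h.abs_optimistic hall hs i)).1
    have hvi : (v : ℝ) ≤ P.visits seen i (s ∩ P.scope i) := by
      exact_mod_cast ciInf_le (OrderBot.bddBelow _) i
    -- For negative `L` all radii vanish, because the real square root of a nonpositive number is
    -- zero.
    by_cases hL : 0 ≤ L
    · have h2 : √(L / P.visits seen i (s ∩ P.scope i)) ≤ √(L / v) := by gcongr
      have h3 := mul_le_mul_of_nonneg_left h2 hB
      linarith
    · have h2 : √(L / P.visits seen i (s ∩ P.scope i)) = 0 :=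
        Real.sqrt_eq_zero_of_nonpos (div_nonpos_of_nonpos_of_nonneg (by linarith) (by positivity))
      have h3 : √(L / v) = 0 :=
        Real.sqrt_eq_zero_of_nonpos (div_nonpos_of_nonpos_of_nonneg (by linarith) (by positivity))
      rw [show (p.m : ℝ) * Real.log (k * p.T / p.δ) = L from rfl, h2] at h1
      rw [h3]
      linarith
  have hge : ∀ i, P.optimistic p seen i (s' ∩ P.scope i) ≤ P.meanLoss θ s' i := fun i => by
    have h1 := (abs_le.1 (h.abs_optimistic hall hs' i)).2
    linarith
  have h1 : ∑ i, P.meanLoss θ s i - ∑ i, P.meanLoss θ s' i ≤ 20 * p.B * √(L / v) * k := by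
    have h2 := Finset.sum_le_sum fun i (_ : i ∈ Finset.univ) => hle i
    have h3 := Finset.sum_le_sum fun i (_ : i ∈ Finset.univ) => hge i
    rw [Finset.sum_add_distrib, Finset.sum_const, Finset.card_univ, Fintype.card_fin,
      nsmul_eq_mul] at h2
    linarith
  calc _ ≤ 20 * p.B * √(L / v) * k * √(v : ℝ) := by gcongr
    _ = 20 * p.B * (√(L / v) * √(v : ℝ)) * k := by ring
    _ = _ := by rw [← Real.sqrt_mul' _ hv0.le, div_mul_cancel₀ _ hv0.ne']

/-! ### The run as a function of the losses -/

section Measurability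

variable (P : Problem k n) (p : Params) (K : List (Finset (Fin k)))
  (O : (Fin k → Finset (Fin k) → ℝ) → Finset (Fin k))

/-- The losses `y t (s, i)` in curried form. -/
def curried (y : ℕ → Finset (Fin k) × Fin k → ℝ) : ℕ → Finset (Fin k) → Fin k → ℝ :=
  fun t s i => y t (s, i)

/-- The memory without the losses. -/
def discretePart (M : Memory k) :
    Finset (Fin k) × List (Finset (Fin k)) × List (Finset (Fin k)) × Finset (Fin k) × ℕ :=
  (M.state, M.seen.map Prod.fst, M.todo, M.target, M.stay)

theorem run_congr {x x' : ℕ → Finset (Fin k) → Fin k → ℝ} {t : ℕ} (h : ∀ u < t, x u = x' u) :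
    P.run p K O x t = P.run p K O x' t := by
  induction t with
  | zero => rfl
  | succ t ih => simp only [run, ih fun u hu => h u (by omega), h t (by omega)]

/-- The memory from which the action of time step `t` is determined. -/
def planned (y : ℕ → Finset (Fin k) × Fin k → ℝ) (t : ℕ) : Memory k :=
  P.plan p O (P.run p K O (curried y) t)

theorem planned_congr {y y' : ℕ → Finset (Fin k) × Fin k → ℝ} {t : ℕ}
    (h : ∀ u < t, y u = y' u) : P.planned p K O y t = P.planned p K O y' t := by
  unfold planned
  rw [P.run_congr p K O fun u hu => ?_]
  funext s i
  simp only [curried, h u hu]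

theorem state_run_succ (x : ℕ → Finset (Fin k) → Fin k → ℝ) (t : ℕ) :
    (P.run p K O x (t + 1)).state = P.next (P.plan p O (P.run p K O x t)).state
      (moveAction (P.plan p O (P.run p K O x t)).state (P.plan p O (P.run p K O x t)).target) :=
  rfl

theorem seen_run_succ (x : ℕ → Finset (Fin k) → Fin k → ℝ) (t : ℕ) :
    (P.run p K O x (t + 1)).seen = ((P.run p K O x (t + 1)).state,
      x t (P.run p K O x (t + 1)).state) :: (P.run p K O x t).seen := by
  rw [run]
  simp [perform, plan_seen]

theorem visits_eq_map (seen : List (Finset (Fin k) × (Fin k → ℝ))) (i : Fin k)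
    (b : Finset (Fin k)) :
    P.visits seen i b = ((seen.map Prod.fst).filter fun s => s ∩ P.scope i = b).length := by
  rw [List.filter_map, List.length_map]; rfl

/-- `plan` without the losses, for a given answer of the oracle. -/
def discretePlan (s : Finset (Fin k))
    (d : Finset (Fin k) × List (Finset (Fin k)) × List (Finset (Fin k)) × Finset (Fin k) × ℕ) :
    Finset (Fin k) × List (Finset (Fin k)) × List (Finset (Fin k)) × Finset (Fin k) × ℕ :=
  if d.1 = d.2.2.2.1 ∧ d.2.2.2.2 = 0 then
    match d.2.2.1 with
    | s :: rest => (d.1, d.2.1, rest, s, 1)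
    | [] => (d.1, d.2.1, [], s,
        ⨅ i, (d.2.1.filter fun s' => s' ∩ P.scope i = s ∩ P.scope i).length)
  else d

theorem discretePart_plan (M : Memory k) :
    discretePart (P.plan p O M)
      = P.discretePlan (O (P.optimistic p M.seen)) (discretePart M) := by
  unfold plan discretePlan discretePart
  simp only [visits_eq_map]
  split_ifs
  · rcases h : M.todo with _ | ⟨s, rest⟩ <;> simp
  · rfl

/-- The three claims need a joint induction: the estimates depend on the loss sums and the visited
states, the oracle's answer on the estimates, and the next state on that answer. -/
theorem measurable_run (hO : ∀ s, MeasurableSet {γ | O γ = s}) (t : ℕ) :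
    (∀ d, MeasurableSet {y | discretePart (P.run p K O (curried y) t) = d}) ∧
    (∀ d, MeasurableSet {y | discretePart (P.planned p K O y t) = d}) ∧
    (∀ i b, Measurable fun y => P.lossSum (P.run p K O (curried y) t).seen i b) := by
  have hplan : ∀ t, (∀ d, MeasurableSet {y | discretePart (P.run p K O (curried y) t) = d}) →
      (∀ i b, Measurable fun y => P.lossSum (P.run p K O (curried y) t).seen i b) →
      ∀ d, MeasurableSet {y | discretePart (P.planned p K O y t) = d} := by
    intro t h1 h2 d
    have h3 : Measurable fun y => P.optimistic p (P.run p K O (curried y) t).seen := by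
      refine measurable_pi_lambda _ fun i => measurable_pi_lambda _ fun b => ?_
      have hv : Measurable fun y => (P.visits (P.run p K O (curried y) t).seen i b : ℝ) := by
        simp only [visits_eq_map]
        exact measurable_comp_of_fiber h1
          (fun d => ((d.2.1.filter fun s => s ∩ P.scope i = b).length : ℝ))
      unfold optimistic
      exact ((h2 i b).div hv).sub (((hv.const_div _).sqrt).const_mul _)
    unfold planned
    simp only [discretePart_plan]
    exact measurableSet_fiber_comp₂
      (f := fun y => O (P.optimistic p (P.run p K O (curried y) t).seen))
      (g := fun y => discretePart (P.run p K O (curried y) t)) (fun s => h3 (hO s)) h1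
      P.discretePlan d
  induction t with
  | zero =>
    have h1 : ∀ d, MeasurableSet {y | discretePart (P.run p K O (curried y) 0) = d} :=
      fun d => by simp only [run]; exact MeasurableSet.const _
    have h2 : ∀ i b, Measurable fun y => P.lossSum (P.run p K O (curried y) 0).seen i b :=
      fun i b => by simp only [run]; exact measurable_const
    exact ⟨h1, hplan 0 h1 h2, h2⟩
  | succ t ih =>
    have h1 : ∀ d, MeasurableSet {y | discretePart (P.run p K O (curried y) (t + 1)) = d} := by
      intro d
      exact measurableSet_fiber_comp ih.2.1 {d' | (P.next d'.1 (moveAction d'.1 d'.2.2.2.1),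
        P.next d'.1 (moveAction d'.1 d'.2.2.2.1) :: d'.2.1, d'.2.2.1, d'.2.2.2.1,
        if d'.1 = d'.2.2.2.1 then d'.2.2.2.2 - 1 else d'.2.2.2.2) = d}
    have hs : ∀ s, MeasurableSet {y | (P.run p K O (curried y) (t + 1)).state = s} :=
      fun s => measurableSet_fiber_comp h1 {d | d.1 = s}
    have h2 : ∀ i b, Measurable fun y => P.lossSum (P.run p K O (curried y) (t + 1)).seen i b := by
      intro i b
      simp only [seen_run_succ, lossSum_cons]
      refine (ih.2.2 i b).add ?_
      -- The coordinate read off from `y t` depends on the random state; splitting over the finitely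
      -- many states makes it fixed in each summand.
      have : ∀ y : ℕ → Finset (Fin k) × Fin k → ℝ,
          (if (P.run p K O (curried y) (t + 1)).state ∩ P.scope i = b then
            curried y t (P.run p K O (curried y) (t + 1)).state i else 0)
          = ∑ s, if (P.run p K O (curried y) (t + 1)).state = s then
            (if s ∩ P.scope i = b then y t (s, i) else 0) else 0 := by
        intro y; simp [curried]
      simp only [this]
      refine Finset.measurable_sum _ fun s _ => Measurable.ite (hs s) ?_ measurable_const
      split_ifs
      · fun_prop
      · exact measurable_const
    exact ⟨h1, hplan _ h1 h2, h2⟩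

variable {O} in
theorem measurableSet_state_eq (hO : ∀ s, MeasurableSet {γ | O γ = s}) (t : ℕ)
    (s : Finset (Fin k)) : MeasurableSet {y | (P.run p K O (curried y) t).state = s} :=
  measurableSet_fiber_comp (P.measurable_run p K O hO t).1 {d | d.1 = s}

variable {O} in
theorem measurable_visits (hO : ∀ s, MeasurableSet {γ | O γ = s}) (t : ℕ) (i : Fin k)
    (b : Finset (Fin k)) :
    Measurable fun y => (P.visits (P.run p K O (curried y) t).seen i b : ℝ) := by
  simp only [visits_eq_map]
  exact measurable_comp_of_fiber (P.measurable_run p K O hO t).1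
    (fun d => ((d.2.1.filter fun s => s ∩ P.scope i = b).length : ℝ))

variable {O} in
theorem measurable_cost_action (hO : ∀ s, MeasurableSet {γ | O γ = s}) (t : ℕ) :
    Measurable fun y => P.cost (P.action p K O (curried y) t) :=
  measurable_comp_of_fiber (P.measurable_run p K O hO t).2.1
    (fun d => P.cost (moveAction d.1 d.2.2.2.1))

end Measurability

end Problem
end FairnessMDP
end

noncomputable section
namespace FairnessMDP
namespace Problem

variable {k n : ℕ}

/-! ### Expectations over the losses -/

section Expectation

variable {Ω : Type*} {ℓ : ℕ → Finset (Fin k) → Fin k → Ω → ℝ}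

/-- The losses of a sample point in uncurried form. -/
def sampled (ℓ : ℕ → Finset (Fin k) → Fin k → Ω → ℝ) (ω : Ω) :
    ℕ → Finset (Fin k) × Fin k → ℝ := fun t q => ℓ t q.1 q.2 ω

variable [MeasurableSpace Ω] {Pr : Measure Ω} {P : Problem k n}
  {θ : Fin n → Finset (Fin k) → ℝ} {B : ℝ}

theorem IsLossModel.measurable_at (h : P.IsLossModel θ B Pr ℓ) (t : ℕ) :
    Measurable fun ω => sampled ℓ ω t :=
  measurable_pi_lambda _ fun q => h.measurable t q.1 q.2

theorem IsLossModel.measurable_sampled (h : P.IsLossModel θ B Pr ℓ) : Measurable (sampled ℓ) :=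
  measurable_pi_lambda _ fun t => h.measurable_at t

/-- What depends on the losses of the first `t` time steps only is independent of the next ones. -/
theorem IsLossModel.indepFun (h : P.IsLossModel θ B Pr ℓ) {t : ℕ}
    {F : (ℕ → Finset (Fin k) × Fin k → ℝ) → ℝ} (hF : Measurable F)
    (hF' : ∀ y y', (∀ u < t, y u = y' u) → F y = F y')
    {g : (Finset (Fin k) × Fin k → ℝ) → ℝ} (hg : Measurable g) :
    IndepFun (fun ω => F (sampled ℓ ω)) (fun ω => g (sampled ℓ ω t)) Pr := by
  have h1 := h.indep.indepFun_finset (Finset.range t) {t} (by simp) h.measurable_at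
  -- A history of length `t` is continued by zeros; by `hF'` the continuation does not affect `F`.
  let e : (Finset.range t → Finset (Fin k) × Fin k → ℝ) → ℕ → Finset (Fin k) × Fin k → ℝ :=
    fun z u => if hu : u ∈ Finset.range t then z ⟨u, hu⟩ else 0
  have he : Measurable e := by
    refine measurable_pi_lambda _ fun u => ?_
    by_cases hu : u ∈ Finset.range t
    · simpa only [e, hu, dif_pos] using measurable_pi_apply _
    · simpa only [e, hu, dif_neg, not_false_eq_true] using measurable_const
  have h2 := h1.comp (hF.comp he)
    (hg.comp (measurable_pi_apply (⟨t, Finset.mem_singleton_self t⟩ : ({t} : Finset ℕ))))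
  have h3 : (fun ω => F (sampled ℓ ω)) = (F ∘ e) ∘ fun ω (i : Finset.range t) =>
      (fun q : Finset (Fin k) × Fin k => ℓ i q.1 q.2 ω) := by
    funext ω
    refine hF' _ _ fun u hu => ?_
    simp only [e, Finset.mem_range, hu, dif_pos]
    rfl
  rw [h3]
  exact h2

variable {p : Params} {K : List (Finset (Fin k))}
  {O : (Fin k → Finset (Fin k) → ℝ) → Finset (Fin k)}

/-- The action of time step `t` is chosen before its losses are seen, so the state with index `t +
1` depends only on the losses with index less than `t`. -/
theorem state_congr {y y' : ℕ → Finset (Fin k) × Fin k → ℝ} {t : ℕ} (h : ∀ u < t, y u = y' u) :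
    (P.run p K O (curried y) (t + 1)).state = (P.run p K O (curried y') (t + 1)).state := by
  have := P.planned_congr p K O h
  unfold planned at this
  rw [state_run_succ, state_run_succ, this]

open Classical in
/-- Integration over the losses of the time step that follows on the time step `t`. -/
theorem IsLossModel.integral_mul (h : P.IsLossModel θ B Pr ℓ) (hO : P.IsOracle O)
    (hO' : ∀ s, MeasurableSet {γ | O γ = s}) (hK : ∀ s ∈ K, P.IsState s) {t : ℕ}
    {H : (ℕ → Finset (Fin k) × Fin k → ℝ) → ℝ} (hH : Measurable H)
    (hH' : ∀ y y', (∀ u < t, y u = y' u) → H y = H y')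
    (hHi : Integrable (fun ω => H (sampled ℓ ω)) Pr)
    {φ : Finset (Fin k) → (Finset (Fin k) × Fin k → ℝ) → ℝ} (hφ : ∀ s, Measurable (φ s))
    (hφi : ∀ s, P.IsState s → Integrable (fun ω => φ s (sampled ℓ ω t)) Pr) :
    Integrable (fun ω => H (sampled ℓ ω) *
      φ (P.run p K O (curried (sampled ℓ ω)) (t + 1)).state (sampled ℓ ω t)) Pr ∧
    ∫ ω, H (sampled ℓ ω) *
      φ (P.run p K O (curried (sampled ℓ ω)) (t + 1)).state (sampled ℓ ω t) ∂Pr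
      = ∑ s ∈ Finset.univ.filter P.IsState,
        (∫ ω, if (P.run p K O (curried (sampled ℓ ω)) (t + 1)).state = s
          then H (sampled ℓ ω) else 0 ∂Pr) * ∫ ω, φ s (sampled ℓ ω t) ∂Pr := by
  -- Splitting by the state reached leaves, for each `s`, a product of a function of the past and a
  -- function of the current losses in the fixed state `s`; these are independent.
  let F : Finset (Fin k) → (ℕ → Finset (Fin k) × Fin k → ℝ) → ℝ := fun s y =>
    if (P.run p K O (curried y) (t + 1)).state = s then H y else 0
  have hF : ∀ s, Measurable (F s) := fun s =>
    Measurable.ite (P.measurableSet_state_eq p K hO' (t + 1) s) hH measurable_const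
  have hF' : ∀ s y y', (∀ u < t, y u = y' u) → F s y = F s y' := fun s y y' hy => by
    simp only [F, state_congr hy, hH' y y' hy]
  have hFi : ∀ s, Integrable (fun ω => F s (sampled ℓ ω)) Pr := fun s => by
    refine hHi.mono ((hF s).comp h.measurable_sampled).aestronglyMeasurable ?_
    refine Filter.Eventually.of_forall fun ω => ?_
    simp only [F]
    split_ifs <;> simp
  have hind := fun s => h.indepFun (hF s) (hF' s) (hφ s)
  have heq : (fun ω => H (sampled ℓ ω) *
      φ (P.run p K O (curried (sampled ℓ ω)) (t + 1)).state (sampled ℓ ω t))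
      = fun ω => ∑ s ∈ Finset.univ.filter P.IsState,
        F s (sampled ℓ ω) * φ s (sampled ℓ ω t) := by
    funext ω
    simp only [F, ite_mul, zero_mul]
    rw [Finset.sum_ite_eq, if_pos]
    simpa using isState_run hO hK (t + 1)
  have hint : ∀ s ∈ Finset.univ.filter P.IsState,
      Integrable (fun ω => F s (sampled ℓ ω) * φ s (sampled ℓ ω t)) Pr := fun s hs =>
    (hind s).integrable_mul (hFi s) (hφi s (by simpa using hs))
  rw [heq]
  refine ⟨integrable_finsetSum _ hint, ?_⟩
  rw [integral_finsetSum _ hint]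
  refine Finset.sum_congr rfl fun s hs => ?_
  exact (hind s).integral_fun_mul_eq_mul_integral (hFi s).aestronglyMeasurable
    (hφi s (by simpa using hs)).aestronglyMeasurable

variable [IsProbabilityMeasure Pr]

/-- Comparison of integrals by integrating over the losses of the next time step. -/
theorem IsLossModel.integral_mul_mono (h : P.IsLossModel θ B Pr ℓ) (hO : P.IsOracle O)
    (hO' : ∀ s, MeasurableSet {γ | O γ = s}) (hK : ∀ s ∈ K, P.IsState s) {t : ℕ}
    {H : (ℕ → Finset (Fin k) × Fin k → ℝ) → ℝ} (hH : Measurable H)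
    (hH' : ∀ y y', (∀ u < t, y u = y' u) → H y = H y')
    (hHi : Integrable (fun ω => H (sampled ℓ ω)) Pr) (hH0 : ∀ y, 0 ≤ H y)
    {φ : Finset (Fin k) → (Finset (Fin k) × Fin k → ℝ) → ℝ} (hφ : ∀ s, Measurable (φ s))
    (hφi : ∀ s, P.IsState s → Integrable (fun ω => φ s (sampled ℓ ω t)) Pr)
    {g : Finset (Fin k) → ℝ}
    (hg : ∀ s, P.IsState s → ∫ ω, φ s (sampled ℓ ω t) ∂Pr ≤ g s) :
    ∫ ω, H (sampled ℓ ω) *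
      φ (P.run p K O (curried (sampled ℓ ω)) (t + 1)).state (sampled ℓ ω t) ∂Pr
      ≤ ∫ ω, H (sampled ℓ ω) * g (P.run p K O (curried (sampled ℓ ω)) (t + 1)).state ∂Pr := by
  classical
  -- The same factorization, applied to `φ` and to the deterministic `g`, reduces the claim to a
  -- comparison state by state.
  rw [(h.integral_mul (p := p) hO hO' hK hH hH' hHi hφ hφi).2,
    (h.integral_mul (p := p) hO hO' hK hH hH' hHi (φ := fun s _ => g s)
      (fun s => measurable_const) (fun s _ => integrable_const _)).2]
  refine Finset.sum_le_sum fun s hs => ?_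
  rw [integral_const, probReal_univ, one_smul]
  refine mul_le_mul_of_nonneg_left (hg s (by simpa using hs)) (integral_nonneg fun ω => ?_)
  dsimp only
  split_ifs
  · exact hH0 _
  · exact le_rfl

theorem IsLossModel.integrable_loss (h : P.IsLossModel θ B Pr ℓ) (t : ℕ) {s : Finset (Fin k)}
    (hs : P.IsState s) (i : Fin k) : Integrable (ℓ t s i) Pr :=
  Integrable.of_mem_Icc 0 B (h.measurable t s i).aemeasurable (h.mem_Icc t s i hs)

theorem IsLossModel.meanLoss_mem_Icc (h : P.IsLossModel θ B Pr ℓ) {s : Finset (Fin k)}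
    (hs : P.IsState s) (i : Fin k) : P.meanLoss θ s i ∈ Set.Icc 0 B := by
  rw [← h.mean 0 s i hs]
  constructor
  · exact integral_nonneg_of_ae ((h.mem_Icc 0 s i hs).mono fun ω hω => hω.1)
  · calc ∫ ω, ℓ 0 s i ω ∂Pr ≤ ∫ _, B ∂Pr :=
        integral_mono_ae (h.integrable_loss 0 hs i) (integrable_const _)
          ((h.mem_Icc 0 s i hs).mono fun ω hω => hω.2)
      _ = B := by simp

theorem IsLossModel.integral_loss (h : P.IsLossModel θ B Pr ℓ) (hO : P.IsOracle O)
    (hO' : ∀ s, MeasurableSet {γ | O γ = s}) (hK : ∀ s ∈ K, P.IsState s) (t : ℕ) :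
    Integrable (fun ω => ∑ i, ℓ t (P.run p K O (fun t s i => ℓ t s i ω) (t + 1)).state i ω) Pr ∧
    ∫ ω, ∑ i, ℓ t (P.run p K O (fun t s i => ℓ t s i ω) (t + 1)).state i ω ∂Pr
      ≤ ∫ ω, ∑ i, P.meanLoss θ (P.run p K O (fun t s i => ℓ t s i ω) (t + 1)).state i ∂Pr := by
  have hφ : ∀ s : Finset (Fin k), Measurable fun z : Finset (Fin k) × Fin k → ℝ =>
      ∑ i, z (s, i) := fun s => by fun_prop
  have hφi : ∀ s, P.IsState s → Integrable (fun ω => ∑ i, sampled ℓ ω t (s, i)) Pr :=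
    fun s hs => integrable_finsetSum _ fun i _ => h.integrable_loss t hs i
  have h1 := h.integral_mul (p := p) hO hO' hK (t := t) (H := fun _ => 1) measurable_const
    (fun _ _ _ => rfl) (integrable_const _) hφ hφi
  have h2 := h.integral_mul_mono (p := p) hO hO' hK (t := t) (H := fun _ => 1) measurable_const
    (fun _ _ _ => rfl) (integrable_const _) (fun _ => zero_le_one) hφ hφi
    (g := fun s => ∑ i, P.meanLoss θ s i) (fun s hs => by
      change ∫ ω, ∑ i, ℓ t s i ω ∂Pr ≤ _
      rw [integral_finsetSum _ fun i _ => h.integrable_loss t hs i]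
      exact (Finset.sum_congr rfl fun i _ => h.mean t s i hs).le)
  simp only [one_mul] at h1 h2
  exact ⟨h1.1, h2⟩

/-! ### Concentration -/

/-- Deviation of the observed losses of a local configuration from their expectation. -/
def deviation (P : Problem k n) (i : Fin k) (b : Finset (Fin k)) (μ : ℝ)
    (seen : List (Finset (Fin k) × (Fin k → ℝ))) : ℝ :=
  P.lossSum seen i b - P.visits seen i b * μ

/-- This is an exponential supermartingale. A time step multiplies the exponential by 1 if the
configuration is not met; otherwise, by Hoeffding's lemma, the factor has expectation at most 1. -/
theorem IsLossModel.integral_exp_deviation (h : P.IsLossModel θ B Pr ℓ) (hO : P.IsOracle O)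
    (hO' : ∀ s, MeasurableSet {γ | O γ = s}) (hK : ∀ s ∈ K, P.IsState s) (i : Fin k)
    (b : Finset (Fin k)) {μ : ℝ}
    (hμ : ∀ s, P.IsState s → s ∩ P.scope i = b → P.meanLoss θ s i = μ) (r : ℝ) (t : ℕ) :
    Integrable (fun ω => Real.exp (r * P.deviation i b μ
      (P.run p K O (curried (sampled ℓ ω)) t).seen - r ^ 2 * B ^ 2 / 8 *
        P.visits (P.run p K O (curried (sampled ℓ ω)) t).seen i b)) Pr ∧
    ∫ ω, Real.exp (r * P.deviation i b μ (P.run p K O (curried (sampled ℓ ω)) t).seen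
      - r ^ 2 * B ^ 2 / 8 * P.visits (P.run p K O (curried (sampled ℓ ω)) t).seen i b) ∂Pr ≤ 1 := by
  induction t with
  | zero => simp [run, deviation, lossSum, visits]
  | succ t ih =>
    let H : (ℕ → Finset (Fin k) × Fin k → ℝ) → ℝ := fun y =>
      Real.exp (r * P.deviation i b μ (P.run p K O (curried y) t).seen
        - r ^ 2 * B ^ 2 / 8 * P.visits (P.run p K O (curried y) t).seen i b)
    have hH : Measurable H := by
      have h1 := P.measurable_visits p K hO' t i b
      have h2 := (P.measurable_run p K O hO' t).2.2 i b
      unfold H deviation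
      fun_prop
    have hH' : ∀ y y', (∀ u < t, y u = y' u) → H y = H y' := fun y y' hy => by
      simp only [H]
      rw [P.run_congr p K O (x := curried y) (x' := curried y')
        (fun u hu => by funext s j; simp only [curried, hy u hu])]
    let φ : Finset (Fin k) → (Finset (Fin k) × Fin k → ℝ) → ℝ := fun s z =>
      if s ∩ P.scope i = b then Real.exp (r * (z (s, i) - μ) - r ^ 2 * B ^ 2 / 8) else 1
    have hφ : ∀ s, Measurable (φ s) := fun s => by
      simp only [φ]; split_ifs <;> fun_prop
    -- A variable in `[0, B]` has sub-Gaussian parameter `(B / 2) ^ 2`, and half of this times `r ^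
    -- 2` is the compensator `r ^ 2 * B ^ 2 / 8`.
    have hsub : ∀ s, P.IsState s → s ∩ P.scope i = b →
        HasSubgaussianMGF (fun ω => ℓ t s i ω - μ) ((‖B - 0‖₊ / 2) ^ 2) Pr := fun s hs hb => by
      have := hasSubgaussianMGF_of_mem_Icc (h.measurable t s i).aemeasurable (h.mem_Icc t s i hs)
      rwa [h.mean t s i hs, hμ s hs hb] at this
    have hφi : ∀ s, P.IsState s → Integrable (fun ω => φ s (sampled ℓ ω t)) Pr := by
      intro s hs
      simp only [φ]
      split_ifs with hb
      · simp only [Real.exp_sub]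
        exact ((hsub s hs hb).integrable_exp_mul r).div_const _
      · exact integrable_const _
    have hφ1 : ∀ s, P.IsState s → ∫ ω, φ s (sampled ℓ ω t) ∂Pr ≤ 1 := by
      intro s hs
      simp only [φ]
      split_ifs with hb
      · simp only [Real.exp_sub _ (r ^ 2 * B ^ 2 / 8)]
        rw [integral_div, div_le_one (Real.exp_pos _)]
        refine ((hsub s hs hb).mgf_le r).trans (Real.exp_le_exp.2 ?_)
        apply le_of_eq
        simp only [sub_zero, NNReal.coe_pow, NNReal.coe_div, coe_nnnorm, Real.norm_eq_abs,
          NNReal.coe_ofNat, div_pow, sq_abs]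
        ring
      · simp
    have heq : ∀ ω, Real.exp (r * P.deviation i b μ
        (P.run p K O (curried (sampled ℓ ω)) (t + 1)).seen - r ^ 2 * B ^ 2 / 8 *
          P.visits (P.run p K O (curried (sampled ℓ ω)) (t + 1)).seen i b)
        = H (sampled ℓ ω) * φ (P.run p K O (curried (sampled ℓ ω)) (t + 1)).state
          (sampled ℓ ω t) := by
      intro ω
      simp only [H, φ, deviation, seen_run_succ, visits_cons, lossSum_cons]
      split_ifs
      · rw [← Real.exp_add]
        congr 1
        simp only [curried]
        push_cast
        ring
      · simp
    simp only [heq]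
    refine ⟨(h.integral_mul (p := p) hO hO' hK hH hH' ih.1 hφ hφi).1, ?_⟩
    refine (h.integral_mul_mono (p := p) hO hO' hK hH hH' ih.1 (fun _ => (Real.exp_pos _).le) hφ
      hφi (g := fun _ => 1) hφ1).trans ?_
    simpa using ih.2

/-- Bound on the probability that the first `N` observations of a local configuration deviate. -/
theorem IsLossModel.measureReal_deviation_le (h : P.IsLossModel θ B Pr ℓ) (hO : P.IsOracle O)
    (hO' : ∀ s, MeasurableSet {γ | O γ = s}) (hK : ∀ s ∈ K, P.IsState s) (i : Fin k)
    (b : Finset (Fin k)) {μ : ℝ}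
    (hμ : ∀ s, P.IsState s → s ∩ P.scope i = b → P.meanLoss θ s i = μ) (hB : 0 < B) {L : ℝ}
    (hL : 0 ≤ L) (t N : ℕ) (hN : 1 ≤ N) :
    Pr.real {ω | P.visits (P.run p K O (curried (sampled ℓ ω)) t).seen i b = N ∧
      10 * B * √(L * N) < |P.deviation i b μ (P.run p K O (curried (sampled ℓ ω)) t).seen|}
      ≤ 2 * Real.exp (-(38 * L)) := by
  have hN' : (0 : ℝ) < N := by exact_mod_cast hN
  have key : ∀ r : ℝ, Pr.real {ω | Real.exp (38 * L) ≤ Real.exp (r * P.deviation i b μ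
      (P.run p K O (curried (sampled ℓ ω)) t).seen - r ^ 2 * B ^ 2 / 8 *
        P.visits (P.run p K O (curried (sampled ℓ ω)) t).seen i b)} ≤ Real.exp (-(38 * L)) := by
    intro r
    have h1 := h.integral_exp_deviation (p := p) hO hO' hK i b hμ r t
    have h2 := (mul_meas_ge_le_integral_of_nonneg
      (Filter.Eventually.of_forall fun ω => (Real.exp_pos _).le) h1.1 (Real.exp (38 * L))).trans h1.2
    rwa [mul_comm, ← le_div_iff₀ (Real.exp_pos _), one_div, ← Real.exp_neg] at h2
  -- For this `r` a deviation beyond the threshold contributes at least `40 * L` and the compensator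
  -- costs `2 * L`, which leaves `38 * L`. The two signs of `r` treat the two tails.
  set r := 4 * √(L / N) / B with hr
  have hr2 : r ^ 2 = 16 * (L / N) / B ^ 2 := by
    rw [hr, div_pow, mul_pow, Real.sq_sqrt (by positivity)]; norm_num
  have hra : r * (10 * B * √(L * N)) = 40 * L := by
    rw [hr, show 4 * √(L / N) / B * (10 * B * √(L * N)) = 40 * (√(L / N) * √(L * N)) by
      field_simp; ring, ← Real.sqrt_mul (by positivity),
      show L / N * (L * N) = L ^ 2 by field_simp, Real.sqrt_sq hL]
  have hr0 : 0 ≤ r := by positivity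
  have hkey2 := (measureReal_union_le _ _).trans (add_le_add (key r) (key (-r)))
  rw [← two_mul] at hkey2
  refine le_trans (measureReal_mono ?_) hkey2
  rintro ω ⟨hv, hd⟩
  simp only [Set.mem_union, Set.mem_ofPred_eq, Real.exp_le_exp, hv, neg_sq]
  have hq : r ^ 2 * B ^ 2 / 8 * N = 2 * L := by rw [hr2]; field_simp; ring
  rw [hq]
  rcases lt_abs.1 hd with hd | hd
  · left
    have := mul_le_mul_of_nonneg_left hd.le hr0
    linarith
  · right
    have := mul_le_mul_of_nonneg_left hd.le hr0
    linarith

end Expectation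

end Problem
end FairnessMDP
end

noncomputable section
namespace FairnessMDP
namespace Problem

variable {k n : ℕ}

/-! ### Failure probability and expected regret -/

theorem lossSum_eq_zero (P : Problem k n) {seen : List (Finset (Fin k) × (Fin k → ℝ))} {i : Fin k}
    {b : Finset (Fin k)} (h : P.visits seen i b = 0) : P.lossSum seen i b = 0 := by
  unfold visits at h
  unfold lossSum
  rw [List.length_eq_zero_iff.1 h]
  simp

theorem isState_policyState (P : Problem k n) (π : Finset (Fin k) → Action k) (t : ℕ) :
    P.IsState (P.policyState π t) := by
  induction t with
  | zero => exact P.isState_empty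
  | succ t ih => exact ih.next _

section Regret

variable {Ω : Type*} [MeasurableSpace Ω] {Pr : Measure Ω} [IsProbabilityMeasure Pr]
  {P : Problem k n} {θ : Fin n → Finset (Fin k) → ℝ}
  {ℓ : ℕ → Finset (Fin k) → Fin k → Ω → ℝ} {p : Params} {K : List (Finset (Fin k))}
  {O : (Fin k → Finset (Fin k) → ℝ) → Finset (Fin k)}

/-- The concentration bound divides by `B`. For `B = 0` it is replaced by the fact that all losses
vanish almost surely. -/
theorem IsLossModel.ae_accurate (h : P.IsLossModel θ p.B Pr ℓ) (hB : p.B = 0)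
    (hO : P.IsOracle O) (hK : ∀ s ∈ K, P.IsState s) :
    ∀ᵐ ω ∂Pr, ∀ t, P.Accurate θ p (P.run p K O (curried (sampled ℓ ω)) t).seen := by
  have h0 : ∀ᵐ ω ∂Pr, ∀ t s i, P.IsState s → ℓ t s i ω = 0 := by
    simp only [ae_all_iff]
    intro t s i hs
    filter_upwards [h.mem_Icc t s i hs] with ω hω
    rw [hB] at hω
    exact le_antisymm hω.2 hω.1
  filter_upwards [h0] with ω hω t i s hs
  have h1 : P.meanLoss θ s i = 0 := by
    have := h.meanLoss_mem_Icc hs i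
    rw [hB] at this
    exact le_antisymm this.2 this.1
  have h2 : ∀ b, P.lossSum (P.run p K O (curried (sampled ℓ ω)) t).seen i b = 0 := by
    intro b
    induction t with
    | zero => simp [run, lossSum]
    | succ t ih =>
      rw [seen_run_succ, lossSum_cons, ih, zero_add]
      split_ifs
      · exact hω _ _ _ (isState_run hO hK (t + 1))
      · rfl
  simp [h1, h2, hB]

-- Union bound over time, criterion, local configuration and number `N` of observations. The count
-- is random, but for each fixed `N` the parameter `r` of the exponential bound is deterministic.
open Classical in
theorem IsLossModel.measureReal_not_accurate_le (h : P.IsLossModel θ p.B Pr ℓ)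
    (hB : 0 ≤ p.B) (hO : P.IsOracle O) (hO' : ∀ s, MeasurableSet {γ | O γ = s})
    (hK : ∀ s ∈ K, P.IsState s) (hL : 0 ≤ p.m * Real.log (k * p.T / p.δ)) (T : ℕ) :
    Pr.real {ω | ¬ ∀ t < T, P.Accurate θ p (P.run p K O (curried (sampled ℓ ω)) t).seen}
      ≤ T * ((∑ i, (2 : ℝ) ^ (P.scope i).card) *
        (T * (2 * Real.exp (-(38 * (p.m * Real.log (k * p.T / p.δ))))))) := by
  rcases hB.eq_or_lt with hB | hB
  · have h1 := h.ae_accurate (p := p) hB.symm hO hK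
    have h2 : Pr {ω | ¬ ∀ t < T, P.Accurate θ p
        (P.run p K O (curried (sampled ℓ ω)) t).seen} = 0 :=
      ae_iff.1 (h1.mono fun ω hω t _ => hω t)
    rw [measureReal_def, h2]
    have : 0 ≤ ∑ i, (2 : ℝ) ^ (P.scope i).card := Finset.sum_nonneg fun _ _ => by positivity
    simp only [ENNReal.toReal_zero]
    positivity
  set L := (p.m : ℝ) * Real.log (k * p.T / p.δ)
  let bad : ℕ → Fin k → Finset (Fin k) → ℕ → Set Ω := fun t i b N =>
    {ω | ∃ s, P.IsState s ∧ s ∩ P.scope i = b ∧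
      P.visits (P.run p K O (curried (sampled ℓ ω)) t).seen i b = N ∧
      10 * p.B * √(L * N) < |P.deviation i b (P.meanLoss θ s i)
        (P.run p K O (curried (sampled ℓ ω)) t).seen|}
  have hbad : ∀ t i b N, 1 ≤ N → Pr.real (bad t i b N) ≤ 2 * Real.exp (-(38 * L)) := by
    intro t i b N hN
    by_cases hs : ∃ s, P.IsState s ∧ s ∩ P.scope i = b
    · obtain ⟨s, hs, rfl⟩ := hs
      have hμ : ∀ s', P.IsState s' → s' ∩ P.scope i = s ∩ P.scope i →
          P.meanLoss θ s' i = P.meanLoss θ s i := fun s' _ he => by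
        rw [← meanLoss_inter_scope, he, meanLoss_inter_scope]
      refine (measureReal_mono ?_).trans (h.measureReal_deviation_le (p := p) hO hO' hK i _ hμ hB
        hL t N hN)
      rintro ω ⟨s', hs', he, hv, hd⟩
      rw [hμ s' hs' he] at hd
      exact ⟨hv, hd⟩
    -- A subset of the scope that no state realizes cannot cause a failure.
    · have : bad t i b N = ∅ := by
        ext ω
        simp only [bad, Set.mem_ofPred_eq, Set.mem_empty_iff_false, iff_false]
        rintro ⟨s, h1, h2, -⟩
        exact hs ⟨s, h1, h2⟩
      rw [this]
      simp only [measureReal_empty]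
      positivity
  have hsub : {ω | ¬ ∀ t < T, P.Accurate θ p (P.run p K O (curried (sampled ℓ ω)) t).seen}
      ⊆ ⋃ t ∈ Finset.range T, ⋃ i ∈ Finset.univ, ⋃ b ∈ (P.scope i).powerset,
        ⋃ N ∈ Finset.Icc 1 T, bad t i b N := by
    intro ω hω
    simp only [Set.mem_ofPred_eq, not_forall] at hω
    obtain ⟨t, ht, hω⟩ := hω
    unfold Accurate at hω
    push Not at hω
    obtain ⟨i, s, hs, hω⟩ := hω
    simp only [Set.mem_iUnion]
    refine ⟨t, by simpa using ht, i, Finset.mem_univ i, s ∩ P.scope i,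
      Finset.mem_powerset.2 Finset.inter_subset_right,
      P.visits (P.run p K O (curried (sampled ℓ ω)) t).seen i (s ∩ P.scope i), ?_,
      s, hs, rfl, rfl, hω⟩
    rw [Finset.mem_Icc]
    constructor
    -- Without observations both sides of the accuracy condition are zero, so failures occur only
    -- for `N ≥ 1`.
    · by_contra h0
      have h0 : P.visits (P.run p K O (curried (sampled ℓ ω)) t).seen i (s ∩ P.scope i) = 0 := by
        omega
      rw [h0, P.lossSum_eq_zero h0] at hω
      simp at hω
    · have := P.visits_le_length (P.run p K O (curried (sampled ℓ ω)) t).seen i (s ∩ P.scope i)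
      rw [run_seen_length] at this
      omega
  refine (measureReal_mono hsub (measure_ne_top _ _)).trans ((measureReal_biUnion_finset_le _ _).trans ?_)
  rw [← nsmul_eq_mul]
  refine (Finset.sum_le_card_nsmul _ _ _ fun t _ => ?_).trans_eq (by rw [Finset.card_range])
  rw [Finset.sum_mul]
  refine (measureReal_biUnion_finset_le _ _).trans (Finset.sum_le_sum fun i _ => ?_)
  refine (measureReal_biUnion_finset_le _ _).trans ?_
  have : (2 : ℝ) ^ (P.scope i).card = ((P.scope i).powerset.card : ℝ) := by simp
  rw [this, ← nsmul_eq_mul]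
  refine Finset.sum_le_card_nsmul _ _ _ fun b _ => ?_
  refine (measureReal_biUnion_finset_le _ _).trans ?_
  rw [← nsmul_eq_mul]
  refine (Finset.sum_le_card_nsmul _ _ _ fun N hN => hbad t i b N (Finset.mem_Icc.1 hN).1).trans_eq
    (by rw [Nat.card_Icc, Nat.add_sub_cancel])

theorem integrable_comp_state (h : P.IsLossModel θ p.B Pr ℓ)
    (hO' : ∀ s, MeasurableSet {γ | O γ = s}) (t : ℕ) (g : Finset (Fin k) → ℝ) :
    Integrable (fun ω => g (P.run p K O (curried (sampled ℓ ω)) t).state) Pr := by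
  have h1 : Measurable fun y => g (P.run p K O (curried y) t).state :=
    measurable_comp_of_fiber (fun s => P.measurableSet_state_eq p K hO' t s) g
  refine Integrable.of_bound (h1.comp h.measurable_sampled).aestronglyMeasurable
    (∑ s, ‖g s‖) (Filter.Eventually.of_forall fun ω => ?_)
  exact Finset.single_le_sum (f := fun s => ‖g s‖) (fun _ _ => norm_nonneg _) (Finset.mem_univ _)

theorem integrable_cost_action (h : P.IsLossModel θ p.B Pr ℓ)
    (hO' : ∀ s, MeasurableSet {γ | O γ = s}) {c : ℝ} (hc : ∀ i, 0 ≤ P.fixCost i ∧ P.fixCost i ≤ c)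
    (hc0 : 0 ≤ c) (t : ℕ) :
    Integrable (fun ω => P.cost (P.action p K O (curried (sampled ℓ ω)) t)) Pr := by
  refine Integrable.of_bound
    ((P.measurable_cost_action p K hO' t).comp h.measurable_sampled).aestronglyMeasurable c
    (Filter.Eventually.of_forall fun ω => ?_)
  rw [Real.norm_eq_abs, abs_of_nonneg (cost_nonneg (fun i => (hc i).1) _)]
  exact cost_le hc0 (fun i => (hc i).2) _

/-- The pseudo-regret in terms of the regret of the states visited. -/
theorem pseudoRegret_le_integral (h : P.IsLossModel θ p.B Pr ℓ) (hO : P.IsOracle O)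
    (hO' : ∀ s, MeasurableSet {γ | O γ = s}) (hK : ∀ s ∈ K, P.IsState s) {c : ℝ}
    (hc : ∀ i, 0 ≤ P.fixCost i ∧ P.fixCost i ≤ c) (hc0 : 0 ≤ c) {s' : Finset (Fin k)}
    (hs' : P.IsBestState θ s') (π : Finset (Fin k) → Action k) :
    (∀ t, Integrable (fun ω => P.algLoss p K O (fun t s i => ℓ t s i ω) t) Pr) ∧
    P.pseudoRegret p K O π Pr ℓ ≤ ∫ ω, ∑ t ∈ Finset.range p.T,
      (P.cost (P.action p K O (curried (sampled ℓ ω)) t)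
        + (∑ i, P.meanLoss θ (P.run p K O (curried (sampled ℓ ω)) (t + 1)).state i
          - ∑ i, P.meanLoss θ s' i)) ∂Pr := by
  have hcost := fun t => integrable_cost_action (K := K) h hO' hc hc0 t
  have hloss := fun t => h.integral_loss (p := p) hO hO' hK t
  have hstate := fun t => integrable_comp_state (K := K) h hO' t fun s => ∑ i, P.meanLoss θ s i
  refine ⟨fun t => (hcost t).add (hloss t).1, ?_⟩
  have hdiff : ∀ t, Integrable (fun ω =>
      ∑ i, P.meanLoss θ (P.run p K O (curried (sampled ℓ ω)) (t + 1)).state i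
        - ∑ i, P.meanLoss θ s' i) Pr := fun t => (hstate (t + 1)).sub (integrable_const _)
  have hsum : ∀ t, Integrable (fun ω => P.cost (P.action p K O (curried (sampled ℓ ω)) t) +
      (∑ i, P.meanLoss θ (P.run p K O (curried (sampled ℓ ω)) (t + 1)).state i
        - ∑ i, P.meanLoss θ s' i)) Pr := fun t => (hcost t).add (hdiff t)
  rw [integral_finsetSum _ fun t _ => hsum t]
  unfold pseudoRegret
  rw [← Finset.sum_sub_distrib]
  refine Finset.sum_le_sum fun t _ => ?_
  have h1 : ∫ ω, P.algLoss p K O (fun t s i => ℓ t s i ω) t ∂Pr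
      = ∫ ω, P.cost (P.action p K O (curried (sampled ℓ ω)) t) ∂Pr
        + ∫ ω, ∑ i, ℓ t (P.run p K O (fun t s i => ℓ t s i ω) (t + 1)).state i ω ∂Pr :=
    integral_add (hcost t) (hloss t).1
  -- The comparison policy pays at least the loss of a best state in every single time step, also on
  -- its way there.
  have h2 : ∑ i, P.meanLoss θ s' i ≤ ∫ ω, P.policyLoss π (fun t s i => ℓ t s i ω) t ∂Pr := by
    have hst := P.isState_policyState π (t + 1)
    have h3 : ∫ ω, P.policyLoss π (fun t s i => ℓ t s i ω) t ∂Pr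
        = P.cost (π (P.policyState π t)) + ∑ i, P.meanLoss θ (P.policyState π (t + 1)) i := by
      unfold policyLoss
      rw [integral_add (integrable_const _)
        (integrable_finsetSum _ fun i _ => h.integrable_loss t hst i),
        integral_finsetSum _ fun i _ => h.integrable_loss t hst i]
      simp [h.mean t _ _ hst]
    rw [h3]
    have := hs'.2 _ hst
    have := cost_nonneg (fun i => (hc i).1) (π (P.policyState π t))
    linarith
  rw [integral_add (hcost t) (hdiff t),
    integral_sub (hstate (t + 1)) (integrable_const _), h1, integral_const, probReal_univ, one_smul]
  have h3 : ∫ ω, ∑ i, ℓ t (P.run p K O (fun t s i => ℓ t s i ω) (t + 1)).state i ω ∂Pr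
      ≤ ∫ ω, ∑ i, P.meanLoss θ (P.run p K O (curried (sampled ℓ ω)) (t + 1)).state i ∂Pr :=
    (hloss t).2
  linarith

/-- The pseudo-regret in terms of the size of the cover and the number of local configurations. -/
theorem pseudoRegret_le (h : P.IsLossModel θ p.B Pr ℓ) (hk : 1 ≤ k) (hB : 0 ≤ p.B)
    (hO : P.IsOracle O) (hO' : ∀ s, MeasurableSet {γ | O γ = s}) (hK : P.IsCover K) {c : ℝ}
    (hc : ∀ i, 0 ≤ P.fixCost i ∧ P.fixCost i ≤ c) (hc0 : 0 ≤ c) {π : Finset (Fin k) → Action k}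
    (hπ : P.IsOptimalPolicy θ π) (hL : 0 ≤ p.m * Real.log (k * p.T / p.δ)) {W G N : ℝ}
    (hW : W = c + k * p.B) (hG : G = 20 * p.B * √(p.m * Real.log (k * p.T / p.δ)) * k)
    (hN : N = ∑ i, (2 : ℝ) ^ (P.scope i).card) :
    (∀ t, Integrable (fun ω => P.algLoss p K O (fun t s i => ℓ t s i ω) t) Pr) ∧
    P.pseudoRegret p K O π Pr ℓ ≤ p.T * W ∧
    P.pseudoRegret p K O π Pr ℓ ≤ W * ((k + 1) * K.length)
        + W * k / Real.log 2 * (N * Real.log p.T) + 3 * G * (N * √(p.T : ℝ)) + k * W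
        + G * √(p.T : ℝ) + p.T * W * (p.T * (N *
        (p.T * (2 * Real.exp (-(38 * (p.m * Real.log (k * p.T / p.δ)))))))) := by
  classical
  obtain ⟨s', hs', -⟩ := hπ
  obtain ⟨hint, hle⟩ := pseudoRegret_le_integral (p := p) h hO hO' hK.1 hc hc0 hs' π
  refine ⟨hint, ?_⟩
  have hW0 : 0 ≤ W := by rw [hW]; positivity
  have hG0 : 0 ≤ G := by rw [hG]; positivity
  set Δ : Finset (Fin k) → ℝ := fun s => ∑ i, P.meanLoss θ s i - ∑ i, P.meanLoss θ s' i with hΔ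
  have hΔ0 : ∀ s, P.IsState s → 0 ≤ Δ s := fun s hs => sub_nonneg.2 (hs'.2 s hs)
  have hΔW : ∀ s a, P.IsState s → P.cost a + Δ s ≤ W := fun s a hs => by
    have h1 := cost_le hc0 (fun i => (hc i).2) a
    have h2 : ∑ i, P.meanLoss θ s i ≤ ∑ _i : Fin k, p.B :=
      Finset.sum_le_sum fun i _ => (h.meanLoss_mem_Icc hs i).2
    have h3 : 0 ≤ ∑ i, P.meanLoss θ s' i :=
      Finset.sum_nonneg fun i _ => (h.meanLoss_mem_Icc hs'.1 i).1
    simp only [Finset.sum_const, Finset.card_univ, Fintype.card_fin, nsmul_eq_mul] at h2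
    simp only [hΔ]
    linarith
  set R : Ω → ℝ := fun ω => ∑ t ∈ Finset.range p.T,
      (P.cost (P.action p K O (curried (sampled ℓ ω)) t)
        + Δ (P.run p K O (curried (sampled ℓ ω)) (t + 1)).state) with hR
  have hRi : Integrable R Pr := integrable_finsetSum _ fun t _ =>
    (integrable_cost_action (K := K) h hO' hc hc0 t).add (integrable_comp_state h hO' (t + 1) Δ)
  have hRW : ∀ ω, R ω ≤ p.T * W := fun ω => by
    calc R ω ≤ ∑ _t ∈ Finset.range p.T, W :=
          Finset.sum_le_sum fun t _ => hΔW _ _ (isState_run hO hK.1 (t + 1))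
      _ = p.T * W := by simp
  constructor
  · refine hle.trans ((integral_mono hRi (integrable_const _) hRW).trans_eq (by simp))
  set bad := {ω | ¬ ∀ t < p.T, P.Accurate θ p (P.run p K O (curried (sampled ℓ ω)) t).seen}
  have hbad := h.measureReal_not_accurate_le (p := p) hB hO hO' hK.1 hL p.T
  rw [← hN] at hbad
  set S := W * ((k + 1) * K.length)
        + W * k / Real.log 2 * (N * Real.log p.T) + 3 * G * (N * √(p.T : ℝ)) + k * W
        + G * √(p.T : ℝ) with hS
  have hN0 : 0 ≤ N := by rw [hN]; exact Finset.sum_nonneg fun _ _ => by positivity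
  have hS0 : 0 ≤ S := by
    have h1 : 0 < Real.log 2 := Real.log_pos (by norm_num)
    have h2 := Real.log_natCast_nonneg p.T
    rw [hS]
    positivity
  -- Measurability of the failure event is not needed: its measurable hull has the same measure, and
  -- the trivial bound `T * W` is used on all of it.
  have hRS : ∀ ω, R ω ≤ S + (toMeasurable Pr bad).indicator (fun _ => p.T * W) ω := by
    intro ω
    by_cases hω : ω ∈ bad
    · rw [Set.indicator_of_mem (subset_toMeasurable Pr bad hω)]
      linarith [hRW ω]
    · have h0 : 0 ≤ (toMeasurable Pr bad).indicator (fun _ => (p.T : ℝ) * W) ω :=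
        Set.indicator_nonneg (fun _ _ => by positivity) _
      have hacc : ∀ t < p.T, P.Accurate θ p (P.run p K O (curried (sampled ℓ ω)) t).seen :=
        not_not.1 hω
      have := sum_regret_le (p := p) (x := curried (sampled ℓ ω)) hk hO hK hG0 hW0 hΔ0 hΔW
        fun t ht hall => hG ▸ (hacc t ht).gap_le hO hB hall hk hs'.1
      rw [← hN] at this
      linarith
  have hmeas := measurableSet_toMeasurable Pr bad
  have hSi : Integrable (fun ω => S + (toMeasurable Pr bad).indicator (fun _ => p.T * W) ω) Pr :=
    (integrable_const S).add ((integrable_const ((p.T : ℝ) * W)).indicator hmeas)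
  have h1 := integral_mono hRi hSi hRS
  rw [integral_add (integrable_const S) ((integrable_const _).indicator hmeas), integral_const,
    integral_indicator_const _ hmeas, probReal_univ, one_smul, measureReal_def,
    measure_toMeasurable, ← measureReal_def, smul_eq_mul, mul_comm (Pr.real bad)] at h1
  refine hle.trans (h1.trans ?_)
  gcongr

end Regret

set_option maxHeartbeats 1000000 in
/-- The regret bound in the form of the main theorem. -/
theorem regret_bound (D : ℕ) (hD : 1 ≤ D) (E : ℝ) {m T : ℕ} (P : Problem k n) {B c : ℝ}
    (K : List (Finset (Fin k))) (O : (Fin k → Finset (Fin k) → ℝ) → Finset (Fin k))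
    (θ : Fin n → Finset (Fin k) → ℝ) (π : Finset (Fin k) → Action k)
    {Ω : Type*} [MeasurableSpace Ω] (Pr : Measure Ω) [IsProbabilityMeasure Pr]
    (ℓ : ℕ → Finset (Fin k) → Fin k → Ω → ℝ) (hk : 1 ≤ k) (hm : 1 ≤ m) (hT : 2 ≤ T)
    (hB : 0 ≤ B) (hcB : 1 ≤ c + B) (hc : ∀ i, 0 ≤ P.fixCost i ∧ P.fixCost i ≤ c)
    (hP : P.IsSparse m D) (hK : P.IsCover K) (hKE : (K.length : ℝ) ≤ E * (k : ℝ) ^ (D * m + 1))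
    (hO : P.IsOracle O) (hO' : ∀ s, MeasurableSet {γ | O γ = s}) (hℓ : P.IsLossModel θ B Pr ℓ)
    (hπ : P.IsOptimalPolicy θ π) :
    let p : Params := { m := m, T := T, B := B, δ := 1 / (T : ℝ) ^ 4 }
    (∀ t, Integrable (fun ω => P.algLoss p K O (fun t s i => ℓ t s i ω) t) Pr) ∧
    P.pseudoRegret p K O π Pr ℓ ≤ (4 * max E 0 + 600) * m * (k : ℝ) ^ (2 * D * m + 2) *
      (c + B) ^ 2 * √(T : ℝ) * Real.log T := by
  intro p
  have hc0 : 0 ≤ c := (hc ⟨0, hk⟩).1.trans (hc ⟨0, hk⟩).2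
  have hk1 : (1 : ℝ) ≤ k := by exact_mod_cast hk
  have hm1 : (1 : ℝ) ≤ m := by exact_mod_cast hm
  have hT2 : (2 : ℝ) ≤ T := by exact_mod_cast hT
  have hT0 : (0 : ℝ) < T := by linarith
  have hlogk : 0 ≤ Real.log k := Real.log_nonneg hk1
  have hlogT : 1 / 2 ≤ Real.log T := by
    have h1 : Real.log 2 ≤ Real.log T := Real.log_le_log (by norm_num) hT2
    linarith [Real.log_two_gt_d9]
  have hlog : Real.log (k * T / (1 / (T : ℝ) ^ 4)) = Real.log k + 5 * Real.log T := by
    rw [show (k : ℝ) * T / (1 / (T : ℝ) ^ 4) = k * (T : ℝ) ^ 5 by field_simp,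
      Real.log_mul (by positivity) (by positivity), Real.log_pow]
    norm_num
  set Λ := (m : ℝ) * Real.log (k * T / (1 / (T : ℝ) ^ 4)) with hΛ
  have hΛ0 : 0 ≤ Λ := by rw [hΛ, hlog]; positivity
  obtain ⟨hint, htriv, hmain⟩ := pseudoRegret_le (p := p) hℓ hk hB hO hO' hK hc hc0 hπ hΛ0 rfl rfl rfl
  refine ⟨hint, ?_⟩
  generalize P.pseudoRegret p K O π Pr ℓ = R at *
  simp only [p] at htriv hmain
  rw [← hΛ] at hmain
  have hN := sum_two_pow_card_scope_le hk hm hD hP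
  have hN0 : 0 ≤ ∑ i, (2 : ℝ) ^ (P.scope i).card := Finset.sum_nonneg fun _ _ => by positivity
  generalize ∑ i, (2 : ℝ) ^ (P.scope i).card = N at *
  set u := (k : ℝ) ^ (D * m) with hu
  have hDm : 1 ≤ D * m := Nat.mul_pos hD hm
  have hku : (k : ℝ) ≤ u := le_self_pow₀ hk1 (by omega)
  have hu1 : 1 ≤ u := hk1.trans hku
  have hku2 : (k : ℝ) ^ (2 * D * m + 2) = u ^ 2 * k ^ 2 := by
    rw [hu, ← pow_mul, ← pow_add]; congr 1; ring
  rw [pow_succ, ← hu] at hKE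
  rw [hku2]
  set z := c + B with hz
  have hBz : B ≤ z := by linarith
  set W := c + k * B with hW
  have hWz : W ≤ k * z := by rw [hW, hz]; nlinarith
  have hW0 : 0 ≤ W := by positivity
  set q := √(T : ℝ) with hq
  have hq1 : 1 ≤ q := Real.one_le_sqrt.2 (by linarith)
  have hqq : q * q = T := Real.mul_self_sqrt hT0.le
  set t := Real.log T with ht
  set Y := u ^ 2 * k ^ 2 * z ^ 2 with hY
  have hY0 : 0 ≤ Y := by positivity
  -- The terms are linear in `c + B`; the assumption `1 ≤ c + B` allows passing to the square of the
  -- statement.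
  have hz2 : z ≤ z ^ 2 := le_self_pow₀ hcB two_ne_zero
  have hu2 : u ≤ u ^ 2 := le_self_pow₀ hu1 two_ne_zero
  set X := m * Y * q * t with hX
  have hXt : Y * t ≤ X := by
    have : Y * 1 * 1 * t ≤ m * Y * q * t := by rw [mul_comm (m : ℝ) Y]; gcongr
    linarith
  have hXq : Y * q ≤ 2 * X := by
    have : 1 * Y * q * (1 / 2) ≤ m * Y * q * t := by gcongr
    linarith
  have hYX : Y ≤ 2 * X := by
    have : Y * (1 / 2) ≤ Y * t := by gcongr
    linarith
  have hX0 : 0 ≤ X := by linarith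
  have hgoal : (4 * max E 0 + 600) * m * (u ^ 2 * k ^ 2) * z ^ 2 * q * t
      = (4 * max E 0 + 600) * X := by rw [hX, hY]; ring
  rw [hgoal]
  clear_value Λ u z W q t Y X
  have hE0 : 0 ≤ max E 0 := le_max_right _ _
  have hEX : 0 ≤ max E 0 * X := by positivity
  -- For short horizons `√T ≤ u ^ 2 * k`, and the trivial bound `T * W` is already of the required
  -- order. For long ones `k ≤ u ≤ T`, so that `log k` is dominated by `log T`.
  by_cases hTk : (T : ℝ) ≤ (u ^ 2 * k) ^ 2
  · have h1 : q ≤ u ^ 2 * k := hq ▸ Real.sqrt_le_iff.2 ⟨by positivity, hTk⟩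
    have h2 : T * W ≤ Y * q := by
      calc T * W ≤ T * (k * z) := by gcongr
        _ = q * k * z * q := by rw [← hqq]; ring
        _ ≤ (u ^ 2 * k) * k * z ^ 2 * q := by gcongr
        _ = Y * q := by rw [hY]; ring
    linarith
  · push Not at hTk
    have huT : u ≤ T := by
      refine le_trans ?_ hTk.le
      calc u = u * 1 * (1 * 1) := by ring
        _ ≤ u ^ 2 * k * (u ^ 2 * k) := by gcongr; exact one_le_pow₀ hu1
        _ = (u ^ 2 * k) ^ 2 := by ring
    have hkT : Real.log k ≤ t := ht ▸ Real.log_le_log (by positivity) (hku.trans huT)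
    -- The failure term carries four factors `T`: from the trivial regret, the union over time, the
    -- union over counts, and `N ≤ 2 * u ≤ 2 * T`. Five powers cancel them with one to spare.
    have hexp : Real.exp (-(38 * Λ)) ≤ 1 / (T : ℝ) ^ 5 := by
      have h1 : 5 * t ≤ Λ := by
        rw [hΛ, hlog]
        calc 5 * t = 1 * (0 + 5 * t) := by ring
          _ ≤ m * (Real.log k + 5 * t) := by gcongr
      calc Real.exp (-(38 * Λ)) ≤ Real.exp (-(5 * t)) := by
            apply Real.exp_le_exp.2; linarith
        _ = 1 / (T : ℝ) ^ 5 := by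
            rw [Real.exp_neg, one_div]
            congr 1
            rw [← Real.exp_log (pow_pos hT0 5), Real.log_pow, ← ht]
            norm_num
    -- Since `m * t ≥ 1 / 2`, the root of `6 * (m * t)` is bounded linearly in `m * t`. This
    -- replaces the root by the factor `m * log T` of the statement.
    have hsqrt : √Λ ≤ 4 * (m * t) := by
      refine Real.sqrt_le_iff.2 ⟨by positivity, ?_⟩
      have h1 : Λ ≤ 6 * (m * t) := by
        rw [hΛ, hlog]
        calc (m : ℝ) * (Real.log k + 5 * t) ≤ m * (t + 5 * t) := by gcongr
          _ = 6 * (m * t) := by ring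
      have h2 : 1 / 2 ≤ m * t := by
        calc (1 : ℝ) / 2 = 1 * (1 / 2) := by ring
          _ ≤ m * t := by gcongr
      have h3 := mul_le_mul_of_nonneg_left h2 (show 0 ≤ m * t by positivity)
      have h4 : (4 * (m * t)) ^ 2 = 16 * (m * t * (m * t)) := by ring
      linarith
    have hG : 20 * B * √Λ * k ≤ 80 * (z * k * m * t) := by
      calc 20 * B * √Λ * k ≤ 20 * z * (4 * (m * t)) * k := by gcongr
        _ = _ := by ring
    have hG0 : 0 ≤ 20 * B * √Λ * k := by positivity
    obtain ⟨G, hG'⟩ : ∃ G, G = 20 * B * √Λ * k := ⟨_, rfl⟩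
    rw [← hG'] at hG hG0 hmain
    have e1 : W * ((k + 1) * K.length) ≤ 4 * (max E 0 * X) := by
      calc W * ((k + 1) * K.length) ≤ (k * z) * ((k + k) * (max E 0 * (u * k))) := by
            gcongr
            exact hKE.trans (mul_le_mul_of_nonneg_right (le_max_left _ _) (by positivity))
        _ = 2 * max E 0 * (u * k * k ^ 2 * z) := by ring
        _ ≤ 2 * max E 0 * (u * u * k ^ 2 * z ^ 2) := by gcongr
        _ = 2 * max E 0 * Y := by rw [hY]; ring
        _ ≤ 2 * max E 0 * (2 * X) := by gcongr
        _ = _ := by ring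
    have hl2 : 1 / Real.log 2 ≤ 2 := by
      rw [div_le_iff₀ (Real.log_pos (by norm_num))]
      linarith [Real.log_two_gt_d9]
    have e2 : W * k / Real.log 2 * (N * t) ≤ 4 * X := by
      calc W * k / Real.log 2 * (N * t) = W * k * (1 / Real.log 2) * (N * t) := by ring
        _ ≤ (k * z) * k * 2 * ((2 * u) * t) := by gcongr
        _ = 4 * (u * k ^ 2 * z * t) := by ring
        _ ≤ 4 * (u ^ 2 * k ^ 2 * z ^ 2 * t) := by gcongr
        _ ≤ 4 * X := by rw [← hY]; linarith
    have hkk : (k : ℝ) ≤ k ^ 2 := le_self_pow₀ hk1 two_ne_zero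
    have e3 : 3 * G * (N * q) ≤ 480 * X := by
      calc 3 * G * (N * q) ≤ 3 * (80 * (z * k * m * t)) * ((2 * u) * q) := by gcongr
        _ = 480 * (m * (u * k * z) * q * t) := by ring
        _ ≤ 480 * (m * (u ^ 2 * k ^ 2 * z ^ 2) * q * t) := by gcongr
        _ = 480 * X := by rw [hX, hY]
    have e4 : k * W ≤ 2 * X := by
      calc k * W ≤ k * (k * z) := by gcongr
        _ = 1 * k ^ 2 * z := by ring
        _ ≤ u ^ 2 * k ^ 2 * z ^ 2 := by gcongr; exact one_le_pow₀ hu1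
        _ ≤ 2 * X := by rw [← hY]; exact hYX
    have e5 : G * q ≤ 80 * X := by
      calc G * q ≤ 80 * (z * k * m * t) * q := by gcongr
        _ = 80 * (m * (1 * k * z) * q * t) := by ring
        _ ≤ 80 * (m * (u ^ 2 * k ^ 2 * z ^ 2) * q * t) := by gcongr; exact one_le_pow₀ hu1
        _ = 80 * X := by rw [hX, hY]
    have e6 : T * W * (T * (N * (T * (2 * Real.exp (-(38 * Λ)))))) ≤ 8 * X := by
      calc T * W * (T * (N * (T * (2 * Real.exp (-(38 * Λ))))))
          ≤ T * (k * W) * (T * ((2 * T) * (T * (2 * (1 / (T : ℝ) ^ 5))))) := by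
            gcongr
            · exact le_mul_of_one_le_left hW0 hk1
            · linarith
        _ = 4 * (k * W) / T := by field_simp; ring
        _ ≤ 4 * (k * W) := div_le_self (by positivity) (by linarith)
        _ ≤ 8 * X := by linarith
    -- The coefficients of `X` add up to `4 * max E 0` and 4 + 480 + 2 + 80 + 8 = 574 ≤ 600.
    linarith

end Problem
end FairnessMDP
end

noncomputable section
namespace FairnessMDP

/-! ### Reasoning about programs -/

namespace Cmd

/-- Bound for the number of steps if no loop has more than `L` passes. -/
def bound (L : ℕ) : Cmd → ℕ
  | .skip => 1
  | .setNat _ i j e => i.steps + j.steps + e.steps + 1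
  | .setReal _ i j e => i.steps + j.steps + e.steps + 1
  | .seq c d => c.bound L + d.bound L
  | .ite b c d => b.steps + (c.bound L + d.bound L)
  | .loop e c => e.steps + 1 + L * (c.bound L + 1)
  | .oracle => 1

/-- A loop multiplies the bound of its body by a factor of order `L`, and the nesting of loops is
fixed by the program text; hence `C` and `d` depend on the program alone. -/
theorem exists_bound_le (c : Cmd) : ∃ C d : ℕ, ∀ L, 1 ≤ L → c.bound L ≤ C * L ^ d := by
  induction c with
  | skip => exact ⟨1, 0, fun L _ => by simp [bound]⟩
  | setNat a i j e => exact ⟨_, 0, fun L _ => by simp only [bound, pow_zero, mul_one]; exact le_rfl⟩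
  | setReal a i j e =>
    exact ⟨_, 0, fun L _ => by simp only [bound, pow_zero, mul_one]; exact le_rfl⟩
  | oracle => exact ⟨1, 0, fun L _ => by simp [bound]⟩
  | seq c d hc hd =>
    obtain ⟨C, a, hC⟩ := hc
    obtain ⟨C', a', hC'⟩ := hd
    refine ⟨C + C', a + a', fun L hL => ?_⟩
    have h1 : C * L ^ a ≤ C * L ^ (a + a') := by gcongr; omega
    have h2 : C' * L ^ a' ≤ C' * L ^ (a + a') := by gcongr; omega
    have := hC L hL
    have := hC' L hL
    simp only [bound, add_mul]
    omega
  | ite b c d hc hd =>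
    obtain ⟨C, a, hC⟩ := hc
    obtain ⟨C', a', hC'⟩ := hd
    refine ⟨b.steps + (C + C'), a + a', fun L hL => ?_⟩
    have h1 : C * L ^ a ≤ C * L ^ (a + a') := by gcongr; omega
    have h2 : C' * L ^ a' ≤ C' * L ^ (a + a') := by gcongr; omega
    have h3 : b.steps ≤ b.steps * L ^ (a + a') := Nat.le_mul_of_pos_right _ (by positivity)
    have := hC L hL
    have := hC' L hL
    simp only [bound, add_mul]
    omega
  | loop e c hc =>
    obtain ⟨C, a, hC⟩ := hc
    refine ⟨e.steps + 1 + (C + 1), a + 1, fun L hL => ?_⟩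
    have h1 : e.steps + 1 ≤ (e.steps + 1) * L ^ (a + 1) :=
      Nat.le_mul_of_pos_right _ (by positivity)
    have h2 : 1 ≤ L ^ a := Nat.one_le_pow _ _ hL
    have h3 : L * (c.bound L + 1) ≤ L * (C * L ^ a + L ^ a) :=
      Nat.mul_le_mul_left _ (add_le_add (hC L hL) h2)
    calc bound L (.loop e c) ≤ (e.steps + 1) * L ^ (a + 1) + L * (C * L ^ a + L ^ a) :=
          add_le_add h1 h3
      _ = _ := by ring

/-- Whether a natural array occurs on the left of an assignment. -/
def writesNat (a : ℕ) : Cmd → Bool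
  | .setNat b _ _ _ => b == a
  | .seq c d => c.writesNat a || d.writesNat a
  | .ite _ c d => c.writesNat a || d.writesNat a
  | .loop _ c => c.writesNat a
  | .oracle => 4 == a
  | _ => false

/-- Whether a real array occurs on the left of an assignment. -/
def writesReal (a : ℕ) : Cmd → Bool
  | .setReal b _ _ _ => b == a
  | .seq c d => c.writesReal a || d.writesReal a
  | .ite _ c d => c.writesReal a || d.writesReal a
  | .loop _ c => c.writesReal a
  | _ => false

end Cmd

/-- The stores agree on all arrays that the program does not write to. -/
structure Frame (c : Cmd) (σ τ : Store) : Prop where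
  nat : ∀ a, c.writesNat a = false → τ.nat a = σ.nat a
  real : ∀ a, c.writesReal a = false → τ.real a = σ.real a

theorem Frame.refl (c : Cmd) (σ : Store) : Frame c σ σ := ⟨fun _ _ => rfl, fun _ _ => rfl⟩

theorem Frame.trans {c : Cmd} {σ τ υ : Store} (h : Frame c σ τ) (h' : Frame c τ υ) :
    Frame c σ υ :=
  ⟨fun a ha => (h'.nat a ha).trans (h.nat a ha), fun a ha => (h'.real a ha).trans (h.real a ha)⟩

theorem Frame.mono {c d : Cmd} {σ τ : Store} (h : Frame c σ τ)
    (hn : ∀ a, d.writesNat a = false → c.writesNat a = false)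
    (hr : ∀ a, d.writesReal a = false → c.writesReal a = false) : Frame d σ τ :=
  ⟨fun a ha => h.nat a (hn a ha), fun a ha => h.real a (hr a ha)⟩

section Logic

variable {k : ℕ} {O : (Fin k → Finset (Fin k) → ℝ) → Finset (Fin k)} {L : ℕ}

/-- Whether an array may change is read off from the syntax. For concrete commands such side
conditions therefore hold by `rfl`, which is used as the default proof in the `frame` lemmas below.
-/
theorem Cmd.frame_eval (c : Cmd) (σ : Store) : Frame c σ (c.eval O σ).1 := by
  induction c generalizing σ with
  | skip => exact Frame.refl _ _
  | setNat b i j e =>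
    refine ⟨fun a ha => ?_, fun a _ => rfl⟩
    have : a ≠ b := fun h => by simp [Cmd.writesNat, h] at ha
    funext i' j'
    simp [Cmd.eval, Store.writeNat, this]
  | setReal b i j e =>
    refine ⟨fun a _ => rfl, fun a ha => ?_⟩
    have : a ≠ b := fun h => by simp [Cmd.writesReal, h] at ha
    funext i' j'
    simp [Cmd.eval, Store.writeReal, this]
  | seq c d hc hd =>
    refine ((hc σ).mono ?_ ?_).trans ((hd _).mono ?_ ?_) <;>
      simp +contextual [Cmd.writesNat, Cmd.writesReal]
  | ite b c d hc hd =>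
    simp only [Cmd.eval]
    split_ifs
    · refine (hc σ).mono ?_ ?_ <;> simp +contextual [Cmd.writesNat, Cmd.writesReal]
    · refine (hd σ).mono ?_ ?_ <;> simp +contextual [Cmd.writesNat, Cmd.writesReal]
  | loop e c hc =>
    simp only [Cmd.eval]
    generalize e.eval σ = N
    induction N with
    | zero => exact Frame.refl _ _
    | succ N ih =>
      rw [Function.iterate_succ_apply']
      exact ih.trans ((hc _).mono (fun _ h => h) (fun _ h => h))
  | oracle =>
    refine ⟨fun a ha => ?_, fun a _ => rfl⟩
    have : a ≠ 4 := fun h => by simp [Cmd.writesNat, h] at ha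
    funext i j
    simp [Cmd.eval, Store.callOracle, this]

/-- The program reaches a store with the property `Q`, within the bound for its steps. -/
def Spec (O : (Fin k → Finset (Fin k) → ℝ) → Finset (Fin k)) (L : ℕ) (c : Cmd) (σ : Store)
    (Q : Store → Prop) : Prop :=
  Q (c.eval O σ).1 ∧ (c.eval O σ).2 ≤ c.bound L

variable {σ : Store} {Q Q' : Store → Prop} {c d : Cmd}

theorem Spec.imp (h : Spec O L c σ Q) (hQ : ∀ τ, Frame c σ τ → Q τ → Q' τ) : Spec O L c σ Q' :=
  ⟨hQ _ (c.frame_eval σ) h.1, h.2⟩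

theorem spec_skip (h : Q σ) : Spec O L .skip σ Q := ⟨h, le_rfl⟩

theorem spec_setNat {a : ℕ} {i j e : NatExpr}
    (h : Q (σ.writeNat a (i.eval σ) (j.eval σ) (e.eval σ))) : Spec O L (.setNat a i j e) σ Q :=
  ⟨h, le_rfl⟩

theorem spec_setReal {a : ℕ} {i j : NatExpr} {e : RealExpr}
    (h : Q (σ.writeReal a (i.eval σ) (j.eval σ) (e.eval σ))) : Spec O L (.setReal a i j e) σ Q :=
  ⟨h, le_rfl⟩

theorem spec_oracle (h : Q (σ.callOracle O)) : Spec O L .oracle σ Q := ⟨h, le_rfl⟩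

theorem spec_seq (h : Spec O L c σ fun τ => Spec O L d τ Q) : Spec O L (.seq c d) σ Q :=
  ⟨h.1.1, add_le_add h.2 h.1.2⟩

theorem spec_ite {b : Test} (hc : b.Holds σ → Spec O L c σ Q) (hd : ¬ b.Holds σ → Spec O L d σ Q) :
    Spec O L (.ite b c d) σ Q := by
  unfold Spec
  simp only [Cmd.eval, Cmd.bound]
  split_ifs with hb
  · exact ⟨(hc hb).1, Nat.add_le_add_left ((hc hb).2.trans (Nat.le_add_right _ _)) _⟩
  · exact ⟨(hd hb).1, Nat.add_le_add_left ((hd hb).2.trans (Nat.le_add_left _ _)) _⟩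

/-- The number of passes is evaluated once, before the first pass. Each pass receives a frame
relative to the start of the loop, so an invariant has to mention only the arrays that the loop
writes. -/
theorem spec_loop {e : NatExpr} (I : ℕ → Store → Prop) (hL : e.eval σ ≤ L) (h0 : I 0 σ)
    (hs : ∀ i < e.eval σ, ∀ τ, Frame (.loop e c) σ τ → I i τ → Spec O L c τ (I (i + 1))) :
    Spec O L (.loop e c) σ (I (e.eval σ)) := by
  have key : ∀ N ≤ e.eval σ, ∀ q : Store × ℕ, q = (fun q : Store × ℕ =>
        let r := c.eval O q.1
        (r.1, q.2 + r.2 + 1))^[N] (σ, e.steps + 1) →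
      I N q.1 ∧ Frame (.loop e c) σ q.1 ∧ q.2 ≤ e.steps + 1 + N * (c.bound L + 1) := by
    intro N
    induction N with
    | zero => rintro - q rfl; exact ⟨h0, Frame.refl _ _, by simp⟩
    | succ N ih =>
      rintro hN q rfl
      rw [Function.iterate_succ_apply']
      obtain ⟨q, hq⟩ : ∃ q, q = (fun q : Store × ℕ =>
        let r := c.eval O q.1
        (r.1, q.2 + r.2 + 1))^[N] (σ, e.steps + 1) := ⟨_, rfl⟩
      obtain ⟨h1, h2, h3⟩ := ih (by omega) q hq
      rw [← hq]
      have h4 := hs N (by omega) _ h2 h1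
      refine ⟨h4.1, h2.trans ((c.frame_eval _).mono (fun _ h => h) (fun _ h => h)), ?_⟩
      have h5 := h4.2
      simp only [add_mul, one_mul]
      omega
  obtain ⟨h1, -, h3⟩ := key _ le_rfl _ rfl
  refine ⟨h1, h3.trans ?_⟩
  simp only [Cmd.bound]
  gcongr

end Logic

/-! ### Abbreviations for programs -/

/-- The scalar variable kept in entry `(0, 0)` of the array `a`. -/
def scalar (a : ℕ) : NatExpr := .read a (.const 0) (.const 0)

/-- Assignment to a scalar variable. -/
def assign (a : ℕ) (e : NatExpr) : Cmd := .setNat a (.const 0) (.const 0) e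

/-- The program `c` for the values `0, …, e - 1` of the scalar variable `v`. -/
def forLoop (v : ℕ) (e : NatExpr) (c : Cmd) : Cmd :=
  .seq (assign v (.const 0)) (.loop e (.seq c (assign v (.plus (scalar v) (.const 1)))))

attribute [simp] NatExpr.eval RealExpr.eval Test.Holds

namespace Store

variable {σ : Store} {a b i j v : ℕ} {r : ℝ}

@[simp] theorem writeNat_nat_of_ne (h : b ≠ a) : (σ.writeNat a i j v).nat b = σ.nat b := by
  funext i' j'; simp [writeNat, h]

@[simp] theorem writeNat_nat_self (i' j' : ℕ) :
    (σ.writeNat a i j v).nat a i' j' = if i' = i ∧ j' = j then v else σ.nat a i' j' := by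
  simp [writeNat]

@[simp] theorem writeNat_real : (σ.writeNat a i j v).real = σ.real := rfl

@[simp] theorem writeReal_nat : (σ.writeReal a i j r).nat = σ.nat := rfl

@[simp] theorem writeReal_real_of_ne (h : b ≠ a) : (σ.writeReal a i j r).real b = σ.real b := by
  funext i' j'; simp [writeReal, h]

@[simp] theorem writeReal_real_self (i' j' : ℕ) :
    (σ.writeReal a i j r).real a i' j' = if i' = i ∧ j' = j then r else σ.real a i' j' := by
  simp [writeReal]

end Store

@[simp] theorem scalar_eval (a : ℕ) (σ : Store) : (scalar a).eval σ = σ.nat a 0 0 := rfl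

theorem spec_assign {k : ℕ} {O : (Fin k → Finset (Fin k) → ℝ) → Finset (Fin k)} {L : ℕ}
    {σ : Store} {Q : Store → Prop} {a : ℕ} {e : NatExpr} (h : Q (σ.writeNat a 0 0 (e.eval σ))) :
    Spec O L (assign a e) σ Q := ⟨h, le_rfl⟩

/-- Incrementing the counter belongs to the pass, so the invariant is required after `i + 1` has
been written; `hv` keeps the body from changing the counter. -/
theorem spec_forLoop {k : ℕ} {O : (Fin k → Finset (Fin k) → ℝ) → Finset (Fin k)} {L : ℕ}
    {σ : Store} {Q : Store → Prop} {c : Cmd} {v : ℕ} {e : NatExpr} (I : ℕ → Store → Prop) (N : ℕ)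
    (hN : e.eval (σ.writeNat v 0 0 0) = N) (hL : N ≤ L) (hv : c.writesNat v = false)
    (h0 : I 0 (σ.writeNat v 0 0 0))
    (hs : ∀ i < N, ∀ τ, Frame (forLoop v e c) σ τ → τ.nat v 0 0 = i → I i τ →
      Spec O L c τ fun υ => I (i + 1) (υ.writeNat v 0 0 (i + 1)))
    (hQ : ∀ τ, Frame (forLoop v e c) σ τ → I N τ → Q τ) :
    Spec O L (forLoop v e c) σ Q := by
  have h1 : Frame (forLoop v e c) σ (σ.writeNat v 0 0 0) := by
    have := (assign v (.const 0)).frame_eval (O := O) σ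
    refine this.mono ?_ ?_ <;>
      simp +contextual [forLoop, assign, Cmd.writesNat, Cmd.writesReal]
  refine Spec.imp (Q := fun τ => I N τ) ?_ (fun τ hf => hQ τ hf)
  refine spec_seq (spec_assign ?_)
  refine Spec.imp (spec_loop (fun i τ => I i τ ∧ τ.nat v 0 0 = i) ?_ ?_ ?_) ?_
  · exact hN.trans_le hL
  · exact ⟨h0, by simp [Store.writeNat_nat_self, NatExpr.eval]⟩
  · rintro i hi τ hf ⟨hI, hi'⟩
    have hf' : Frame (forLoop v e c) σ τ := by
      refine h1.trans (hf.mono ?_ ?_) <;>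
        simp +contextual [forLoop, assign, Cmd.writesNat, Cmd.writesReal]
    refine spec_seq ((hs i (hN ▸ hi) τ hf' hi' hI).imp fun υ hυ hI' => spec_assign ?_)
    have : υ.nat v 0 0 = i := by rw [hυ.nat v hv, hi']
    simp only [NatExpr.eval, scalar_eval, this]
    exact ⟨hI', by simp [Store.writeNat_nat_self]⟩
  · intro τ _ h
    exact hN ▸ h.1

end FairnessMDP
end

noncomputable section
namespace FairnessMDP

variable {k n : ℕ}

/-! ### Representation of the data in the store

Natural arrays of the program: `5` scopes, `6` states of the cover, `7` number of these states,
`8` current state, `9` target, `10` remaining stay, `11` numbers of observations, `12` number of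
states of the cover already chosen, `13` and `14` mask and power of two, `15` to `18` counters of
loops, `19` and `21` beginning and number of the states found for the current criterion, `20`
number of differences. Real arrays of the program: `3` estimates, `4` sums of losses. -/

/-- The values of `f` are the bits of `s`. -/
def Bits (f : ℕ → ℕ) (s : Finset (Fin k)) : Prop := ∀ j : Fin k, f j = if j ∈ s then 1 else 0

/-- Uniqueness of binary expansions. It guarantees that writing the table entry of one configuration
leaves the others intact. -/
theorem mask_injective : Function.Injective (mask : Finset (Fin k) → ℕ) := by
  intro b b' h
  have h1 : ∀ s : Finset (Fin k), mask s = ∑ i ∈ s.map Fin.valEmbedding, 2 ^ i := fun s => by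
    simp [mask]
  rw [h1, h1] at h
  exact Finset.map_injective _ (Finset.geomSum_injective le_rfl h)

/-- The elements of `b` with number less than `j`. -/
def below (b : Finset (Fin k)) (j : ℕ) : Finset (Fin k) := b.filter fun u : Fin k => (u : ℕ) < j

theorem below_zero (b : Finset (Fin k)) : below b 0 = ∅ := by simp [below]

theorem below_card (b : Finset (Fin k)) : below b k = b :=
  Finset.filter_true_of_mem fun u _ => u.2

theorem below_succ (b : Finset (Fin k)) {j : ℕ} (hj : j < k) :
    below b (j + 1) = if ⟨j, hj⟩ ∈ b then insert ⟨j, hj⟩ (below b j) else below b j := by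
  ext u
  have hu : (u : ℕ) = j ↔ u = ⟨j, hj⟩ := by rw [Fin.ext_iff]
  split_ifs with h <;> simp only [below, Finset.mem_filter, Finset.mem_insert]
  · constructor
    · rintro ⟨h1, h2⟩
      rcases Nat.lt_succ_iff_lt_or_eq.1 h2 with h3 | h3
      · exact .inr ⟨h1, h3⟩
      · exact .inl (hu.1 h3)
    · rintro (rfl | ⟨h1, h2⟩)
      · exact ⟨h, Nat.lt_succ_self _⟩
      · exact ⟨h1, by omega⟩
  · refine and_congr_right fun h1 => ?_
    have : (u : ℕ) ≠ j := fun h' => h (hu.1 h' ▸ h1)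
    omega

theorem notMem_below (b : Finset (Fin k)) {j : ℕ} (hj : j < k) : ⟨j, hj⟩ ∉ below b j := by
  simp [below]

theorem sum_below_succ (b : Finset (Fin k)) {j : ℕ} (hj : j < k) (f : Fin k → ℕ) :
    ∑ u ∈ below b (j + 1), f u
      = ∑ u ∈ below b j, f u + if ⟨j, hj⟩ ∈ b then f ⟨j, hj⟩ else 0 := by
  rw [below_succ b hj]
  split_ifs
  · rw [Finset.sum_insert (notMem_below b hj), add_comm]
  · rfl

/-- The data that do not change after the preparations. -/
structure StaticRep (P : Problem k n) (p : Params) (K : List (Finset (Fin k))) (σ : Store) :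
    Prop where
  card : σ.nat 0 0 0 = k
  m : σ.nat 0 0 2 = p.m
  T : σ.nat 0 0 3 = p.T
  B : σ.real 0 0 0 = p.B
  δ : σ.real 0 0 1 = p.δ
  scope : ∀ i : Fin k, Bits (σ.nat 5 i) (P.scope i)
  length : σ.nat 7 0 0 = K.length
  cover : ∀ r, Bits (σ.nat 6 r) (K.getD r ∅)

/-- The observations. -/
structure SeenRep (P : Problem k n) (p : Params) (σ : Store)
    (seen : List (Finset (Fin k) × (Fin k → ℝ))) : Prop where
  visits : ∀ (i : Fin k) b, σ.nat 11 i (mask b) = P.visits seen i b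
  loss : ∀ (i : Fin k) b, σ.real 4 i (mask b) = P.lossSum seen i b
  estimate : ∀ (i : Fin k) b, σ.real 3 i (mask b) = P.optimistic p seen i b

/-- The memory of the algorithm without the observations. -/
structure MemoryRep (K : List (Finset (Fin k))) (σ : Store) (M : Memory k) : Prop where
  state : Bits (fun j => σ.nat 8 j 0) M.state
  target : Bits (fun j => σ.nat 9 j 0) M.target
  stay : σ.nat 10 0 0 = M.stay
  todo : M.todo = K.drop (σ.nat 12 0 0)

theorem StaticRep.frame {P : Problem k n} {p : Params} {K : List (Finset (Fin k))} {σ τ : Store}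
    {c : Cmd} (h : StaticRep P p K σ) (hf : Frame c σ τ) (h0 : c.writesNat 0 = false := by rfl)
    (h5 : c.writesNat 5 = false := by rfl) (h6 : c.writesNat 6 = false := by rfl)
    (h7 : c.writesNat 7 = false := by rfl) (hr : c.writesReal 0 = false := by rfl) :
    StaticRep P p K τ := by
  have h0 := hf.nat 0 h0
  have h5 := hf.nat 5 h5
  have h6 := hf.nat 6 h6
  have h7 := hf.nat 7 h7
  have hr := hf.real 0 hr
  constructor
  · rw [h0, h.card]
  · rw [h0, h.m]
  · rw [h0, h.T]
  · rw [hr, h.B]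
  · rw [hr, h.δ]
  · rw [h5]; exact h.scope
  · rw [h7, h.length]
  · rw [h6]; exact h.cover

section Specs

variable {O : (Fin k → Finset (Fin k) → ℝ) → Finset (Fin k)} {L : ℕ} {σ : Store}

/-! ### Masks -/

/-- Mask of the local configuration, at the criterion in variable `15`, of the state in array `a`. -/
def maskCmd (a : ℕ) : Cmd :=
  .seq (assign 13 (.const 0)) (.seq (assign 14 (.const 1)) (forLoop 16 (scalar 0)
    (.seq
      (.ite (.natLE (.const 2) (.plus (.read 5 (scalar 15) (scalar 16))
          (.read a (scalar 16) (.const 0))))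
        (assign 13 (.plus (scalar 13) (scalar 14))) .skip)
      (assign 14 (.plus (scalar 14) (scalar 14))))))

/-- Powers of two arise by doubling variable `14`, as natural numbers cannot be multiplied. Two bits
have sum at least 2 exactly for members of the intersection. -/
theorem spec_maskCmd {a : ℕ} (ha : a ∉ ({13, 14, 16} : Finset ℕ)) (hk : σ.nat 0 0 0 = k)
    (hkL : k ≤ L) {i : Fin k} (hi : σ.nat 15 0 0 = i) {S s : Finset (Fin k)}
    (hS : Bits (σ.nat 5 i) S) (hs : Bits (fun j => σ.nat a j 0) s) :
    Spec O L (maskCmd a) σ fun τ => τ.nat 13 0 0 = mask (s ∩ S) := by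
  simp only [Finset.mem_insert, Finset.mem_singleton, not_or] at ha
  obtain ⟨ha1, ha2, ha3⟩ := ha
  refine spec_seq (spec_assign (spec_seq (spec_assign ?_)))
  refine spec_forLoop (fun j τ => τ.nat 14 0 0 = 2 ^ j ∧
    τ.nat 13 0 0 = ∑ u ∈ below (s ∩ S) j, 2 ^ (u : ℕ)) k ?_ hkL rfl ?_ ?_ ?_
  · simp [hk]
  · simp [below_zero]
  · rintro j hj τ hf hj' ⟨h1, h2⟩
    have e5 : τ.nat 5 i j = if (⟨j, hj⟩ : Fin k) ∈ S then 1 else 0 := by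
      rw [hf.nat 5 rfl]; simpa using hS ⟨j, hj⟩
    have e15 : τ.nat 15 0 0 = i := by rw [hf.nat 15 rfl]; simpa using hi
    have ea : τ.nat a j 0 = if (⟨j, hj⟩ : Fin k) ∈ s then 1 else 0 := by
      rw [hf.nat a (by simp [forLoop, assign, Cmd.writesNat, Ne.symm ha1, Ne.symm ha2, Ne.symm ha3])]
      simpa [ha1, ha2] using hs ⟨j, hj⟩
    have hsum := sum_below_succ (s ∩ S) hj (fun u => 2 ^ (u : ℕ))
    refine spec_seq (spec_ite (fun hb => spec_assign (spec_assign ?_))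
      (fun hb => spec_skip (spec_assign ?_)))
    · simp only [Test.Holds, NatExpr.eval, scalar_eval, e15, hj', e5, ea] at hb
      have hm : (⟨j, hj⟩ : Fin k) ∈ s ∩ S := by
        rw [Finset.mem_inter]; split_ifs at hb <;> simp_all
      rw [if_pos hm] at hsum
      simp [h1, h2, hsum, pow_succ, mul_two]
    · simp only [Test.Holds, NatExpr.eval, scalar_eval, e15, hj', e5, ea] at hb
      have hm : (⟨j, hj⟩ : Fin k) ∉ s ∩ S := by
        rw [Finset.mem_inter]; split_ifs at hb <;> simp_all
      rw [if_neg hm] at hsum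
      simp [h1, h2, hsum, pow_succ, mul_two]
  · rintro τ - ⟨-, h⟩
    rw [h, mask, below_card]

/-! ### Recording the losses -/

/-- The estimate for the mask in variable `13` and the criterion in variable `15`. -/
def estimateExpr : RealExpr :=
  .minus (.over (.read 4 (scalar 15) (scalar 13)) (.cast (.read 11 (scalar 15) (scalar 13))))
    (.times (.times (.cast (.const 10)) (.read 0 (.const 0) (.const 0)))
      (.sqrt (.over (.times (.cast (.read 0 (.const 0) (.const 2)))
        (.log (.over (.times (.cast (scalar 0)) (.cast (.read 0 (.const 0) (.const 3))))
          (.read 0 (.const 0) (.const 1))))) (.cast (.read 11 (scalar 15) (scalar 13))))))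

/-- Update of the tables for the current state and the supplied losses. -/
def recordCmd : Cmd :=
  forLoop 15 (scalar 0) (.seq (maskCmd 8)
    (.seq (.setNat 11 (scalar 15) (scalar 13)
      (.plus (.read 11 (scalar 15) (scalar 13)) (.const 1)))
    (.seq (.setReal 4 (scalar 15) (scalar 13)
      (.plus (.read 4 (scalar 15) (scalar 13)) (.read 2 (scalar 15) (.const 0))))
    (.setReal 3 (scalar 15) (scalar 13) estimateExpr))))

/-- An observation affects, for each criterion, only the entry of the current local configuration.
So the exponentially long rows of the tables never have to be traversed. -/
theorem spec_recordCmd {P : Problem k n} {p : Params} {K : List (Finset (Fin k))}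
    {seen : List (Finset (Fin k) × (Fin k → ℝ))} {s : Finset (Fin k)} {y : Fin k → ℝ}
    (hkL : k ≤ L) (hst : StaticRep P p K σ) (hseen : SeenRep P p σ seen)
    (hs : Bits (fun j => σ.nat 8 j 0) s) (hy : ∀ i : Fin k, σ.real 2 i 0 = y i) :
    Spec O L recordCmd σ fun τ => SeenRep P p τ ((s, y) :: seen) := by
  refine spec_forLoop (fun j τ => ∀ (i : Fin k) b,
    τ.nat 11 i (mask b) = P.visits (if (i : ℕ) < j then (s, y) :: seen else seen) i b ∧
    τ.real 4 i (mask b) = P.lossSum (if (i : ℕ) < j then (s, y) :: seen else seen) i b ∧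
    τ.real 3 i (mask b) = P.optimistic p (if (i : ℕ) < j then (s, y) :: seen else seen) i b)
    k ?_ hkL rfl ?_ ?_ ?_
  · simp [hst.card]
  · intro i b
    simp [hseen.visits, hseen.loss, hseen.estimate]
  · intro j hj τ hf hj' hI
    have hst' : StaticRep P p K τ := hst.frame hf
    refine spec_seq (Spec.imp (spec_maskCmd (i := ⟨j, hj⟩) (by decide) hst'.card hkL hj'
      (hst'.scope _) (s := s) ?_) ?_)
    · rw [hf.nat 8 rfl]; exact hs
    intro υ hυ hmask
    have hst'' : StaticRep P p K υ := hst'.frame hυ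
    have e15 : υ.nat 15 0 0 = j := by rw [hυ.nat 15 rfl, hj']
    have ey : υ.real 2 j 0 = y ⟨j, hj⟩ := by rw [hυ.real 2 rfl, hf.real 2 rfl]; exact hy ⟨j, hj⟩
    refine spec_seq (spec_setNat (spec_seq (spec_setReal (spec_setReal ?_))))
    have e11 := hυ.nat 11 rfl
    have e4 := hυ.real 4 rfl
    have e3 := hυ.real 3 rfl
    intro i b
    obtain ⟨h1, h2, h3⟩ := hI i b
    by_cases hi : (i : ℕ) = j
    · obtain rfl : i = ⟨j, hj⟩ := Fin.ext hi
      simp only [lt_irrefl, if_false] at h1 h2 h3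
      by_cases hb : s ∩ P.scope ⟨j, hj⟩ = b
      · subst hb
        simp [estimateExpr, e15, hmask, e11, e4, ey, h1, h2, Problem.visits_cons,
          Problem.lossSum_cons, Problem.optimistic, hst''.m, hst''.T, hst''.B, hst''.δ, hst''.card]
      · have hb' : mask b ≠ mask (s ∩ P.scope ⟨j, hj⟩) := fun h => hb (mask_injective h).symm
        simp [e15, hmask, hb', hb, e11, e4, e3, h1, h2, h3, Problem.visits_cons,
          Problem.lossSum_cons, Problem.optimistic]
    · have hij : (i : ℕ) < j + 1 ↔ (i : ℕ) < j := by omega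
      simp [e15, hi, hij, e11, e4, e3, h1, h2, h3]
  · intro τ _ h
    simp only [Fin.is_lt, if_true] at h
    exact ⟨fun i b => (h i b).1, fun i b => (h i b).2.1, fun i b => (h i b).2.2⟩

end Specs
end FairnessMDP
end

noncomputable section
namespace FairnessMDP

variable {k n : ℕ}

theorem SeenRep.frame {P : Problem k n} {p : Params} {σ τ : Store}
    {seen : List (Finset (Fin k) × (Fin k → ℝ))} {c : Cmd} (h : SeenRep P p σ seen)
    (hf : Frame c σ τ) (h11 : c.writesNat 11 = false := by rfl)
    (h4 : c.writesReal 4 = false := by rfl) (h3 : c.writesReal 3 = false := by rfl) :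
    SeenRep P p τ seen := by
  constructor
  · rw [hf.nat 11 h11]; exact h.visits
  · rw [hf.real 4 h4]; exact h.loss
  · rw [hf.real 3 h3]; exact h.estimate

theorem MemoryRep.frame {K : List (Finset (Fin k))} {σ τ : Store} {M : Memory k} {c : Cmd}
    (h : MemoryRep K σ M) (hf : Frame c σ τ) (h8 : c.writesNat 8 = false := by rfl)
    (h9 : c.writesNat 9 = false := by rfl) (h10 : c.writesNat 10 = false := by rfl)
    (h12 : c.writesNat 12 = false := by rfl) : MemoryRep K τ M := by
  constructor
  · rw [hf.nat 8 h8]; exact h.state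
  · rw [hf.nat 9 h9]; exact h.target
  · rw [hf.nat 10 h10]; exact h.stay
  · rw [hf.nat 12 h12]; exact h.todo

section Specs

variable {O : (Fin k → Finset (Fin k) → ℝ) → Finset (Fin k)} {L : ℕ} {σ : Store}

/-! ### Planning -/

/-- Number of criteria in which the current state and the target differ, in variable `20`. -/
def differCmd : Cmd :=
  .seq (assign 20 (.const 0)) (forLoop 16 (scalar 0) (assign 20 (.plus (scalar 20)
    (.plus (.minus (.read 8 (scalar 16) (.const 0)) (.read 9 (scalar 16) (.const 0)))
      (.minus (.read 9 (scalar 16) (.const 0)) (.read 8 (scalar 16) (.const 0)))))))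

/-- Of the two truncated differences of bits, one is positive exactly if the bits differ, so the sum
vanishes only for equal states. -/
theorem spec_differCmd (hk : σ.nat 0 0 0 = k) (hkL : k ≤ L) {s s' : Finset (Fin k)}
    (hs : Bits (fun j => σ.nat 8 j 0) s) (hs' : Bits (fun j => σ.nat 9 j 0) s') :
    Spec O L differCmd σ fun τ => τ.nat 20 0 0 = 0 ↔ s = s' := by
  refine spec_seq (spec_assign ?_)
  refine spec_forLoop (fun j τ => τ.nat 20 0 0 = 0 ↔ ∀ u : Fin k, (u : ℕ) < j → (u ∈ s ↔ u ∈ s'))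
    k ?_ hkL rfl ?_ ?_ ?_
  · simp [hk]
  · simp
  · intro j hj τ hf hj' hI
    refine spec_assign ?_
    have e8 : τ.nat 8 j 0 = if (⟨j, hj⟩ : Fin k) ∈ s then 1 else 0 := by
      rw [hf.nat 8 rfl]; exact hs ⟨j, hj⟩
    have e9 : τ.nat 9 j 0 = if (⟨j, hj⟩ : Fin k) ∈ s' then 1 else 0 := by
      rw [hf.nat 9 rfl]; exact hs' ⟨j, hj⟩
    have h1 : (∀ u : Fin k, (u : ℕ) < j + 1 → (u ∈ s ↔ u ∈ s')) ↔
        (∀ u : Fin k, (u : ℕ) < j → (u ∈ s ↔ u ∈ s')) ∧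
          ((⟨j, hj⟩ : Fin k) ∈ s ↔ (⟨j, hj⟩ : Fin k) ∈ s') := by
      constructor
      · exact fun h => ⟨fun u hu => h u (by omega), h ⟨j, hj⟩ (Nat.lt_succ_self j)⟩
      · rintro ⟨h1, h2⟩ u hu
        rcases Nat.lt_succ_iff_lt_or_eq.1 hu with h3 | h3
        · exact h1 u h3
        · rwa [show u = ⟨j, hj⟩ from Fin.ext h3]
    rw [h1, ← hI]
    simp only [Store.writeNat_nat_of_ne (show 20 ≠ 16 by decide), Store.writeNat_nat_self,
      NatExpr.eval, scalar_eval, hj', e8, e9, and_self, if_true]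
    split_ifs <;> simp_all
  · rintro τ - h
    rw [h, Finset.ext_iff]
    simp

/-- The state with the bits `e`, for the index in variable `16`, becomes the target. -/
def copyCmd (e : NatExpr) : Cmd := forLoop 16 (scalar 0) (.setNat 9 (scalar 16) (.const 0) e)

theorem spec_copyCmd (hk : σ.nat 0 0 0 = k) (hkL : k ≤ L) {e : NatExpr} {s : Finset (Fin k)}
    (he : ∀ (j : Fin k) τ, Frame (copyCmd e) σ τ → τ.nat 16 0 0 = j →
      e.eval τ = if j ∈ s then 1 else 0) :
    Spec O L (copyCmd e) σ fun τ => Bits (fun j => τ.nat 9 j 0) s := by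
  refine spec_forLoop (fun j τ => ∀ u : Fin k, (u : ℕ) < j → τ.nat 9 u 0 = if u ∈ s then 1 else 0)
    k ?_ hkL rfl ?_ ?_ ?_
  · simp [hk]
  · simp
  · intro j hj τ hf hj' hI
    refine spec_setNat ?_
    intro u hu
    rw [he ⟨j, hj⟩ τ hf hj']
    by_cases hu' : (u : ℕ) = j
    · obtain rfl : u = ⟨j, hj⟩ := Fin.ext hu'
      simp [hj']
    · simpa [hj', hu'] using hI u (by omega)
  · exact fun τ _ h u => h u u.2

/-- Number of observations of the least observed local configuration of the target. -/
def stayCmd : Cmd :=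
  forLoop 15 (scalar 0) (.seq (maskCmd 9)
    (.ite (.natLE (scalar 15) (.const 0)) (assign 10 (.read 11 (scalar 15) (scalar 13)))
      (assign 10 (.minus (scalar 10) (.minus (scalar 10) (.read 11 (scalar 15) (scalar 13)))))))

/-- Truncated subtraction yields the minimum as `a - (a - b)`; the first criterion only initializes
the variable. -/
theorem spec_stayCmd {P : Problem k n} {p : Params} {K : List (Finset (Fin k))}
    {seen : List (Finset (Fin k) × (Fin k → ℝ))} {s : Finset (Fin k)} (hk : 1 ≤ k)
    (hkL : k ≤ L) (hst : StaticRep P p K σ) (hseen : SeenRep P p σ seen)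
    (hs : Bits (fun j => σ.nat 9 j 0) s) :
    Spec O L stayCmd σ fun τ => τ.nat 10 0 0 = ⨅ i, P.visits seen i (s ∩ P.scope i) := by
  refine spec_forLoop (fun j τ => 1 ≤ j →
    (∀ u : Fin k, (u : ℕ) < j → τ.nat 10 0 0 ≤ P.visits seen u (s ∩ P.scope u)) ∧
    ∃ u, P.visits seen u (s ∩ P.scope u) = τ.nat 10 0 0) k ?_ hkL rfl ?_ ?_ ?_
  · simp [hst.card]
  · intro h
    omega
  · intro j hj τ hf hj' hI
    have hst' : StaticRep P p K τ := hst.frame hf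
    refine spec_seq (Spec.imp (spec_maskCmd (i := ⟨j, hj⟩) (by decide) hst'.card hkL hj'
      (hst'.scope _) (s := s) ?_) ?_)
    · rw [hf.nat 9 rfl]; exact hs
    intro υ hυ hmask
    have e15 : υ.nat 15 0 0 = j := by rw [hυ.nat 15 rfl, hj']
    have e10 := hυ.nat 10 rfl
    have e11 : υ.nat 11 j (mask (s ∩ P.scope ⟨j, hj⟩))
        = P.visits seen ⟨j, hj⟩ (s ∩ P.scope ⟨j, hj⟩) := by
      rw [hυ.nat 11 rfl, hf.nat 11 rfl]; exact hseen.visits ⟨j, hj⟩ _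
    have hlast : ∀ {N : ℕ}, N ≤ P.visits seen ⟨j, hj⟩ (s ∩ P.scope ⟨j, hj⟩) →
        (∀ u : Fin k, (u : ℕ) < j → N ≤ P.visits seen u (s ∩ P.scope u)) →
        ∀ u : Fin k, (u : ℕ) < j + 1 → N ≤ P.visits seen u (s ∩ P.scope u) := by
      intro N h1 h2 u hu
      rcases Nat.lt_succ_iff_lt_or_eq.1 hu with h3 | h3
      · exact h2 u h3
      · rwa [show u = ⟨j, hj⟩ from Fin.ext h3]
    refine spec_ite (fun hb => spec_assign ?_) (fun hb => spec_assign ?_)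
    · simp only [Test.Holds, NatExpr.eval, scalar_eval, e15] at hb
      intro _
      simp only [Store.writeNat_nat_of_ne (show 10 ≠ 15 by decide), Store.writeNat_nat_self,
        NatExpr.eval, scalar_eval, e15, hmask, e11, and_self, if_true]
      exact ⟨hlast le_rfl fun u hu => by omega, _, rfl⟩
    · simp only [Test.Holds, NatExpr.eval, scalar_eval, e15] at hb
      intro _
      obtain ⟨h1, u, h2⟩ := hI (by omega)
      simp only [Store.writeNat_nat_of_ne (show 10 ≠ 15 by decide), Store.writeNat_nat_self,
        NatExpr.eval, scalar_eval, e15, hmask, e11, e10, and_self, if_true]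
      refine ⟨hlast (by omega) fun u hu => (Nat.sub_le _ _).trans (h1 u hu), ?_⟩
      by_cases hle : τ.nat 10 0 0 ≤ P.visits seen ⟨j, hj⟩ (s ∩ P.scope ⟨j, hj⟩)
      · exact ⟨u, by omega⟩
      · exact ⟨⟨j, hj⟩, by omega⟩
  · intro τ _ h
    obtain ⟨h1, u, h2⟩ := h hk
    have : Nonempty (Fin k) := ⟨u⟩
    exact le_antisymm (le_ciInf fun i => h1 i i.2) (h2 ▸ ciInf_le (OrderBot.bddBelow _) u)

/-- If the last visit is completed, choose the next one. -/
def planCmd : Cmd :=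
  .seq differCmd (.ite (.natLE (.plus (scalar 20) (scalar 10)) (.const 0))
    (.ite (.natLE (.plus (scalar 12) (.const 1)) (scalar 7))
      (.seq (copyCmd (.read 6 (scalar 12) (scalar 16)))
        (.seq (assign 12 (.plus (scalar 12) (.const 1))) (assign 10 (.const 1))))
      (.seq .oracle (.seq (copyCmd (.read 4 (scalar 16) (.const 0))) stayCmd)))
    .skip)

theorem spec_planCmd {P : Problem k n} {p : Params} {K : List (Finset (Fin k))} {M : Memory k}
    (hk : 1 ≤ k) (hkL : k ≤ L) (hst : StaticRep P p K σ) (hseen : SeenRep P p σ M.seen)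
    (hM : MemoryRep K σ M) :
    Spec O L planCmd σ fun τ => MemoryRep K τ (P.plan p O M) := by
  refine spec_seq (Spec.imp (spec_differCmd hst.card hkL hM.state hM.target) ?_)
  intro τ hf hd
  have hst : StaticRep P p K τ := hst.frame hf
  have hseen : SeenRep P p τ M.seen := hseen.frame hf
  have hM : MemoryRep K τ M := hM.frame hf
  clear hf
  refine spec_ite (fun hb => ?_) (fun hb => spec_skip ?_)
  · simp only [Test.Holds, NatExpr.eval, scalar_eval, Nat.le_zero, Nat.add_eq_zero_iff, hd,
      hM.stay] at hb
    have hplan : P.plan p O M = match M.todo with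
      | s :: rest => { M with todo := rest, target := s, stay := 1 }
      | [] => { M with
        target := O (P.optimistic p M.seen)
        stay := ⨅ i, P.visits M.seen i (O (P.optimistic p M.seen) ∩ P.scope i) } := by
      unfold Problem.plan; exact if_pos hb
    refine spec_ite (fun hlt => ?_) (fun hlt => ?_)
    · simp only [Test.Holds, NatExpr.eval, scalar_eval, hst.length] at hlt
      have hdrop := List.drop_eq_getElem_cons (show τ.nat 12 0 0 < K.length from hlt)
      rw [hM.todo, hdrop] at hplan
      simp only at hplan
      refine spec_seq (Spec.imp (spec_copyCmd hst.card hkL (s := K[τ.nat 12 0 0]) ?_) ?_)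
      · intro j υ hυ hj
        simp only [NatExpr.eval, scalar_eval, hj]
        rw [hυ.nat 6 rfl, hυ.nat 12 rfl, hst.cover _ j, List.getD_eq_getElem _ _ hlt]
      · intro υ hυ hbits
        refine spec_seq (spec_assign (spec_assign ?_))
        rw [hplan]
        have e8 := hυ.nat 8 rfl
        have e12 := hυ.nat 12 rfl
        constructor
        · simpa [e8] using hM.state
        · simpa using hbits
        · simp
        · simp [e12]
    · simp only [Test.Holds, NatExpr.eval, scalar_eval, hst.length] at hlt
      rw [hM.todo, List.drop_eq_nil_of_le (by omega)] at hplan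
      simp only at hplan
      refine spec_seq (spec_oracle ?_)
      have hO : Frame .oracle τ (τ.callOracle O) := Cmd.frame_eval (O := O) .oracle τ
      have hst' : StaticRep P p K (τ.callOracle O) := hst.frame hO
      -- Real array `3` holds the current estimates at all masks, so the oracle can be called
      -- without any preparation.
      have hanswer : ∀ j : Fin k, (τ.callOracle O).nat 4 j 0
          = if j ∈ O (P.optimistic p M.seen) then 1 else 0 := by
        intro j
        have : (fun (i : Fin k) b => τ.real 3 i (mask b)) = P.optimistic p M.seen := by
          funext i b; exact hseen.estimate i b
        simp [Store.callOracle, this]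
      refine spec_seq (Spec.imp (spec_copyCmd hst'.card hkL
        (s := O (P.optimistic p M.seen)) ?_) ?_)
      · intro j υ hυ hj
        simp only [NatExpr.eval, scalar_eval, hj]
        rw [hυ.nat 4 rfl, hanswer]
      · intro υ hυ hbits
        refine Spec.imp (spec_stayCmd hk hkL (hst'.frame hυ) ((hseen.frame hO).frame hυ) hbits) ?_
        intro φ hφ hstay
        rw [hplan]
        constructor
        · rw [hφ.nat 8 rfl, hυ.nat 8 rfl, hO.nat 8 rfl]; exact hM.state
        · rw [hφ.nat 9 rfl]; exact hbits
        · exact hstay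
        · rw [hφ.nat 12 rfl, hυ.nat 12 rfl, hO.nat 12 rfl]
          exact (List.drop_eq_nil_of_le (by omega)).symm
  · have hb' : ¬ (M.state = M.target ∧ M.stay = 0) := by
      simpa only [Test.Holds, NatExpr.eval, scalar_eval, Nat.le_zero, Nat.add_eq_zero_iff, hd,
        hM.stay] using hb
    unfold Problem.plan
    rwa [if_neg hb']

/-! ### Acting -/

/-- Unless an action has been found, announce the action of kind `c` for the least criterion in the
state of array `b` that is not in the state of array `a`. -/
def findCmd (c a b : ℕ) : Cmd :=
  forLoop 16 (scalar 0)
    (.ite (.natLE (.plus (.plus (.const 1) (scalar 3)) (.read a (scalar 16) (.const 0)))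
        (.read b (scalar 16) (.const 0)))
      (.seq (assign 3 (.const c)) (.setNat 3 (.const 0) (.const 1) (scalar 16)))
      .skip)

/-- If the search for a criterion to withdraw has succeeded, the subsequent search for one to fix
must not overwrite the result: `1 + 1` exceeds any bit. -/
theorem spec_findCmd_of_found {c a b : ℕ} (hk : σ.nat 0 0 0 = k) (hkL : k ≤ L)
    (hb : b ∉ ({3, 16} : Finset ℕ)) {s' : Finset (Fin k)}
    (hs' : Bits (fun j => σ.nat b j 0) s') (h0 : 1 ≤ σ.nat 3 0 0) :
    Spec O L (findCmd c a b) σ fun τ =>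
      τ.nat 3 0 0 = σ.nat 3 0 0 ∧ τ.nat 3 0 1 = σ.nat 3 0 1 := by
  simp only [Finset.mem_insert, Finset.mem_singleton, not_or] at hb
  refine spec_forLoop (fun j τ => τ.nat 3 0 0 = σ.nat 3 0 0 ∧ τ.nat 3 0 1 = σ.nat 3 0 1) k ?_ hkL
    rfl ?_ ?_ ?_
  · simp [hk]
  · simp
  · intro j hj τ hf hj' hI
    have eb : τ.nat b j 0 = if (⟨j, hj⟩ : Fin k) ∈ s' then 1 else 0 := by
      rw [hf.nat b (by simp [forLoop, assign, Cmd.writesNat, Ne.symm hb.1, Ne.symm hb.2])]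
      exact hs' ⟨j, hj⟩
    refine spec_ite (fun hc => ?_) (fun _ => spec_skip ?_)
    · simp only [Test.Holds, NatExpr.eval, scalar_eval, hj', eb, hI.1] at hc
      split_ifs at hc <;> omega
    · simpa using hI
  · exact fun τ _ h => h

/-- The test compares 1 plus the announced kind plus the bit in `a` with the bit in `b`. It succeeds
only if nothing has been announced yet and the criterion lies in the second state but not in the
first; the first success is the least such criterion. -/
theorem spec_findCmd {c a b : ℕ} (hk : σ.nat 0 0 0 = k) (hkL : k ≤ L) (hc : 1 ≤ c)
    (ha : a ∉ ({3, 16} : Finset ℕ)) (hb : b ∉ ({3, 16} : Finset ℕ)) {s s' : Finset (Fin k)}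
    (hs : Bits (fun j => σ.nat a j 0) s) (hs' : Bits (fun j => σ.nat b j 0) s')
    (h0 : σ.nat 3 0 0 = 0) :
    Spec O L (findCmd c a b) σ fun τ => (τ.nat 3 0 0 = 0 ∧ s' ⊆ s) ∨
      (τ.nat 3 0 0 = c ∧ ∃ u ∈ s' \ s, (∀ w ∈ s' \ s, u ≤ w) ∧ τ.nat 3 0 1 = u) := by
  simp only [Finset.mem_insert, Finset.mem_singleton, not_or] at ha hb
  refine spec_forLoop (fun j τ => (τ.nat 3 0 0 = 0 ∧ ∀ w ∈ s' \ s, j ≤ (w : ℕ)) ∨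
      (τ.nat 3 0 0 = c ∧ ∃ u ∈ s' \ s, (∀ w ∈ s' \ s, u ≤ w) ∧ τ.nat 3 0 1 = u)) k ?_ hkL
    rfl ?_ ?_ ?_
  · simp [hk]
  · simp [h0]
  · intro j hj τ hf hj' hI
    have ea : τ.nat a j 0 = if (⟨j, hj⟩ : Fin k) ∈ s then 1 else 0 := by
      rw [hf.nat a (by simp [forLoop, assign, Cmd.writesNat, Ne.symm ha.1, Ne.symm ha.2])]
      exact hs ⟨j, hj⟩
    have eb : τ.nat b j 0 = if (⟨j, hj⟩ : Fin k) ∈ s' then 1 else 0 := by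
      rw [hf.nat b (by simp [forLoop, assign, Cmd.writesNat, Ne.symm hb.1, Ne.symm hb.2])]
      exact hs' ⟨j, hj⟩
    refine spec_ite (fun ht => ?_) (fun ht => spec_skip ?_)
    · simp only [Test.Holds, NatExpr.eval, scalar_eval, hj', ea, eb] at ht
      rcases hI with ⟨h1, h2⟩ | ⟨h1, -⟩
      · refine spec_seq (spec_assign (spec_setNat (.inr ⟨by simp, ⟨j, hj⟩, ?_, ?_, by simp [hj']⟩)))
        · rw [Finset.mem_sdiff]
          split_ifs at ht <;> first | omega | tauto
        · exact fun w hw => h2 w hw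
      · split_ifs at ht <;> omega
    · simp only [Test.Holds, NatExpr.eval, scalar_eval, hj', ea, eb] at ht
      rcases hI with ⟨h1, h2⟩ | h
      · refine .inl ⟨by simpa using h1, fun w hw => ?_⟩
        refine Nat.lt_of_le_of_ne (h2 w hw) fun hjw => ?_
        obtain rfl : w = ⟨j, hj⟩ := Fin.ext hjw.symm
        rw [Finset.mem_sdiff] at hw
        simp [h1, hw.1, hw.2] at ht
      · exact .inr (by simpa using h)
  · rintro τ - (⟨h1, h2⟩ | h)
    · refine .inl ⟨h1, fun w hw => ?_⟩
      by_contra hws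
      exact absurd (h2 w (Finset.mem_sdiff.2 ⟨hw, hws⟩)) (by simp)
    · exact .inr h

theorem moveAction_eq_unfix {s s' : Finset (Fin k)} {u : Fin k} (hu : u ∈ s \ s')
    (h : ∀ w ∈ s \ s', u ≤ w) : moveAction s s' = .unfix u := by
  rcases moveAction_cases s s' with ⟨i, hi, hmin, hm⟩ | ⟨hs, -⟩ | ⟨rfl, -⟩
  · rw [hm, le_antisymm (hmin u hu) (h i hi)]
  · rw [Finset.mem_sdiff] at hu; exact absurd (hs hu.1) hu.2
  · simp at hu

theorem moveAction_eq_fix {s s' : Finset (Fin k)} {u : Fin k} (hs : s ⊆ s') (hu : u ∈ s' \ s)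
    (h : ∀ w ∈ s' \ s, u ≤ w) : moveAction s s' = .fix u := by
  rcases moveAction_cases s s' with ⟨i, hi, -⟩ | ⟨-, i, hi, hmin, hm⟩ | ⟨rfl, -⟩
  · rw [Finset.mem_sdiff] at hi; exact absurd (hs hi.1) hi.2
  · rw [hm, le_antisymm (hmin u hu) (h i hi)]
  · simp at hu

/-- One step towards, or in, the target. -/
def moveCmd : Cmd :=
  .seq (assign 3 (.const 0)) (.seq (findCmd 2 9 8) (.seq (findCmd 1 8 9)
    (.ite (.natLE (scalar 3) (.const 0))
      (assign 10 (.minus (scalar 10) (.const 1)))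
      (.ite (.natLE (scalar 3) (.const 1))
        (.setNat 8 (.read 3 (.const 0) (.const 1)) (.const 0) (.const 1))
        (.setNat 8 (.read 3 (.const 0) (.const 1)) (.const 0) (.const 0))))))

/-- A single bit of the state is updated, also for a fix: the state is then contained in the
independent target, so no neighbour has to be removed. -/
theorem spec_moveCmd {P : Problem k n} {K : List (Finset (Fin k))} {M : Memory k}
    (hk : σ.nat 0 0 0 = k) (hkL : k ≤ L) (hM : MemoryRep K σ M) (hP : P.IsState M.target) :
    Spec O L moveCmd σ fun τ => τ.Announces (moveAction M.state M.target) ∧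
      MemoryRep K τ { M with
        state := P.next M.state (moveAction M.state M.target)
        stay := if M.state = M.target then M.stay - 1 else M.stay } := by
  refine spec_seq (spec_assign (spec_seq ?_))
  refine Spec.imp (spec_findCmd (s := M.target) (s' := M.state) (by simpa using hk) hkL
    (by decide) (by decide) (by decide) (by simpa using hM.target) (by simpa using hM.state)
    (by simp)) ?_
  rintro τ hf (⟨h0, hsub⟩ | ⟨h2, u, hu, hmin, h1⟩)
  · have e8 : τ.nat 8 = σ.nat 8 := by rw [hf.nat 8 rfl]; simp
    have e9 : τ.nat 9 = σ.nat 9 := by rw [hf.nat 9 rfl]; simp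
    have e10 : τ.nat 10 = σ.nat 10 := by rw [hf.nat 10 rfl]; simp
    have e12 : τ.nat 12 = σ.nat 12 := by rw [hf.nat 12 rfl]; simp
    refine spec_seq (Spec.imp (spec_findCmd (s := M.state) (s' := M.target)
      (by rw [hf.nat 0 rfl]; simpa using hk) hkL le_rfl (by decide) (by decide)
      (by rw [e8]; exact hM.state) (by rw [e9]; exact hM.target) h0) ?_)
    rintro υ hυ (⟨h0', hsub'⟩ | ⟨h2, u, hu, hmin, h1⟩)
    · have heq := hsub.antisymm hsub'
      refine spec_ite (fun _ => spec_assign ?_) (fun hb => absurd h0'.le hb)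
      have ha : moveAction M.state M.target = .null := by rw [heq]; simp [moveAction]
      rw [ha, if_pos heq]
      refine ⟨by simpa [Store.Announces] using h0', ?_⟩
      constructor
      · simpa [hυ.nat 8 rfl, e8, Problem.next] using hM.state
      · simpa [hυ.nat 9 rfl, e9] using hM.target
      · simp [hυ.nat 10 rfl, e10, hM.stay]
      · simpa [hυ.nat 12 rfl, e12] using hM.todo
    · have hne : M.state ≠ M.target := fun h => by simp [h] at hu
      have ha := moveAction_eq_fix hsub hu hmin
      refine spec_ite (fun hb => absurd hb (by simp [h2])) (fun _ => ?_)
      refine spec_ite (fun _ => spec_setNat ?_) (fun hb => absurd h2.le hb)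
      rw [ha, if_neg hne, Problem.next_fix_eq_insert hP hsub (Finset.mem_sdiff.1 hu).1]
      refine ⟨by simp [Store.Announces, h1, h2], ?_⟩
      constructor
      · intro j
        have := hM.state j
        by_cases hj : j = u
        · simp [h1, hj]
        · have hj' : (j : ℕ) ≠ u := fun h => hj (Fin.ext h)
          simpa [h1, hj, hj', hυ.nat 8 rfl, e8] using this
      · simpa [hυ.nat 9 rfl, e9] using hM.target
      · simp [hυ.nat 10 rfl, e10, hM.stay]
      · simpa [hυ.nat 12 rfl, e12] using hM.todo
  · have e8 : τ.nat 8 = σ.nat 8 := by rw [hf.nat 8 rfl]; simp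
    have e9 : τ.nat 9 = σ.nat 9 := by rw [hf.nat 9 rfl]; simp
    have e10 : τ.nat 10 = σ.nat 10 := by rw [hf.nat 10 rfl]; simp
    have e12 : τ.nat 12 = σ.nat 12 := by rw [hf.nat 12 rfl]; simp
    refine spec_seq (Spec.imp (spec_findCmd_of_found (s' := M.target)
      (by rw [hf.nat 0 rfl]; simpa using hk) hkL (by decide)
      (by rw [e9]; exact hM.target) (by omega)) ?_)
    rintro υ hυ ⟨h2', h1'⟩
    rw [h2] at h2'
    rw [h1] at h1'
    have hne : M.state ≠ M.target := fun h => by simp [h] at hu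
    have ha := moveAction_eq_unfix hu hmin
    refine spec_ite (fun hb => absurd hb (by simp [h2'])) (fun _ => ?_)
    refine spec_ite (fun hb => absurd hb (by simp [h2'])) (fun _ => spec_setNat ?_)
    rw [ha, if_neg hne]
    refine ⟨by simp [Store.Announces, h1', h2'], ?_⟩
    constructor
    · intro j
      have := hM.state j
      by_cases hj : j = u
      · simp [h1', hj, Problem.next]
      · have hj' : (j : ℕ) ≠ u := fun h => hj (Fin.ext h)
        simpa [h1', hj, hj', hυ.nat 8 rfl, e8, Problem.next] using this
    · simpa [hυ.nat 9 rfl, e9] using hM.target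
    · simp [hυ.nat 10 rfl, e10, hM.stay]
    · simpa [hυ.nat 12 rfl, e12] using hM.todo

end Specs
end FairnessMDP
end

noncomputable section
namespace FairnessMDP

variable {k n : ℕ}

/-! ### Scopes -/

/-- The array `f` is the table of the relation `C`. -/
def Table {k' : ℕ} (f : ℕ → ℕ → ℕ) (C : Fin k' → Fin k → Prop) : Prop :=
  ∀ r j, (C r j → f r j = 1) ∧ (¬ C r j → f r j = 0)

theorem Table.congr {k' : ℕ} {f : ℕ → ℕ → ℕ} {C C' : Fin k' → Fin k → Prop} (h : Table f C)
    (hC : ∀ r j, C r j ↔ C' r j) : Table f C' := fun r j => by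
  rw [← hC r j]; exact h r j

theorem Table.one_le_iff {k' : ℕ} {f : ℕ → ℕ → ℕ} {C : Fin k' → Fin k → Prop} (h : Table f C)
    (r : Fin k') (j : Fin k) : 1 ≤ f r j ↔ C r j := by
  by_cases hC : C r j
  · simp [(h r j).1 hC, hC]
  · simp [(h r j).2 hC, hC]

theorem Table.writeNat {k' a : ℕ} {σ : Store} {C C' : Fin k' → Fin k → Prop}
    (h : Table (σ.nat a) C) (r₀ : Fin k') (j₀ : Fin k)
    (hC : ∀ r j, C' r j ↔ C r j ∨ (r = r₀ ∧ j = j₀)) :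
    Table ((σ.writeNat a r₀ j₀ 1).nat a) C' := by
  intro r j
  rw [hC r j, Store.writeNat_nat_self]
  by_cases he : (r : ℕ) = r₀ ∧ (j : ℕ) = j₀
  · rw [if_pos he]
    exact ⟨fun _ => rfl, fun h => absurd (.inr ⟨Fin.ext he.1, Fin.ext he.2⟩) h⟩
  · rw [if_neg he, or_iff_left fun h => he ⟨congrArg _ h.1, congrArg _ h.2⟩]
    exact h r j

section Specs

variable {O : (Fin k → Finset (Fin k) → ℝ) → Finset (Fin k)} {L : ℕ} {σ : Store}

/-- Computation of the scopes. -/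
def scopeCmd : Cmd :=
  forLoop 15 (scalar 0) (.seq (.setNat 5 (scalar 15) (scalar 15) (.const 1))
    (forLoop 17 (.read 0 (.const 0) (.const 1))
      (.ite (.natLE (.const 1) (.read 2 (scalar 17) (scalar 15)))
        (forLoop 16 (scalar 0) (.ite (.natLE (.const 1) (.read 2 (scalar 17) (scalar 16)))
          (.setNat 5 (scalar 15) (scalar 16) (.const 1)) .skip))
        .skip)))

/-- The invariants of the three nested loops describe what has been found so far: complete rows for
earlier criteria; in the current row the contribution of earlier correlation sets; and of the
current set its first members. -/
theorem spec_scopeCmd {P : Problem k n} (hk : σ.nat 0 0 0 = k) (hn : σ.nat 0 0 1 = n)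
    (hkL : k ≤ L) (hnL : n ≤ L) (hinc : Table (σ.nat 2) fun l u => u ∈ P.corr l)
    (h5 : σ.nat 5 = fun _ _ => 0) :
    Spec O L scopeCmd σ fun τ => Table (τ.nat 5) fun i j => j ∈ P.scope i := by
  have hscope : ∀ i j, j ∈ P.scope i ↔ j = i ∨ ∃ l, i ∈ P.corr l ∧ j ∈ P.corr l := fun i j => by
    simp [Problem.scope]
  refine spec_forLoop (fun i τ => Table (τ.nat 5) fun r j : Fin k => (r : ℕ) < i ∧ j ∈ P.scope r)
    k ?_ hkL rfl ?_ ?_ ?_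
  · simp [hk]
  · intro r j
    simp [h5]
  · intro i hi τ hf hi' hI
    have e0 := hf.nat 0 rfl
    have e2 := hf.nat 2 rfl
    refine spec_seq (spec_setNat ?_)
    refine spec_forLoop (fun l τ => Table (τ.nat 5) fun r j : Fin k =>
      ((r : ℕ) < i ∧ j ∈ P.scope r) ∨ (r = ⟨i, hi⟩ ∧ (j = r ∨
        ∃ l' : Fin n, (l' : ℕ) < l ∧ r ∈ P.corr l' ∧ j ∈ P.corr l'))) n ?_ hnL rfl ?_ ?_ ?_
    · simp [e0, hn]
    · rw [Store.writeNat_nat_of_ne (by decide)]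
      simp only [scalar_eval, hi', NatExpr.eval]
      refine hI.writeNat ⟨i, hi⟩ ⟨i, hi⟩ fun r j => ?_
      simp only [Nat.not_lt_zero, false_and, exists_false, or_false]
      refine or_congr_right ⟨?_, ?_⟩ <;> rintro ⟨rfl, rfl⟩ <;> exact ⟨rfl, rfl⟩
    · intro l hl υ hυ hl' hJ
      have e15 : υ.nat 15 0 0 = i := by rw [hυ.nat 15 rfl]; simpa using hi'
      have e0' : υ.nat 0 = σ.nat 0 := by rw [hυ.nat 0 rfl]; simpa using e0
      have e2' : υ.nat 2 = σ.nat 2 := by rw [hυ.nat 2 rfl]; simpa using e2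
      have hsplit : ∀ r j : Fin k,
          (∃ l' : Fin n, (l' : ℕ) < l + 1 ∧ r ∈ P.corr l' ∧ j ∈ P.corr l') ↔
          (∃ l' : Fin n, (l' : ℕ) < l ∧ r ∈ P.corr l' ∧ j ∈ P.corr l') ∨
            (r ∈ P.corr ⟨l, hl⟩ ∧ j ∈ P.corr ⟨l, hl⟩) := by
        intro r j
        constructor
        · rintro ⟨l', h1, h2⟩
          rcases Nat.lt_succ_iff_lt_or_eq.1 h1 with h3 | h3
          · exact .inl ⟨l', h3, h2⟩
          · obtain rfl : l' = ⟨l, hl⟩ := Fin.ext h3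
            exact .inr h2
        · rintro (⟨l', h1, h2⟩ | h2)
          · exact ⟨l', by omega, h2⟩
          · exact ⟨⟨l, hl⟩, Nat.lt_succ_self l, h2⟩
      have hi2 := hinc.one_le_iff ⟨l, hl⟩ ⟨i, hi⟩
      refine spec_ite (fun hb => ?_) (fun hb => spec_skip ?_)
      · simp only [Test.Holds, NatExpr.eval, scalar_eval, hl', e15, e2', hi2] at hb
        refine spec_forLoop (fun j' τ => Table (τ.nat 5) fun r j : Fin k =>
          (((r : ℕ) < i ∧ j ∈ P.scope r) ∨ (r = ⟨i, hi⟩ ∧ (j = r ∨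
          ∃ l' : Fin n, (l' : ℕ) < l ∧ r ∈ P.corr l' ∧ j ∈ P.corr l'))) ∨
            (r = ⟨i, hi⟩ ∧ (j : ℕ) < j' ∧ j ∈ P.corr ⟨l, hl⟩)) k ?_ hkL rfl ?_ ?_ ?_
        · simp [e0', hk]
        · rw [Store.writeNat_nat_of_ne (by decide)]
          exact hJ.congr fun r j => by simp
        · intro j hj φ hφ hj' hT
          have e15' : φ.nat 15 0 0 = i := by rw [hφ.nat 15 rfl, e15]
          have e17' : φ.nat 17 0 0 = l := by rw [hφ.nat 17 rfl, hl']
          have e2'' : φ.nat 2 = σ.nat 2 := by rw [hφ.nat 2 rfl, e2']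
          have hj2 := hinc.one_le_iff ⟨l, hl⟩ ⟨j, hj⟩
          have hlt : ∀ w : Fin k, (w : ℕ) < j + 1 ↔ (w : ℕ) < j ∨ w = ⟨j, hj⟩ := fun w => by
            rw [Nat.lt_succ_iff_lt_or_eq, Fin.ext_iff]
          refine spec_ite (fun hb => spec_setNat ?_) (fun hb => spec_skip ?_)
          · simp only [Test.Holds, NatExpr.eval, scalar_eval, hj', e17', e2'', hj2] at hb
            rw [Store.writeNat_nat_of_ne (by decide)]
            simp only [scalar_eval, e15', hj', NatExpr.eval]
            refine hT.writeNat ⟨i, hi⟩ ⟨j, hj⟩ fun r w => ?_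
            rw [hlt]
            refine Iff.trans (or_congr_right ⟨?_, ?_⟩) or_assoc.symm
            · rintro ⟨h1, h2 | h2, h3⟩
              · exact .inl ⟨h1, h2, h3⟩
              · exact .inr ⟨h1, h2⟩
            · rintro (⟨h1, h2, h3⟩ | ⟨h1, h2⟩)
              · exact ⟨h1, .inl h2, h3⟩
              · exact ⟨h1, .inr h2, h2 ▸ hb⟩
          · simp only [Test.Holds, NatExpr.eval, scalar_eval, hj', e17', e2'', hj2] at hb
            rw [Store.writeNat_nat_of_ne (by decide)]
            refine hT.congr fun r w => or_congr_right (and_congr_right fun _ => ?_)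
            rw [hlt]
            constructor
            · exact fun h => ⟨.inl h.1, h.2⟩
            · rintro ⟨h1 | h1, h2⟩
              · exact ⟨h1, h2⟩
              · exact absurd (h1 ▸ h2) hb
        · intro φ _ hT
          rw [Store.writeNat_nat_of_ne (by decide)]
          refine hT.congr fun r j => ?_
          rw [hsplit, or_assoc]
          refine or_congr_right ?_
          have : (j : ℕ) < k := j.2
          constructor
          · rintro (⟨rfl, h⟩ | ⟨rfl, -, h⟩)
            · exact ⟨rfl, h.imp_right .inl⟩
            · exact ⟨rfl, .inr (.inr ⟨hb, h⟩)⟩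
          · rintro ⟨rfl, h | h | h⟩
            · exact .inl ⟨rfl, .inl h⟩
            · exact .inl ⟨rfl, .inr h⟩
            · exact .inr ⟨rfl, this, h.2⟩
      · simp only [Test.Holds, NatExpr.eval, scalar_eval, hl', e15, e2', hi2] at hb
        rw [Store.writeNat_nat_of_ne (by decide)]
        refine hJ.congr fun r j => ?_
        rw [hsplit]
        refine or_congr_right (and_congr_right fun hr => or_congr_right ?_)
        subst hr
        simp [hb]
    · intro υ _ hJ
      rw [Store.writeNat_nat_of_ne (by decide)]
      refine hJ.congr fun r j => ?_
      have h1 : ∀ l' : Fin n, (l' : ℕ) < n := fun l' => l'.2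
      simp only [h1, true_and, ← hscope, Nat.lt_succ_iff_lt_or_eq]
      rw [show (r : ℕ) = i ↔ r = ⟨i, hi⟩ by rw [Fin.ext_iff]]
      tauto
  · intro τ _ hI
    exact hI.congr fun r j => by simp

/-! ### The cover -/

/-- The states found from the criteria less than `u` in the scope of `i`. -/
def Problem.scopeStates (P : Problem k n) (i : Fin k) : ℕ → List (Finset (Fin k))
  | 0 => [∅]
  | u + 1 =>
    if h : u < k then
      if ⟨u, h⟩ ∈ P.scope i then
        P.scopeStates i u ++ (P.scopeStates i u).map fun b => P.next b (.fix ⟨u, h⟩)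
      else P.scopeStates i u
    else P.scopeStates i u

/-- The states found for the criteria less than `i`. -/
def Problem.coverStates (P : Problem k n) : ℕ → List (Finset (Fin k))
  | 0 => []
  | i + 1 => if h : i < k then P.coverStates i ++ P.scopeStates ⟨i, h⟩ k else P.coverStates i

theorem Problem.scopeStates_succ (P : Problem k n) (i : Fin k) {u : ℕ} (hu : u < k) :
    P.scopeStates i (u + 1) = if ⟨u, hu⟩ ∈ P.scope i then
        P.scopeStates i u ++ (P.scopeStates i u).map fun b => P.next b (.fix ⟨u, hu⟩)
      else P.scopeStates i u := by
  rw [Problem.scopeStates, dif_pos hu]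

theorem Problem.coverStates_succ (P : Problem k n) {i : ℕ} (hi : i < k) :
    P.coverStates (i + 1) = P.coverStates i ++ P.scopeStates ⟨i, hi⟩ k := by
  rw [Problem.coverStates, dif_pos hi]

theorem Problem.length_scopeStates (P : Problem k n) (i : Fin k) {u : ℕ} (hu : u ≤ k) :
    (P.scopeStates i u).length = 2 ^ (below (P.scope i) u).card := by
  induction u with
  | zero => simp [Problem.scopeStates, below_zero]
  | succ u ih =>
    rw [P.scopeStates_succ i (by omega), below_succ _ (show u < k by omega)]
    split_ifs
    · rw [Finset.card_insert_of_notMem (notMem_below _ _), List.length_append, List.length_map,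
        ih (by omega), pow_succ, mul_two]
    · exact ih (by omega)

theorem Problem.length_scopeStates_le (P : Problem k n) (i : Fin k) {u : ℕ} (hu : u ≤ k) :
    (P.scopeStates i u).length ≤ 2 ^ (P.scope i).card := by
  rw [P.length_scopeStates i hu]
  exact Nat.pow_le_pow_right two_pos (Finset.card_le_card (Finset.filter_subset _ _))

theorem Problem.isState_of_mem_scopeStates (P : Problem k n) (i : Fin k) (u : ℕ) :
    ∀ s ∈ P.scopeStates i u, P.IsState s := by
  induction u with
  | zero => simp [Problem.scopeStates, P.isState_empty]
  | succ u ih =>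
    rw [Problem.scopeStates]
    split_ifs with h1 h2
    · intro s hs
      rw [List.mem_append, List.mem_map] at hs
      rcases hs with hs | ⟨b, hb, rfl⟩
      · exact ih s hs
      · exact (ih b hb).next _
    · exact ih
    · exact ih

/-- An independent `b` is built up in increasing order, and at each criterion of the scope one
branch makes the right choice. Fixing a member of `b` in a part of `b` removes nothing. The other
branches do no harm, as they too consist of states. -/
theorem Problem.below_mem_scopeStates (P : Problem k n) (i : Fin k) {b : Finset (Fin k)}
    (hb : P.IsState b) (hbi : b ⊆ P.scope i) {u : ℕ} (hu : u ≤ k) :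
    below b u ∈ P.scopeStates i u := by
  induction u with
  | zero => simp [Problem.scopeStates, below_zero]
  | succ u ih =>
    have hu' : u < k := by omega
    rw [P.scopeStates_succ i hu', below_succ _ hu']
    have := ih (by omega)
    split_ifs with h1 h2 h2
    · rw [List.mem_append, List.mem_map]
      exact .inr ⟨_, this, Problem.next_fix_eq_insert hb (Finset.filter_subset _ _) h2⟩
    · exact List.mem_append_left _ this
    · exact absurd (hbi h2) h1
    · exact this

theorem Problem.mem_coverStates (P : Problem k n) {s : Finset (Fin k)} {i : ℕ} (hi : i ≤ k) :
    s ∈ P.coverStates i ↔ ∃ u : Fin k, (u : ℕ) < i ∧ s ∈ P.scopeStates u k := by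
  induction i with
  | zero => simp [Problem.coverStates]
  | succ i ih =>
    have hi' : i < k := by omega
    rw [P.coverStates_succ hi', List.mem_append, ih (by omega)]
    constructor
    · rintro (⟨u, h1, h2⟩ | h)
      · exact ⟨u, by omega, h2⟩
      · exact ⟨⟨i, hi'⟩, Nat.lt_succ_self i, h⟩
    · rintro ⟨u, h1, h2⟩
      rcases Nat.lt_succ_iff_lt_or_eq.1 h1 with h3 | h3
      · exact .inl ⟨u, h3, h2⟩
      · obtain rfl : u = ⟨i, hi'⟩ := Fin.ext h3
        exact .inr h2

/-- A local configuration is a subset of a state, hence itself a state, and is its own witness. -/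
theorem Problem.isCover_coverStates (P : Problem k n) : P.IsCover (P.coverStates k) := by
  constructor
  · intro s hs
    obtain ⟨u, -, hu⟩ := (P.mem_coverStates le_rfl).1 hs
    exact P.isState_of_mem_scopeStates u k s hu
  · intro s hs i
    refine ⟨s ∩ P.scope i, (P.mem_coverStates le_rfl).2 ⟨i, i.2, ?_⟩, ?_⟩
    · have := P.below_mem_scopeStates i (hs.mono Finset.inter_subset_left)
        (Finset.inter_subset_right (s₁ := s)) le_rfl
      rwa [below_card] at this
    · rw [Finset.inter_assoc, Finset.inter_self]

theorem Problem.length_coverStates (P : Problem k n) :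
    (P.coverStates k).length = ∑ i, 2 ^ (P.scope i).card := by
  have : ∀ i ≤ k, (P.coverStates i).length = ∑ u ∈ below Finset.univ i, 2 ^ (P.scope u).card := by
    intro i
    induction i with
    | zero => simp [Problem.coverStates, below_zero]
    | succ i ih =>
      intro hi
      rw [P.coverStates_succ (by omega), List.length_append, ih (by omega),
        sum_below_succ _ (show i < k by omega), P.length_scopeStates _ le_rfl, below_card]
      simp
  rw [this k le_rfl, below_card]

/-- The list of states in arrays `6` and `7`. -/
structure RowsRep (σ : Store) (K : List (Finset (Fin k))) : Prop where
  length : σ.nat 7 0 0 = K.length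
  rows : ∀ r, Bits (σ.nat 6 r) (K.getD r ∅)

theorem RowsRep.writeNat {K : List (Finset (Fin k))} (h : RowsRep σ K) {a : ℕ} (i j v : ℕ)
    (h6 : a ≠ 6) (h7 : a ≠ 7) : RowsRep (σ.writeNat a i j v) K := by
  constructor
  · rw [Store.writeNat_nat_of_ne h7.symm]; exact h.length
  · rw [Store.writeNat_nat_of_ne h6.symm]; exact h.rows

theorem getD_append_singleton (K : List (Finset (Fin k))) (b : Finset (Fin k)) (r : ℕ) :
    (K ++ [b]).getD r ∅ = if r = K.length then b else K.getD r ∅ := by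
  split_ifs with h
  · subst h; simp
  · rcases lt_or_gt_of_ne h with h | h
    · rw [List.getD_append _ _ _ _ h]
    · rw [List.getD_eq_default _ _ (by simp; omega), List.getD_eq_default _ _ (by omega)]

/-- Append to the list the state that results if the criterion in variable `17` is fixed in the
state number `18` of those beginning with number `19`. -/
def appendCmd : Cmd :=
  .seq (forLoop 16 (scalar 0) (.setNat 6 (scalar 7) (scalar 16)
    (.minus (.read 6 (.plus (scalar 19) (scalar 18)) (scalar 16))
      (.read 1 (scalar 17) (scalar 16)))))
    (.seq (.setNat 6 (scalar 7) (scalar 17) (.const 1))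
      (assign 7 (.plus (scalar 7) (.const 1))))

/-- Truncated subtraction of the adjacency row of `u` from the bits deletes the neighbours of `u`;
then the bit of `u` is set. -/
theorem spec_appendCmd {P : Problem k n} {K : List (Finset (Fin k))} {u : Fin k} {r : ℕ}
    (hk : σ.nat 0 0 0 = k) (hkL : k ≤ L) (hadj : Table (σ.nat 1) P.graph.Adj) (hK : RowsRep σ K)
    (hu : σ.nat 17 0 0 = u) (hr : σ.nat 19 0 0 + σ.nat 18 0 0 = r) (hrK : r < K.length) :
    Spec O L appendCmd σ fun τ => RowsRep τ (K ++ [P.next (K.getD r ∅) (.fix u)]) := by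
  refine spec_seq ?_
  refine spec_forLoop (fun j τ => (∀ q ≠ K.length, Bits (τ.nat 6 q) (K.getD q ∅)) ∧
    ∀ w : Fin k, (w : ℕ) < j →
      ((w ∈ K.getD r ∅ ∧ ¬ P.graph.Adj u w) → τ.nat 6 K.length w = 1) ∧
      (¬ (w ∈ K.getD r ∅ ∧ ¬ P.graph.Adj u w) → τ.nat 6 K.length w = 0)) k ?_ hkL rfl ?_ ?_ ?_
  · simp [hk]
  · exact ⟨fun q _ => by simpa using hK.rows q, by simp⟩
  · rintro j hj τ hf hj' ⟨h1, h2⟩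
    have e7 : τ.nat 7 0 0 = K.length := by rw [hf.nat 7 rfl]; exact hK.length
    have e17 : τ.nat 17 0 0 = u := by rw [hf.nat 17 rfl]; exact hu
    have er : τ.nat 19 0 0 + τ.nat 18 0 0 = r := by rw [hf.nat 18 rfl, hf.nat 19 rfl]; exact hr
    have hrow := h1 r hrK.ne ⟨j, hj⟩
    simp only at hrow
    have ha := hadj u ⟨j, hj⟩
    rw [← hf.nat 1 rfl] at ha
    refine spec_setNat ⟨?_, ?_⟩
    · intro q hq w
      have := h1 q hq w
      simpa [e7, hq] using this
    · intro w hw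
      by_cases hwj : (w : ℕ) = j
      · obtain rfl : w = ⟨j, hj⟩ := Fin.ext hwj
        simp only [Store.writeNat_nat_of_ne (show 6 ≠ 16 by decide), Store.writeNat_nat_self,
          NatExpr.eval, scalar_eval, e7, e17, er, hj', hrow, and_self, if_true]
        by_cases hA : P.graph.Adj u ⟨j, hj⟩
        · rw [ha.1 hA]
          refine ⟨fun h => absurd hA h.2, fun _ => ?_⟩
          split_ifs <;> rfl
        · rw [ha.2 hA]
          refine ⟨fun h => by rw [if_pos h.1], fun h => ?_⟩
          rw [if_neg fun h' => h ⟨h', hA⟩]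
      · simpa [e7, hj', hwj] using h2 w (by omega)
  · rintro τ hf ⟨h1, h2⟩
    have e7 : τ.nat 7 0 0 = K.length := by rw [hf.nat 7 rfl]; exact hK.length
    have e17 : τ.nat 17 0 0 = u := by rw [hf.nat 17 rfl]; exact hu
    refine spec_seq (spec_setNat (spec_assign ⟨by simp [e7], fun q w => ?_⟩))
    have hnext : w ∈ P.next (K.getD r ∅) (.fix u) ↔
        w = u ∨ (w ∈ K.getD r ∅ ∧ ¬ P.graph.Adj u w) := by simp [Problem.next]
    have hget := getD_append_singleton K (P.next (K.getD r ∅) (.fix u)) q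
    simp only [Store.writeNat_nat_of_ne (show 6 ≠ 7 by decide), Store.writeNat_nat_self,
      NatExpr.eval, scalar_eval, e7, e17]
    by_cases hq : q = K.length
    · rw [if_pos hq] at hget
      rw [hget]
      subst hq
      by_cases hw : w = u
      · rw [if_pos ⟨rfl, congrArg _ hw⟩, if_pos (hnext.2 (.inl hw))]
      · rw [if_neg fun h => hw (Fin.ext h.2)]
        by_cases hc : w ∈ K.getD r ∅ ∧ ¬ P.graph.Adj u w
        · rw [(h2 w w.2).1 hc, if_pos (hnext.2 (.inr hc))]
        · rw [(h2 w w.2).2 hc, if_neg fun h => (hnext.1 h).elim hw hc]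
    · rw [if_neg hq] at hget
      rw [hget, if_neg fun h => hq h.1]
      exact h1 q hq w

/-- Computation of a cover. -/
def coverCmd : Cmd :=
  forLoop 15 (scalar 0) (.seq (assign 19 (scalar 7))
    (.seq (assign 7 (.plus (scalar 7) (.const 1)))
      (forLoop 17 (scalar 0) (.ite (.natLE (.const 1) (.read 5 (scalar 15) (scalar 17)))
        (forLoop 18 (.minus (scalar 7) (scalar 19)) appendCmd) .skip))))

/-- The bound of the innermost loop is the number of states found for the current criterion when the
loop starts. States appended meanwhile do not prolong it, so the list exactly doubles. -/
theorem spec_coverCmd {P : Problem k n} (hk : σ.nat 0 0 0 = k) (hkL : k ≤ L)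
    (hL : ∀ i, 2 ^ (P.scope i).card ≤ L) (hadj : Table (σ.nat 1) P.graph.Adj)
    (hscope : Table (σ.nat 5) fun i j => j ∈ P.scope i) (hK : RowsRep (k := k) σ []) :
    Spec O L coverCmd σ fun τ => RowsRep τ (P.coverStates k) := by
  refine spec_forLoop (fun i τ => RowsRep τ (P.coverStates i)) k ?_ hkL rfl ?_ ?_ ?_
  · simp [hk]
  · exact hK.writeNat _ _ _ (by decide) (by decide)
  · intro i hi τ hf hi' hI
    have e0 := hf.nat 0 rfl
    have e1 := hf.nat 1 rfl
    have e5 := hf.nat 5 rfl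
    refine spec_seq (spec_assign (spec_seq (spec_assign ?_)))
    refine spec_forLoop (fun u τ => RowsRep τ (P.coverStates i ++ P.scopeStates ⟨i, hi⟩ u)) k ?_ hkL
      rfl ?_ ?_ ?_
    · simp [e0, hk]
    · refine RowsRep.writeNat ?_ _ _ _ (by decide) (by decide)
      constructor
      · simp [hI.length, Problem.scopeStates]
      · intro q
        -- Rows beyond the end of the list are zero and so represent `∅`; appending the initial
        -- state `∅` only needs the length to be increased.
        rw [Problem.scopeStates, getD_append_singleton]
        have := hI.rows q
        split_ifs with hq
        · rw [List.getD_eq_default _ _ hq.ge] at this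
          simpa using this
        · simpa using this
    · intro u hu υ hυ hu' hJ
      have e15 : υ.nat 15 0 0 = i := by rw [hυ.nat 15 rfl]; simpa using hi'
      have e19 : υ.nat 19 0 0 = (P.coverStates i).length := by
        rw [hυ.nat 19 rfl]; simpa using hI.length
      have e0' : υ.nat 0 = σ.nat 0 := by rw [hυ.nat 0 rfl]; simpa using e0
      have e1' : υ.nat 1 = σ.nat 1 := by rw [hυ.nat 1 rfl]; simpa using e1
      have e5' : υ.nat 5 = σ.nat 5 := by rw [hυ.nat 5 rfl]; simpa using e5
      have hmem := hscope.one_le_iff ⟨i, hi⟩ ⟨u, hu⟩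
      refine spec_ite (fun hb => ?_) (fun hb => spec_skip ?_)
      · simp only [Test.Holds, NatExpr.eval, scalar_eval, e15, hu', e5', hmem] at hb
        rw [P.scopeStates_succ _ hu, if_pos hb]
        set S := P.scopeStates ⟨i, hi⟩ u with hS
        refine spec_forLoop (fun r τ => RowsRep τ (P.coverStates i ++ S ++
          (S.take r).map fun b => P.next b (.fix ⟨u, hu⟩))) S.length ?_ ?_ rfl ?_ ?_ ?_
        · simp [e19, hJ.length]
        · exact (P.length_scopeStates_le _ hu.le).trans (hL _)
        · simpa using hJ.writeNat _ _ _ (by decide) (by decide)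
        · intro r hr φ hφ hr' hR
          have hlen : (P.coverStates i).length + r < (P.coverStates i ++ S ++
              (S.take r).map fun b => P.next b (.fix ⟨u, hu⟩)).length := by simp; omega
          refine Spec.imp (spec_appendCmd (P := P) (u := ⟨u, hu⟩)
            (r := (P.coverStates i).length + r) ?_ hkL ?_ hR ?_ ?_ hlen) ?_
          · rw [hφ.nat 0 rfl, e0', hk]
          · rw [hφ.nat 1 rfl, e1']; exact hadj
          · rw [hφ.nat 17 rfl, hu']
          · rw [hφ.nat 19 rfl, e19, hr']
          · intro ψ _ hψ
            refine RowsRep.writeNat ?_ _ _ _ (by decide) (by decide)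
            have hget : (P.coverStates i ++ S ++
                (S.take r).map fun b => P.next b (.fix ⟨u, hu⟩)).getD
                  ((P.coverStates i).length + r) ∅ = S[r] := by
              rw [List.append_assoc, List.getD_append_right _ _ _ _ (by omega),
                Nat.add_sub_cancel_left, List.getD_append _ _ _ _ hr, List.getD_eq_getElem _ _ hr]
            rw [hget] at hψ
            rw [List.take_add_one, List.getElem?_eq_getElem hr, Option.toList_some, List.map_append,
              List.map_singleton, ← List.append_assoc]
            exact hψ
        · intro φ _ hφ
          rw [List.take_length, List.append_assoc] at hφ
          exact hφ.writeNat _ _ _ (by decide) (by decide)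
      · simp only [Test.Holds, NatExpr.eval, scalar_eval, e15, hu', e5', hmem] at hb
        rw [P.scopeStates_succ _ hu, if_neg hb]
        exact hJ.writeNat _ _ _ (by decide) (by decide)
    · intro υ _ hJ
      rw [P.coverStates_succ hi]
      exact hJ.writeNat _ _ _ (by decide) (by decide)
  · exact fun τ _ h => h

end Specs
end FairnessMDP
end

noncomputable section
namespace FairnessMDP

variable {k n : ℕ}

/-! ### The program -/

/-- Implementation of the algorithm, with the cover `Problem.coverStates`. -/
def program : OnlineProgram where
  setup := .seq scopeCmd (.seq coverCmd (.seq planCmd moveCmd))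
  round := .seq recordCmd (.seq planCmd moveCmd)

theorem StaticRep.supply {P : Problem k n} {p : Params} {K : List (Finset (Fin k))} {σ : Store}
    (h : StaticRep P p K σ) (y : Fin k → ℝ) : StaticRep P p K (σ.supply y) where
  card := h.card
  m := h.m
  T := h.T
  B := by simp [Store.supply, h.B]
  δ := by simp [Store.supply, h.δ]
  scope := h.scope
  length := h.length
  cover := h.cover

theorem SeenRep.supply {P : Problem k n} {p : Params} {σ : Store}
    {seen : List (Finset (Fin k) × (Fin k → ℝ))} (h : SeenRep P p σ seen) (y : Fin k → ℝ) :
    SeenRep P p (σ.supply y) seen where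
  visits := h.visits
  loss := by simp [Store.supply, h.loss]
  estimate := by simp [Store.supply, h.estimate]

theorem MemoryRep.supply {K : List (Finset (Fin k))} {σ : Store} {M : Memory k}
    (h : MemoryRep K σ M) (y : Fin k → ℝ) : MemoryRep K (σ.supply y) M :=
  ⟨h.state, h.target, h.stay, h.todo⟩

section Specs

variable {O : (Fin k → Finset (Fin k) → ℝ) → Finset (Fin k)} {L : ℕ} {σ : Store}
  {P : Problem k n} {p : Params} {K : List (Finset (Fin k))} {M : Memory k}

/-- The store when an action of the algorithm is announced: `M` is the memory before the action
is planned. -/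
structure Announced (P : Problem k n) (p : Params) (K : List (Finset (Fin k)))
    (O : (Fin k → Finset (Fin k) → ℝ) → Finset (Fin k)) (M : Memory k) (τ : Store) : Prop where
  static : StaticRep P p K τ
  seen : SeenRep P p τ M.seen
  announces : τ.Announces (moveAction (P.plan p O M).state (P.plan p O M).target)
  memory : ∀ x, MemoryRep K τ (P.perform (P.plan p O M) x)

theorem spec_planCmd_moveCmd (hk : 1 ≤ k) (hkL : k ≤ L) (hst : StaticRep P p K σ)
    (hseen : SeenRep P p σ M.seen) (hM : MemoryRep K σ M) (hP : P.IsState (P.plan p O M).target) :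
    Spec O L (.seq planCmd moveCmd) σ (Announced P p K O M) := by
  refine spec_seq ((spec_planCmd hk hkL hst hseen hM).imp fun τ hτ hM' => ?_)
  have hst' : StaticRep P p K τ := hst.frame hτ
  have hseen' : SeenRep P p τ M.seen := hseen.frame hτ
  refine (spec_moveCmd hst'.card hkL hM' hP).imp fun υ hυ h => ?_
  exact ⟨hst'.frame hυ, hseen'.frame hυ, h.1, fun _ => ⟨h.2.state, h.2.target, h.2.stay, h.2.todo⟩⟩

/-- The store already contains the state reached by the announced action. Only the observation of
that time step is missing; it is recorded before the next action is planned. -/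
theorem spec_round {x : Finset (Fin k) → Fin k → ℝ} (hk : 1 ≤ k) (hkL : k ≤ L)
    (hσ : Announced P p K O M σ)
    (hP : P.IsState (P.plan p O (P.perform (P.plan p O M) x)).target) :
    Spec O L program.round (σ.supply (x (P.perform (P.plan p O M) x).state))
      (Announced P p K O (P.perform (P.plan p O M) x)) := by
  have hst := hσ.static.supply (x (P.perform (P.plan p O M) x).state)
  have hM := (hσ.memory x).supply (x (P.perform (P.plan p O M) x).state)
  refine spec_seq ((spec_recordCmd hkL hst (hσ.seen.supply _) hM.state
    (y := x (P.perform (P.plan p O M) x).state) fun i => ?_).imp fun τ hτ hseen => ?_)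
  · simp [Store.supply]
  · refine spec_planCmd_moveCmd hk hkL (hst.frame hτ) ?_ (hM.frame hτ) hP
    have : (P.perform (P.plan p O M) x).seen
        = ((P.perform (P.plan p O M) x).state, x (P.perform (P.plan p O M) x).state) :: M.seen := by
      rw [← P.plan_seen (p := p) (O := O) M]; rfl
    rw [this]
    exact hseen

theorem spec_setup (x : ℕ → Finset (Fin k) → Fin k → ℝ) (hk : 1 ≤ k) (hkL : k ≤ L) (hnL : n ≤ L)
    (hL : ∀ i, 2 ^ (P.scope i).card ≤ L)
    (hP : P.IsState (P.plan p O (P.run p (P.coverStates k) O x 0)).target) :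
    Spec O L program.setup (inputStore P p)
      (Announced P p (P.coverStates k) O (P.run p (P.coverStates k) O x 0)) := by
  refine spec_seq ((spec_scopeCmd rfl rfl hkL hnL (P := P) (fun l u => ?_) ?_).imp
    fun σ hσ hscope => spec_seq ((spec_coverCmd (P := P) ?_ hkL hL ?_ hscope ?_).imp
    fun τ hτ hcover => ?_))
  · simp [inputStore, Fin.val_inj]
  · simp [inputStore]
  · rw [hσ.nat 0 rfl]; rfl
  · rw [hσ.nat 1 rfl]
    intro u v
    simp [inputStore, Fin.val_inj]
  · constructor
    · rw [hσ.nat 7 rfl]; rfl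
    · rw [hσ.nat 6 rfl]
      intro r j
      simp [inputStore]
  have hn : ∀ a, scopeCmd.writesNat a = false → coverCmd.writesNat a = false →
      τ.nat a = (inputStore P p).nat a := fun a h1 h2 => by rw [hτ.nat a h2, hσ.nat a h1]
  have hr : ∀ a, scopeCmd.writesReal a = false → coverCmd.writesReal a = false →
      τ.real a = (inputStore P p).real a := fun a h1 h2 => by rw [hτ.real a h2, hσ.real a h1]
  refine spec_planCmd_moveCmd hk hkL ?_ ?_ ?_ hP
  · refine ⟨?_, ?_, ?_, ?_, ?_, fun i j => ?_, hcover.length, hcover.rows⟩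
    · rw [hn 0 rfl rfl]; rfl
    · rw [hn 0 rfl rfl]; rfl
    · rw [hn 0 rfl rfl]; rfl
    · rw [hr 0 rfl rfl]; simp [inputStore]
    · rw [hr 0 rfl rfl]; simp [inputStore]
    · rw [hτ.nat 5 rfl]
      split_ifs with h
      · exact (hscope i j).1 h
      · exact (hscope i j).2 h
  · constructor <;> intro i b
    · rw [hn 11 rfl rfl]; simp [inputStore, Problem.run, Problem.visits]
    · rw [hr 4 rfl rfl]; simp [inputStore, Problem.run, Problem.lossSum]
    -- Division by zero gives zero, so the zero table is the correct table of estimates before any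
    -- observation.
    · rw [hr 3 rfl rfl]
      simp [inputStore, Problem.run, Problem.optimistic, Problem.lossSum, Problem.visits]
  · constructor
    · rw [hn 8 rfl rfl]; intro j; simp [inputStore, Problem.run]
    · rw [hn 9 rfl rfl]; intro j; simp [inputStore, Problem.run]
    · rw [hn 10 rfl rfl]; simp [inputStore, Problem.run]
    · rw [hn 12 rfl rfl]; simp [inputStore, Problem.run]

/-- The program implements the algorithm, with the bounds of the program logic on the number of
steps. -/
theorem program_implements (hO : P.IsOracle O) (hk : 1 ≤ k) (hkL : k ≤ L) (hnL : n ≤ L)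
    (hL : ∀ i, 2 ^ (P.scope i).card ≤ L) :
    program.Implements P p (P.coverStates k) O
      ((program.setup.bound L + program.round.bound L : ℕ) : ℝ) := by
  intro x t y r
  have hvalid : ∀ t, P.IsState (P.plan p O (P.run p (P.coverStates k) O x t)).target := fun t =>
    ((P.validMemory_run hO P.isCover_coverStates.1 t).plan hO).2.1
  have key : ∀ t, Announced P p (P.coverStates k) O (P.run p (P.coverStates k) O x t)
      (program.exec O (inputStore P p) y t).1 ∧
      (program.exec O (inputStore P p) y t).2 ≤ program.setup.bound L + program.round.bound L := by
    intro t
    induction t with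
    | zero =>
      have h := spec_setup (L := L) x hk hkL hnL hL (hvalid 0)
      exact ⟨h.1, h.2.trans (Nat.le_add_right _ _)⟩
    | succ t ih =>
      have h := spec_round (L := L) (x := x t) hk hkL ih.1 (hvalid (t + 1))
      exact ⟨h.1, h.2.trans (Nat.le_add_left _ _)⟩
  exact ⟨(key t).1.announces, by exact_mod_cast (key t).2⟩

end Specs

/-! ### Size of the instance -/

/-- Since the correlation sets are distinct, at most one is empty; every other one is counted at one
of its members, and each member lies in at most `D * k` of them. -/
theorem Problem.card_corr_le {P : Problem k n} {m D : ℕ} (hk : 1 ≤ k) (h : P.IsSparse m D) :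
    n ≤ 1 + D * k ^ 2 := by
  classical
  have hdeg : ∀ i : Fin k, (Finset.univ.filter fun j => i ∈ P.corr j).card ≤ D * k := fun i => by
    have hlog : Real.logb 2 k ≤ k := by
      rw [Real.logb_le_iff_le_rpow (by norm_num) (by exact_mod_cast hk), Real.rpow_natCast]
      exact_mod_cast Nat.lt_two_pow_self.le
    have := (h.degree_le i).trans (mul_le_mul_of_nonneg_left hlog D.cast_nonneg)
    exact_mod_cast this
  have hempty : (Finset.univ.filter fun j => P.corr j = ∅).card ≤ 1 :=
    Finset.card_le_one.2 fun a ha b hb => h.injective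
      ((Finset.mem_filter.1 ha).2.trans (Finset.mem_filter.1 hb).2.symm)
  have hsub : (Finset.univ.filter fun j => ¬ P.corr j = ∅)
      ⊆ Finset.univ.biUnion fun i => Finset.univ.filter fun j => i ∈ P.corr j := fun j hj => by
    obtain ⟨i, hi⟩ := Finset.nonempty_iff_ne_empty.2 (Finset.mem_filter.1 hj).2
    exact Finset.mem_biUnion.2 ⟨i, Finset.mem_univ i, by simpa using hi⟩
  have hne := (Finset.card_le_card hsub).trans
    (Finset.card_biUnion_le_card_mul _ _ _ fun i _ => hdeg i)
  have := Finset.card_filter_add_card_filter_not (s := (Finset.univ : Finset (Fin n)))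
    (fun j => P.corr j = ∅)
  simp only [Finset.card_univ, Fintype.card_fin] at this hne
  nlinarith

/-- The program takes a polynomial number of steps per action. -/
theorem program_polynomial (D : ℕ) :
    ∃ (E : ℝ) (q : ℕ), 2 ≤ E ∧ ∀ (k n m : ℕ) (P : Problem k n), 1 ≤ k → P.IsSparse m D →
      ∀ (p : Params) (O : (Fin k → Finset (Fin k) → ℝ) → Finset (Fin k)), P.IsOracle O →
        program.Implements P p (P.coverStates k) O (E * ((k : ℝ) ^ (m + 1)) ^ q) := by
  obtain ⟨C, d, hCd⟩ := program.setup.exists_bound_le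
  obtain ⟨C', d', hCd'⟩ := program.round.exists_bound_le
  -- The summand 2 lets the same constant serve for the size of the cover.
  refine ⟨((C * (D + 2) ^ d + C' * (D + 2) ^ d' + 2 : ℕ) : ℝ), (D + 2) * (d + d'),
    by exact_mod_cast Nat.le_add_left _ _, fun k n m P hk h p O hO x t => ?_⟩
  -- The exponent is large enough for `X` to dominate `k`, `k ^ 2` and `k ^ (D * (m - 1))`. Thus `(D
  -- + 2) * X` bounds the passes of all loops: `k`, `n ≤ 1 + D * k ^ 2` and the number of local
  -- configurations at a criterion.
  set X := k ^ ((m + 1) * (D + 2)) with hX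
  have hX1 : 1 ≤ X := Nat.one_le_pow _ _ hk
  have hX' : ∀ e ≤ (m + 1) * (D + 2), k ^ e ≤ X := fun e he => Nat.pow_le_pow_right hk he
  have hkL : k ≤ (D + 2) * X := by
    have := hX' 1 (by nlinarith)
    rw [pow_one] at this
    nlinarith
  have hnL : n ≤ (D + 2) * X := by
    have h1 := P.card_corr_le hk h
    have h2 := hX' 2 (by nlinarith)
    nlinarith
  have hL : ∀ i, 2 ^ (P.scope i).card ≤ (D + 2) * X := fun i => by
    have h1 : 2 ^ (P.scope i).card ≤ 2 * k ^ (D * (m - 1)) := by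
      exact_mod_cast P.two_pow_card_scope_le hk h i
    have h2 := hX' (D * (m - 1)) (by nlinarith [Nat.sub_le m 1])
    nlinarith
  have hr := program_implements (p := p) hO hk hkL hnL hL x t
  refine ⟨hr.1, hr.2.trans ?_⟩
  have hpow : ∀ C e, e ≤ d + d' → C * ((D + 2) * X) ^ e
      ≤ C * (D + 2) ^ e * (k ^ (m + 1)) ^ ((D + 2) * (d + d')) := fun C e he => by
    rw [mul_pow, mul_assoc, hX, ← pow_mul, ← pow_mul, mul_assoc (m + 1)]
    gcongr
  have h1 := (hCd ((D + 2) * X) (by nlinarith)).trans (hpow C d (by omega))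
  have h2 := (hCd' ((D + 2) * X) (by nlinarith)).trans (hpow C' d' (by omega))
  have : program.setup.bound ((D + 2) * X) + program.round.bound ((D + 2) * X)
      ≤ (C * (D + 2) ^ d + C' * (D + 2) ^ d' + 2) * (k ^ (m + 1)) ^ ((D + 2) * (d + d')) := by
    refine (add_le_add h1 h2).trans ?_
    rw [← add_mul]
    exact Nat.mul_le_mul_right _ (Nat.le_add_right _ _)
  exact_mod_cast this

end FairnessMDP
end

/-! ### The main theorem: regret and running time combined -/

theorem mainTheorem5 (D : ℕ) (hD : 1 ≤ D) :
    -- regret, for every cover of size `O(k ^ (D * m + 1))`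
    (∀ E : ℝ, ∃ A : ℝ, ∀ (k n m T : ℕ) (P : FairnessMDP.Problem k n) (B c : ℝ)
      (K : List (Finset (Fin k))) (O : (Fin k → Finset (Fin k) → ℝ) → Finset (Fin k))
      (θ : Fin n → Finset (Fin k) → ℝ) (π : Finset (Fin k) → FairnessMDP.Action k)
      (Ω : Type*) [MeasurableSpace Ω] (Pr : MeasureTheory.Measure Ω)
      [MeasureTheory.IsProbabilityMeasure Pr] (ℓ : ℕ → Finset (Fin k) → Fin k → Ω → ℝ),
      1 ≤ k → 1 ≤ m → 2 ≤ T → 0 ≤ B → 1 ≤ c + B →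
      (∀ i, 0 ≤ P.fixCost i ∧ P.fixCost i ≤ c) →
      P.IsSparse m D →
      P.IsCover K → (K.length : ℝ) ≤ E * (k : ℝ) ^ (D * m + 1) →
      P.IsOracle O → (∀ s, MeasurableSet {γ | O γ = s}) →
      P.IsLossModel θ B Pr ℓ →
      P.IsOptimalPolicy θ π →
      let p : FairnessMDP.Params := { m := m, T := T, B := B, δ := 1 / (T : ℝ) ^ 4 }
      (∀ t, MeasureTheory.Integrable (fun ω => P.algLoss p K O (fun t s i => ℓ t s i ω) t) Pr) ∧
      P.pseudoRegret p K O π Pr ℓ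
        ≤ A * m * (k : ℝ) ^ (2 * D * m + 2) * (c + B) ^ 2 * √(T : ℝ) * Real.log T) ∧
    -- running time, including the computation of such a cover
    (∃ (prog : FairnessMDP.OnlineProgram) (E : ℝ) (q : ℕ), ∀ (k n m : ℕ)
      (P : FairnessMDP.Problem k n), 1 ≤ k → 1 ≤ m → P.IsSparse m D →
      ∃ K : List (Finset (Fin k)), P.IsCover K ∧ (K.length : ℝ) ≤ E * (k : ℝ) ^ (D * m + 1) ∧
        ∀ (T : ℕ) (B δ : ℝ) (O : (Fin k → Finset (Fin k) → ℝ) → Finset (Fin k)),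
          P.IsOracle O →
          prog.Implements P { m := m, T := T, B := B, δ := δ } K O
            (E * ((k : ℝ) ^ (m + 1)) ^ q)) := by
  refine ⟨fun E => ⟨4 * max E 0 + 600, ?_⟩, ?_⟩
  · intro k n m T P B c K O θ π Ω _ Pr _ ℓ hk hm hT hB hcB hc hP hK hKE hO hO' hℓ hπ
    exact P.regret_bound D hD E K O θ π Pr ℓ hk hm hT hB hcB hc hP hK hKE hO hO' hℓ hπ
  · obtain ⟨E, q, hE, h⟩ := FairnessMDP.program_polynomial D
    refine ⟨FairnessMDP.program, E, q, fun k n m P hk hm hP =>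
      ⟨P.coverStates k, P.isCover_coverStates, ?_, fun T B δ O hO => h k n m P hk hP _ O hO⟩⟩
    have hk' : (1 : ℝ) ≤ k := by exact_mod_cast hk
    rw [P.length_coverStates]
    push_cast
    calc ∑ i, (2 : ℝ) ^ (P.scope i).card ≤ 2 * (k : ℝ) ^ (D * m) :=
          P.sum_two_pow_card_scope_le hk hm hD hP
      _ ≤ E * (k : ℝ) ^ (D * m + 1) := mul_le_mul hE
          (pow_le_pow_right₀ hk' (Nat.le_succ _)) (by positivity) (by linarith)
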